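/- **Setting.** Let $K<\mathrm{SO}(3)$ be one of the rotation groups $\mathbb D_n$ ($n\ge 2$), $\mathbb T,\mathbb O,\mathbb I$ (dihedral, tetrahedral, octahedral, icosahedral), let $m=|K|$, and let $\mathcal F[K]\subset S^2$ be the (finite) set of points with non-trivial isotropy in $K$. Let $F\subset\mathcal F[K]$ be a $K$-invariant subset, and put $N=m+|F|$. Choose orderings $g_1,\dots,g_m$ of $K$ and $f_{m+1},\dots,f_N$ of $F$, let $$H(v)=-\tfrac12\sum_{i<j}\ln|v_j-v_i|^2,\qquad h_{(K,F)}(u)=H(g_1u,\dots,g_mu,f_{m+1},\dots,f_N),\quad u\in S^2\setminus\mathcal F[K]$$ (this does not depend on the orderings), and call $$\dot u=-\frac1m\,u\times\nabla_u h_{(K,F)}(u)\qquad\text{on } S^2\setminus\mathcal F[K]$$ the reduced system. The energy of a solution is the constant value of $h_{(K,F)}$ along it. Points of $\mathcal F[K]$ are called collision points. A periodic orbit is the orbit of a non-constant periodic solution, and period means minimal period. A *family of periodic orbits around* $u_0\in S^2$, parametrised by the energies in an open interval $I$, is a family of periodic solutions $\gamma_e$, $e\in I$, such that $\gamma_e$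 has energy $e$, $\gamma_e(t)$ is jointly continuous in $(e,t)$, the orbits shrink to $u_0$ as $e$ tends to one end $e_0$ of $I$, and, for every $e\in I$, the point $u_0$ together with the orbits of energy strictly between $e_0$ and $e$ is an open subset of $S^2$ whose boundary is the orbit of $\gamma_e$. **Proposition.** The following hold for the reduced system. 1. A point of $S^2\setminus\mathcal F[K]$ is an equilibrium if and only if it is a critical point of $h_{(K,F)}:S^2\setminus\mathcal F[K]\to\mathbb R$. Every local minimum (respectively local maximum) $u_0$ of $h_{(K,F)}$ is a Lyapunov stable equilibrium, and for some $\varepsilon>0$ there is a family of periodic orbits around $u_0$, parametrised by the energies in $(h_{(K,F)}(u_0),h_{(K,F)}(u_0)+\varepsilon)$ (respectively $(h_{(K,F)}(u_0)-\varepsilon,h_{(K,F)}(u_0))$), which shrink to $u_0$ as the energy tends to $h_{(K,F)}(u_0)$. Every saddle point, that is, every critical point which is not a local extremum, is an equilibrium that is not Lyapunov stable. 2. If the level set $\{u\in S^2\setminus\mathcal F[K]: h_{(K,F)}(u)=c\}$ contains no critical point of $h_{(K,F)}$, then each of its connected components is a periodic orbit. 3. Let $u_0\in\mathcal F[K]$.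 Then $h_{(K,F)}(u)\to\infty$ as $u\to u_0$ in $S^2\setminus\mathcal F[K]$, and for some $E\in\mathbb R$ there is a family of periodic orbits around $u_0$, parametrised by the energies $e\in(E,\infty)$, which shrink to $u_0$ as $e\to\infty$, and whose periods tend to $0$ as $e\to\infty$. -/

import Mathlib

open Set Filter Topology

noncomputable section

namespace SphereVortex

/-- Euclidean space `ℝ³`. -/
abbrev E3 := EuclideanSpace ℝ (Fin 3)

/-- The rotation group `SO(3)`. -/
abbrev SO3 := Matrix.specialOrthogonalGroup (Fin 3) ℝ

/-- The unit sphere `S²` in `ℝ³`. -/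
def S2 : Set E3 := Metric.sphere 0 1

/-- The action of a rotation on a vector. -/
def rot (g : SO3) (u : E3) : E3 :=
  WithLp.toLp 2 (Matrix.mulVec (g : Matrix (Fin 3) (Fin 3) ℝ) (WithLp.ofLp u))

/-- The vector product of `ℝ³`. -/
def cross (u v : E3) : E3 :=
  WithLp.toLp 2 (crossProduct (WithLp.ofLp u) (WithLp.ofLp v))

/-- `K` is one of the rotation groups `𝔻ₙ` (`n ≥ 2`), `𝕋`, `𝕆`, `𝕀`, in any position. A subgroup of
`SO(3)` is conjugate to the standard copy of one of these groups exactly if it is isomorphic to it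
as an abstract group, and `𝕋 ≅ A₄`, `𝕆 ≅ S₄`, `𝕀 ≅ A₅`. -/
def IsDihedralOrPolyhedral (K : Subgroup SO3) : Prop :=
  (∃ n : ℕ, 2 ≤ n ∧ Nonempty (K ≃* DihedralGroup n)) ∨
    Nonempty (K ≃* alternatingGroup (Fin 4)) ∨
    Nonempty (K ≃* Equiv.Perm (Fin 4)) ∨
    Nonempty (K ≃* alternatingGroup (Fin 5))

/-- The set `𝓕[K]` of points of the sphere with non-trivial isotropy in `K`. -/
def isotropyPoints (K : Subgroup SO3) : Set E3 :=
  {u | u ∈ S2 ∧ ∃ g ∈ K, g ≠ 1 ∧ rot g u = u}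

/-- The phase space `S² ∖ 𝓕[K]` of the reduced system. -/
def phaseSpace (K : Subgroup SO3) : Set E3 := S2 \ isotropyPoints K

/-- The Hamiltonian `H(v) = -½ ∑_{i<j} ln |v_j - v_i|²` of `N` identical vortices, given by the
same formula on `(ℝ³)ᴺ`. -/
def vortexHamiltonian {N : ℕ} (v : Fin N → E3) : ℝ :=
  -(1 / 2 : ℝ) * ∑ i : Fin N, ∑ j ∈ Finset.Ioi i, Real.log (‖v j - v i‖ ^ 2)

/-- The configuration `(g₁u, …, g_m u, f₁, …, f_l)` determined by orderings of `K` and `F`. -/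
def symmetricConfiguration {K : Subgroup SO3} {F : Set E3} {m l : ℕ}
    (gs : Fin m ≃ K) (fs : Fin l ≃ F) (u : E3) : Fin (m + l) → E3 :=
  Fin.append (fun i => rot (gs i : SO3) u) (fun j => (fs j : E3))

/-- The reduced Hamiltonian `h_(K,F)(u) = H(g₁u, …, g_m u, f₁, …, f_l)`. It is given by a formula on
all of `ℝ³`, which is smooth near every point of `S² ∖ 𝓕[K]`. -/
def reducedHamiltonian {K : Subgroup SO3} {F : Set E3} {m l : ℕ}
    (gs : Fin m ≃ K) (fs : Fin l ≃ F) (u : E3) : ℝ :=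
  vortexHamiltonian (symmetricConfiguration gs fs u)

/-- The vector field `u ↦ -(1/m) u × ∇h(u)` on the sphere. Only the tangential part of the gradient
contributes, so `∇h` may be taken in `ℝ³`. -/
def hamiltonianField (m : ℕ) (h : E3 → ℝ) (u : E3) : E3 :=
  -(1 / (m : ℝ)) • cross u (gradient h u)

/-- The vector field of the reduced system `u' = -(1/m) u × ∇h_(K,F)(u)`, with `m = |K|`. -/
def reducedField {K : Subgroup SO3} {F : Set E3} {m l : ℕ}
    (gs : Fin m ≃ K) (fs : Fin l ≃ F) : E3 → E3 :=
  hamiltonianField m (reducedHamiltonian gs fs)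

/-- `u` is a critical point of the restriction of `h` to the sphere: the differential of `h` vanishes
on the tangent plane `u^⊥` of the sphere at `u`. -/
def IsCriticalOnSphere (h : E3 → ℝ) (u : E3) : Prop :=
  ∀ w : E3, inner ℝ u w = 0 → fderiv ℝ h u w = 0

/-- `γ` is, over the set `s` of times, a solution of `u' = X(u)` with values in `D`. -/
def IsSolutionOn (D : Set E3) (X : E3 → E3) (γ : ℝ → E3) (s : Set ℝ) : Prop :=
  ∀ t ∈ s, γ t ∈ D ∧ HasDerivWithinAt γ (X (γ t)) s t

/-- `u₀` is an equilibrium of `u' = X(u)` on `D`. -/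
def IsEquilibrium (D : Set E3) (X : E3 → E3) (u₀ : E3) : Prop :=
  u₀ ∈ D ∧ X u₀ = 0

/-- Lyapunov stability: solutions that start close to `u₀` stay close to `u₀` in the future, for as
long as they exist. -/
def IsLyapunovStable (D : Set E3) (X : E3 → E3) (u₀ : E3) : Prop :=
  ∀ U ∈ 𝓝 u₀, ∃ V ∈ 𝓝 u₀, ∀ b : ℝ, 0 < b → ∀ γ : ℝ → E3,
    IsSolutionOn D X γ (Ico 0 b) → γ 0 ∈ V → ∀ t ∈ Ico 0 b, γ t ∈ U

/-- `γ` is a periodic solution, defined for all times, with minimal period `T > 0` (so `γ` is not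
constant). -/
def IsPeriodicSolution (D : Set E3) (X : E3 → E3) (γ : ℝ → E3) (T : ℝ) : Prop :=
  IsSolutionOn D X γ univ ∧ 0 < T ∧ Function.Periodic γ T ∧
    ∀ s ∈ Ioo 0 T, ¬ Function.Periodic γ s

/-- `C` is a periodic orbit. -/
def IsPeriodicOrbit (D : Set E3) (X : E3 → E3) (C : Set E3) : Prop :=
  ∃ (γ : ℝ → E3) (T : ℝ), IsPeriodicSolution D X γ T ∧ C = range γ

/-- The level set of energy `c`. -/
def levelSet (D : Set E3) (h : E3 → ℝ) (c : ℝ) : Set E3 := {u | u ∈ D ∧ h u = c}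

/-- The point `u₀` together with the orbits of those `γ e` whose energy `e` lies in `J`. -/
def filledBy (γ : ℝ → ℝ → E3) (u₀ : E3) (J : Set ℝ) : Set E3 :=
  insert u₀ (⋃ e ∈ J, range (γ e))

/-- `γ e`, for `e` in the interval `I`, is a continuous one-parameter family of periodic solutions
around `u₀`, of minimal period `T e` and parametrised by the energy `e`. The set `J e` holds the
energies of the orbits inside of `γ e`, and `l` is the limit of energies in which the orbits shrink
to `u₀`. The orbit of `γ e` is the boundary of the region of the sphere that consists of `u₀` and of
the orbits inside of `γ e`. In particular, the orbits fill a punctured neighbourhood of `u₀`. -/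
structure IsPeriodicFamilyAround (D : Set E3) (X : E3 → E3) (h : E3 → ℝ) (u₀ : E3)
    (I : Set ℝ) (J : ℝ → Set ℝ) (l : Filter ℝ) (γ : ℝ → ℝ → E3) (T : ℝ → ℝ) : Prop where
  continuousOn : ContinuousOn (fun p : ℝ × ℝ => γ p.1 p.2) (I ×ˢ univ)
  periodic : ∀ e ∈ I, IsPeriodicSolution D X (γ e) (T e)
  energy : ∀ e ∈ I, ∀ t : ℝ, h (γ e t) = e
  isOpen_inside : ∀ e ∈ I, ∃ O : Set E3, IsOpen O ∧ filledBy γ u₀ (J e) = S2 ∩ O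
  boundary : ∀ e ∈ I, closure (filledBy γ u₀ (J e)) \ filledBy γ u₀ (J e) = range (γ e)
  approach : ∀ U ∈ 𝓝 u₀, ∀ᶠ e in l, range (γ e) ⊆ U

end SphereVortex

end

open SphereVortex

/-!
On the sphere the reduced Hamiltonian is `h = -½ log G`, where `G` is the product of the squared
distances of the points of the configuration, a non-negative polynomial on `ℝ³` that vanishes on
the sphere exactly at the collision points. The reduced field is `u × ∇G(u)` divided by
`2 m G(u)`, and `G` is constant along orbits. Up to a constant change of speed on each orbit, the
reduced system is therefore the restriction of the complete system `u' = u × ∇G(u)`, which is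
defined on the whole sphere and for which collision points are equilibria.
`IsLogHamiltonian` records this, and `exists_isSphereFlow` provides the flow.

*Critical points are isolated.* Restricted to the sphere, `G` is a product of squared distances
to points of the sphere, up to a constant. In the stereographic coordinate `z` this product is
`|P(z)|² / (1 + |z|²)ᵂ` with a polynomial `P`, up to a constant, and its critical points off the
zeros solve an equation that expresses the conjugate of `z` as a rational function of `z`. Such an
equation has infinitely many solutions only if the rational function has degree at most one, which
is not so because `G` has at least four zeros (`IsPointProduct.finite_critical`).

*Regular level curves are closed.* In a flow box, orbits and level curves coincide. An orbit in a
compact set has a limit point, so it is closed if the points of its energy are regular there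
(`IsSphereFlow.exists_period_of_isCompact`). Orbits are open and closed in regular level sets.

*Closed level curves enclose extrema.* A closed level curve in a chart is the zero set of a
continuous function whose sign distinguishes the two sides (`exists_separating_function`, which
replaces the Jordan curve theorem), so that it bounds a region with a local extremum. Hence orbits
near a critical point which is not an extremum leave a fixed neighbourhood, as they would be closed
otherwise (`IsSphereFlow.exists_leaving`). Around an isolated minimum of `G` or `-G`, every orbit in
a small disc is closed, and it is the whole of its level set in the disc
(`IsSphereFlow.exists_disc`). By analyticity, `G` is strictly monotone along a short arc from the
extremum, and the inverse of this function gives a starting point on every orbit that depends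
continuously on the energy (`IsLogHamiltonian.exists_family`). Collision points are minima of `G`.

*Periods near a collision `p`.* The vector `p - ⟪p, u⟫ u` is tangent to the sphere at `u` and points
to `p`. The derivative of `G` in its direction is at most `-½ G(u)` for `u` close to `p`
(`radialBound_distanceProduct`). At distance at most `r` from `p` the angular velocity around `p` in
the system `u' = u × ∇G(u)` is therefore at least `G / (2 r²)`, so that orbits close up after a time
of at most `4 π r² / G` (`IsSphereFlow.exists_short_return`). In the reduced system times are
multiplied by `2 m G`, and so the periods are of order `r²`.
-/

open scoped ContDiff

/-! ### Global flows of bounded Lipschitz vector fields -/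

/-- A bounded Lipschitz vector field on a Banach space has a jointly continuous global flow. -/
theorem exists_global_flow {E : Type*} [NormedAddCommGroup E] [NormedSpace ℝ E] [CompleteSpace E]
    {f : E → E} {K L : NNReal} (hK : LipschitzWith K f) (hL : ∀ x, ‖f x‖ ≤ L) :
    ∃ Φ : ℝ → E → E, (∀ x, Φ 0 x = x) ∧ (∀ x t, HasDerivAt (fun s => Φ s x) (f (Φ t x)) t) ∧
      (∀ s t x, Φ (s + t) x = Φ s (Φ t x)) ∧ Continuous (fun p : ℝ × E => Φ p.1 p.2) := by
  have loc : ∀ (x : E) (n : ℝ), ∃ α : ℝ → E, α 0 = x ∧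
      (0 < n → ∀ t ∈ Ioo (-n) n, HasDerivAt α (f (α t)) t) := by
    intro x n
    rcases lt_or_ge 0 n with hn | hn
    · have h0 : (0 : ℝ) ∈ Icc (-n) n := ⟨by linarith, hn.le⟩
      have hpl : IsPicardLindelof (fun _ => f) (tmin := -n) (tmax := n) ⟨0, h0⟩ x
          (L * n.toNNReal) 0 L K := by
        refine IsPicardLindelof.of_time_independent (fun x _ => hL x) hK.lipschitzOnWith ?_
        simp [Real.coe_toNNReal n hn.le]
      obtain ⟨α, h1, h2⟩ := hpl.exists_eq_forall_mem_Icc_hasDerivWithinAt₀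
      exact ⟨α, h1, fun _ t ht =>
        (h2 t (Ioo_subset_Icc_self ht)).hasDerivAt (Icc_mem_nhds ht.1 ht.2)⟩
    · exact ⟨fun _ => x, rfl, fun h => absurd h (not_lt.2 hn)⟩
  choose α hα0 hα using loc
  have agree : ∀ x a b, 0 < a → a ≤ b → EqOn (α x a) (α x b) (Ioo (-a) a) := by
    intro x a b ha hab
    refine ODE_solution_unique_of_mem_Ioo (v := fun _ => f) (s := fun _ => univ) (K := K)
      (t₀ := 0) (fun t _ => hK.lipschitzOnWith) ⟨by linarith, ha⟩
      (fun t ht => ⟨hα x a ha t ht, trivial⟩)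
      (fun t ht => ⟨hα x b (by linarith) t ⟨by linarith [ht.1], by linarith [ht.2]⟩, trivial⟩) ?_
    rw [hα0, hα0]
  set Φ : ℝ → E → E := fun t x => α x (|t| + 1) t with hΦ
  have hd : ∀ x t, HasDerivAt (fun s => Φ s x) (f (Φ t x)) t := by
    intro x t
    have ht : t ∈ Ioo (-(|t| + 1)) (|t| + 1) := by
      rw [mem_Ioo, ← abs_lt]; linarith
    have h := hα x (|t| + 1) (by positivity) t ht
    refine h.congr_of_eventuallyEq ?_
    filter_upwards [Ioo_mem_nhds ht.1 ht.2] with s hs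
    have hs' : s ∈ Ioo (-(|s| + 1)) (|s| + 1) := by
      rw [mem_Ioo, ← abs_lt]; linarith
    rcases le_total (|s| + 1) (|t| + 1) with h | h
    · exact agree x _ _ (by positivity) h hs'
    · exact (agree x _ _ (by positivity) h hs).symm
  have h0 : ∀ x, Φ 0 x = x := fun x => hα0 x _
  have hcomp : ∀ s t x, Φ (s + t) x = Φ s (Φ t x) := by
    intro s t x
    have := ODE_solution_unique_univ (v := fun _ => f) (s := fun _ => univ) (K := K)
      (f := fun s => Φ (s + t) x) (g := fun s => Φ s (Φ t x)) (t₀ := 0)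
      (fun t => hK.lipschitzOnWith)
      (fun s => ⟨by simpa using (hd x (s + t)).comp_add_const s t, trivial⟩)
      (fun s => ⟨hd _ s, trivial⟩) (by simp [h0])
    exact congrFun this s
  have hcont : ∀ x, Continuous fun s => Φ s x := fun x =>
    continuous_iff_continuousAt.2 fun t => (hd x t).continuousAt
  have hlip : ∀ t x y, dist (Φ t x) (Φ t y) ≤ dist x y * Real.exp (K * |t|) := by
    intro t x y
    rcases le_total 0 t with ht | ht
    · have := dist_le_of_trajectories_ODE (v := fun _ => f) (K := K) (a := 0) (b := t)
        (fun _ => hK) (hcont x).continuousOn (fun s _ => (hd x s).hasDerivWithinAt)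
        (hcont y).continuousOn (fun s _ => (hd y s).hasDerivWithinAt)
        (le_of_eq (by rw [h0, h0])) t ⟨ht, le_rfl⟩
      simpa [abs_of_nonneg ht] using this
    · -- a trajectory run backwards is a trajectory of `-f`
      have hneg : ∀ x s, HasDerivAt (fun s => Φ (-s) x) (-f (Φ (-s) x)) s := by
        intro x s
        have := (hd x (-s)).scomp s (hasDerivAt_neg s)
        simpa [Function.comp_def] using this
      have := dist_le_of_trajectories_ODE (v := fun _ x => -f x) (K := K) (a := 0) (b := -t)
        (fun _ => hK.neg) ((hcont x).comp continuous_neg).continuousOn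
        (fun s _ => (hneg x s).hasDerivWithinAt)
        ((hcont y).comp continuous_neg).continuousOn (fun s _ => (hneg y s).hasDerivWithinAt)
        (δ := dist x y) (le_of_eq (by simp [h0])) (-t) ⟨by linarith, le_rfl⟩
      simpa [abs_of_nonpos ht] using this
  refine ⟨Φ, h0, hd, hcomp, continuous_iff_continuousAt.2 ?_⟩
  rintro ⟨t₀, x₀⟩
  rw [ContinuousAt, tendsto_iff_dist_tendsto_zero]
  have hb : Tendsto (fun p : ℝ × E => dist p.2 x₀ * Real.exp (K * |p.1|)
      + dist (Φ p.1 x₀) (Φ t₀ x₀)) (𝓝 (t₀, x₀)) (𝓝 0) := by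
    have h : Continuous (fun p : ℝ × E => dist p.2 x₀ * Real.exp (K * |p.1|)
      + dist (Φ p.1 x₀) (Φ t₀ x₀)) := by
      have := (hcont x₀).comp (continuous_fst (X := ℝ) (Y := E))
      simp only [Function.comp_def] at this
      fun_prop
    simpa using h.tendsto (t₀, x₀)
  refine squeeze_zero (fun _ => dist_nonneg) (fun p => ?_) hb
  exact (dist_triangle _ (Φ p.1 x₀) _).trans (by gcongr; exact hlip _ _ _)

/-! ### The vector product and the Hamiltonian flow on the sphere -/

namespace SphereVortex

theorem cross_zero (u v : E3) : cross u v 0 = u 1 * v 2 - u 2 * v 1 := by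
  simp [cross, cross_apply]

theorem cross_one (u v : E3) : cross u v 1 = u 2 * v 0 - u 0 * v 2 := by
  simp [cross, cross_apply]

theorem cross_two (u v : E3) : cross u v 2 = u 0 * v 1 - u 1 * v 0 := by
  simp [cross, cross_apply]

theorem inner_coord (u v : E3) : inner ℝ u v = u 0 * v 0 + u 1 * v 1 + u 2 * v 2 := by
  simp [PiLp.inner_apply, Fin.sum_univ_three, mul_comm]

theorem E3.ext {u v : E3} (h0 : u 0 = v 0) (h1 : u 1 = v 1) (h2 : u 2 = v 2) : u = v := by
  ext i; fin_cases i <;> assumption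

theorem inner_cross_self_left (u v : E3) : inner ℝ u (cross u v) = 0 := by
  rw [inner_coord, cross_zero, cross_one, cross_two]; ring

theorem inner_cross_self_right (u v : E3) : inner ℝ v (cross u v) = 0 := by
  rw [inner_coord, cross_zero, cross_one, cross_two]; ring

theorem cross_cross_left (u v : E3) :
    cross u (cross u v) = (inner ℝ u v) • u - (inner ℝ u u) • v := by
  apply E3.ext <;>
    simp [inner_coord, cross_zero, cross_one, cross_two,  -inner_self_eq_norm_sq_to_K] <;> ring

theorem cross_smul_right (c : ℝ) (u v : E3) : cross u (c • v) = c • cross u v := by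
  apply E3.ext <;> simp [cross_zero, cross_one, cross_two] <;> ring

theorem mem_S2 {u : E3} : u ∈ S2 ↔ inner ℝ u u = 1 := by
  rw [S2, mem_sphere_zero_iff_norm, real_inner_self_eq_norm_sq,
    pow_eq_one_iff_of_nonneg (norm_nonneg u) two_ne_zero]

theorem isCompact_S2 : IsCompact S2 := isCompact_sphere _ _

theorem contDiff_cross {n : WithTop ℕ∞} {f g : E3 → E3} (hf : ContDiff ℝ n f)
    (hg : ContDiff ℝ n g) : ContDiff ℝ n fun x => cross (f x) (g x) := by
  rw [contDiff_euclidean] at hf hg ⊢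
  intro i
  fin_cases i
  · simp only [Fin.zero_eta, cross_zero]
    exact ((hf 1).mul (hg 2)).sub ((hf 2).mul (hg 1))
  · simp only [Fin.mk_one, cross_one]
    exact ((hf 2).mul (hg 0)).sub ((hf 0).mul (hg 2))
  · simp only [Fin.reduceFinMk, cross_two]
    exact ((hf 0).mul (hg 1)).sub ((hf 1).mul (hg 0))

theorem inner_gradient (G : E3 → ℝ) (u w : E3) : inner ℝ (gradient G u) w = fderiv ℝ G u w := by
  simp [gradient]

/-- The differential of `G` vanishes on the tangent plane of the sphere at `u` exactly if
`u × ∇G(u) = 0`. -/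
theorem isCriticalOnSphere_iff {G : E3 → ℝ} {u : E3} (hu : u ∈ S2) :
    IsCriticalOnSphere G u ↔ cross u (gradient G u) = 0 := by
  have hu1 := mem_S2.1 hu
  constructor
  · intro h
    -- both factors of `u × ∇G` are orthogonal to it
    have h1 := h (cross u (cross u (gradient G u))) (inner_cross_self_left _ _)
    rw [← inner_gradient, cross_cross_left, hu1, one_smul, inner_sub_right, inner_smul_right] at h1
    have h2 : inner ℝ (cross u (gradient G u)) (cross u (gradient G u)) = 0 := by
      have : inner ℝ (cross u (gradient G u)) (cross u (gradient G u))
          = inner ℝ u u * inner ℝ (gradient G u) (gradient G u)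
            - inner ℝ u (gradient G u) * inner ℝ (gradient G u) u := by
        simp only [inner_coord, cross_zero, cross_one, cross_two]; ring
      rw [this, hu1]
      linarith
    exact inner_self_eq_zero.1 h2
  · intro h w hw
    have h1 : cross u (cross u (gradient G u)) = 0 := by
      rw [h]; apply E3.ext <;> simp [cross_zero, cross_one, cross_two]
    rw [cross_cross_left, hu1, one_smul, sub_eq_zero] at h1
    rw [← inner_gradient, ← h1, inner_smul_left, hw, mul_zero]

/-- `Φ` is a continuous flow on the sphere, with orbits the solutions of `u' = u × ∇G(u)`. -/
structure IsSphereFlow (G : E3 → ℝ) (Φ : ℝ → E3 → E3) : Prop where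
  zero : ∀ x, Φ 0 x = x
  add : ∀ s t x, Φ (s + t) x = Φ s (Φ t x)
  mem : ∀ t, ∀ x ∈ S2, Φ t x ∈ S2
  hasDerivAt : ∀ x ∈ S2, ∀ t, HasDerivAt (fun s => Φ s x) (cross (Φ t x) (gradient G (Φ t x))) t
  continuous : Continuous fun p : ℝ × E3 => Φ p.1 p.2
  energy : ∀ t, ∀ x ∈ S2, G (Φ t x) = G x
  fixed : ∀ x ∈ S2, cross x (gradient G x) = 0 → ∀ t, Φ t x = x

theorem exists_isSphereFlow {G : E3 → ℝ} (hG : ContDiff ℝ 2 G) : ∃ Φ, IsSphereFlow G Φ := by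
  have hgrad : ContDiff ℝ 1 (gradient G) :=
    (LinearIsometryEquiv.contDiff (InnerProductSpace.toDual ℝ E3).symm).comp
      (hG.fderiv_right (m := 1) (by norm_num))
  have hY : ContDiff ℝ 1 fun x => cross x (gradient G x) := contDiff_cross contDiff_id hgrad
  -- a cutoff makes the field bounded and globally Lipschitz without changing it on the sphere
  let χ : ContDiffBump (0 : E3) := ⟨2, 3, by norm_num, by norm_num⟩
  set f : E3 → E3 := fun x => χ x • cross x (gradient G x) with hf
  have hf1 : ContDiff ℝ 1 f := χ.contDiff.smul hY
  have hfs : HasCompactSupport f := χ.hasCompactSupport.smul_right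
  obtain ⟨K, hK⟩ := hf1.lipschitzWith_of_hasCompactSupport hfs one_ne_zero
  obtain ⟨L, hL⟩ := hf1.continuous.bounded_above_of_compact_support hfs
  obtain ⟨Φ, h0, hd, hadd, hc⟩ := exists_global_flow (L := L.toNNReal) hK
    (fun x => (hL x).trans (Real.le_coe_toNNReal L))
  have hmem : ∀ t, ∀ x ∈ S2, Φ t x ∈ S2 := by
    intro t x hx
    have hder : ∀ t, HasDerivAt (fun s => inner ℝ (Φ s x) (Φ s x)) 0 t := by
      intro t
      have := (hd x t).inner ℝ (hd x t)
      have hz : inner ℝ (Φ t x) (f (Φ t x)) = 0 := by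
        rw [hf]; simp only [inner_smul_right, inner_cross_self_left, mul_zero]
      rwa [real_inner_comm (Φ t x) (f (Φ t x)), hz, add_zero] at this
    have := is_const_of_deriv_eq_zero (fun t => (hder t).differentiableAt)
      (fun t => (hder t).deriv) t 0
    rw [mem_S2] at hx ⊢
    rw [this, h0, hx]
  have hone : ∀ x ∈ S2, f x = cross x (gradient G x) := by
    intro x hx
    have : χ x = 1 := by
      apply χ.one_of_mem_closedBall
      have : ‖x‖ = 1 := by simpa [S2] using hx
      rw [mem_closedBall_zero_iff, this]
      change (1 : ℝ) ≤ 2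
      norm_num
    rw [hf]; simp [this]
  have hder : ∀ x ∈ S2, ∀ t,
      HasDerivAt (fun s => Φ s x) (cross (Φ t x) (gradient G (Φ t x))) t := by
    intro x hx t
    rw [← hone _ (hmem t x hx)]
    exact hd x t
  refine ⟨Φ, h0, hadd, hmem, hder, hc, fun t x hx => ?_, fun x hx h t => ?_⟩
  · have hE : ∀ t, HasDerivAt (fun s => G (Φ s x)) 0 t := by
      intro t
      have h1 := ((hG.differentiable (by norm_num)) (Φ t x)).hasFDerivAt.comp_hasDerivAt t
        (hder x hx t)
      rwa [← inner_gradient, inner_cross_self_right] at h1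
    have := is_const_of_deriv_eq_zero (fun t => (hE t).differentiableAt)
        (fun t => (hE t).deriv) t 0
    rw [this, h0]
  · have := ODE_solution_unique_univ (v := fun _ => f) (s := fun _ => univ) (K := K)
      (f := fun s => Φ s x) (g := fun _ => x) (t₀ := 0)
      (fun t => hK.lipschitzOnWith) (fun s => ⟨hd x s, trivial⟩)
      (fun s => ⟨by rw [hone x hx, h]; exact hasDerivAt_const s x, trivial⟩) (h0 x)
    exact congrFun this t

/-! ### Flow boxes and closed orbits -/

theorem eq_zero_of_orthogonal {y g w : E3} (h : cross y g ≠ 0) (h1 : inner ℝ y w = 0)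
    (h2 : inner ℝ g w = 0) (h3 : inner ℝ (cross y g) w = 0) : w = 0 := by
  have hz : cross w (cross y g) = 0 := by
    have : cross w (cross y g) = (inner ℝ g w) • y - (inner ℝ y w) • g := by
      apply E3.ext <;> simp [inner_coord, cross_zero, cross_one, cross_two] <;> ring
    rw [this, h1, h2]; simp
  set b := cross y g
  have hb : 0 < inner ℝ b b := real_inner_self_pos.2 h
  have hL : (inner ℝ w w : ℝ) * inner ℝ b b
      = inner ℝ (cross w b) (cross w b) + inner ℝ b w ^ 2 := by
    simp only [inner_coord, cross_zero, cross_one, cross_two]; ring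
  rw [hz, h3, inner_zero_left] at hL
  rcases mul_eq_zero.1 (hL.trans (by simp)) with h | h
  · exact inner_self_eq_zero.1 h
  · exact absurd h hb.ne'

/-- A map with injective strict derivative is injective near the base point. -/
theorem exists_nhds_injOn {E F : Type*} [NormedAddCommGroup E] [NormedSpace ℝ E]
    [FiniteDimensional ℝ E] [NormedAddCommGroup F] [NormedSpace ℝ F] {f : E → F} {f' : E →L[ℝ] F}
    {x : E} (hf : HasStrictFDerivAt f f' x) (hinj : Function.Injective f') :
    ∃ N ∈ 𝓝 x, InjOn f N := by
  obtain ⟨K, hK, hA⟩ := LinearMap.exists_antilipschitzWith f'.toLinearMap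
    (LinearMap.ker_eq_bot.2 hinj)
  have hb : ∀ v, ‖v‖ ≤ K * ‖f' v‖ := fun v => by simpa [dist_eq_norm] using hA.le_mul_dist v 0
  have hK' : (0 : ℝ) < K := hK
  have := hf.isLittleO.def (c := 1 / (2 * K)) (by positivity)
  rw [nhds_prod_eq, Filter.eventually_prod_self_iff'] at this
  obtain ⟨N, hN, h⟩ := this
  refine ⟨N, hN, fun a ha b hb' hab => ?_⟩
  have h1 := h a ha b hb'
  simp only [hab, sub_self, zero_sub, norm_neg] at h1
  have h2 := hb (a - b)
  have h3 : (K : ℝ) * ‖f' (a - b)‖ ≤ K * (1 / (2 * K) * ‖a - b‖) := by gcongr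
  have h4 : (K : ℝ) * (1 / (2 * K) * ‖a - b‖) = ‖a - b‖ / 2 := by field_simp
  have : ‖a - b‖ ≤ 0 := by linarith
  exact sub_eq_zero.1 (norm_le_zero_iff.1 this)

variable {G : E3 → ℝ} {Φ : ℝ → E3 → E3}

/-- Near a regular point `y`, the level set of `y` on the sphere is a short piece of the orbit
of `y`: the functions `|u|²`, `G` and `⟨u, Y⟩`, where `Y` is the velocity at `y`, are coordinates
near `y`, and the last one takes all values close to `⟨y, Y⟩` on the orbit. -/
theorem IsSphereFlow.exists_box (hΦ : IsSphereFlow G Φ) (hG : ContDiff ℝ 2 G) {y : E3}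
    (hy : y ∈ S2) (hreg : cross y (gradient G y) ≠ 0) {ε : ℝ} (hε : 0 < ε) :
    ∃ W, IsOpen W ∧ y ∈ W ∧ ∀ x ∈ W, x ∈ S2 → G x = G y → ∃ t, |t| < ε ∧ x = Φ t y := by
  set b := cross y (gradient G y) with hb
  have hF : HasStrictFDerivAt (fun u : E3 => (inner ℝ u u, G u, inner ℝ b u))
      (((innerSL ℝ y).comp (ContinuousLinearMap.id ℝ E3) +
        (innerSL ℝ y).comp (ContinuousLinearMap.id ℝ E3)).prod
        ((fderiv ℝ G y).prod (innerSL ℝ b))) y := by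
    refine HasStrictFDerivAt.prodMk ?_ (HasStrictFDerivAt.prodMk
      (hG.contDiffAt.hasStrictFDerivAt (by norm_num)) (innerSL ℝ b).hasStrictFDerivAt)
    have := (hasStrictFDerivAt_id (𝕜 := ℝ) y).inner ℝ (hasStrictFDerivAt_id y)
    refine this.congr_fderiv ?_
    ext w
    simp [fderivInnerCLM_apply, real_inner_comm]
  obtain ⟨N, hN, hinj⟩ := exists_nhds_injOn hF (by
    rw [injective_iff_map_eq_zero]
    intro w hw
    simp only [ContinuousLinearMap.prod_apply, Prod.mk_eq_zero, _root_.add_apply,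
      ContinuousLinearMap.comp_apply, ContinuousLinearMap.id_apply, innerSL_apply_apply] at hw
    exact eq_zero_of_orthogonal hreg (by linarith [hw.1]) (by rw [inner_gradient]; exact hw.2.1)
      hw.2.2)
  have hd : HasDerivAt (fun t => inner ℝ b (Φ t y)) (inner ℝ b b) 0 := by
    have h := hΦ.hasDerivAt y hy 0
    rw [hΦ.zero, ← hb] at h
    have := (innerSL ℝ b).hasFDerivAt.comp_hasDerivAt (0 : ℝ) h
    simpa only [innerSL_apply_apply, Function.comp_def] using this
  have hpos : 0 < inner ℝ b b := real_inner_self_pos.2 hreg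
  have hcont : Continuous fun t => Φ t y :=
    hΦ.continuous.comp (continuous_id.prodMk continuous_const)
  have hev : ∀ᶠ t in 𝓝 (0 : ℝ), |t| < ε ∧ Φ t y ∈ N := by
    refine Filter.Eventually.and ?_ ?_
    · exact (continuous_abs.tendsto' 0 0 abs_zero).eventually_lt_const hε
    · exact hcont.tendsto' 0 y (hΦ.zero y) hN
  obtain ⟨d, hd0, hball⟩ := Metric.eventually_nhds_iff.1 hev
  -- the coordinate along the orbit increases through `t = 0`
  have hsl := (hasDerivAt_iff_tendsto_slope_zero.1 hd)
  have hsl' := hsl.eventually (lt_mem_nhds hpos)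
  rw [eventually_nhdsWithin_iff] at hsl'
  obtain ⟨d', hd0', hball'⟩ := Metric.eventually_nhds_iff.1 hsl'
  set τ := min d d' / 2 with hτ
  have hτ0 : 0 < τ := by have := lt_min hd0 hd0'; positivity
  have hτd : τ < d := by have := min_le_left d d'; have := lt_min hd0 hd0'; linarith
  have hτd' : τ < d' := by have := min_le_right d d'; have := lt_min hd0 hd0'; linarith
  have hp := hball' (y := τ) (by simpa [abs_of_pos hτ0] using hτd') (by simp [hτ0.ne'])
  have hm := hball' (y := -τ) (by simpa [abs_of_pos hτ0] using hτd') (by simp [hτ0.ne'])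
  simp only [zero_add, hΦ.zero, smul_eq_mul] at hp hm
  have hp' : inner ℝ b y < inner ℝ b (Φ τ y) := by
    have := (mul_pos_iff_of_pos_left (inv_pos.2 hτ0)).1 hp; linarith
  have hm' : inner ℝ b (Φ (-τ) y) < inner ℝ b y := by
    rw [inv_neg, neg_mul, Left.neg_pos_iff] at hm
    have := (pos_iff_neg_of_mul_neg hm).1 (inv_pos.2 hτ0); linarith
  have hopen : IsOpen ((fun x : E3 => inner ℝ b x) ⁻¹'
      Ioo (inner ℝ b (Φ (-τ) y)) (inner ℝ b (Φ τ y))) :=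
    isOpen_Ioo.preimage (by fun_prop)
  refine ⟨interior N ∩ _, isOpen_interior.inter hopen,
    ⟨mem_interior_iff_mem_nhds.2 hN, hm', hp'⟩, fun x hx hxS hxG => ?_⟩
  obtain ⟨t, ht, hte⟩ := intermediate_value_Icc (a := -τ) (b := τ) (by linarith)
    (f := fun t => inner ℝ b (Φ t y)) (by fun_prop) ⟨hx.2.1.le, hx.2.2.le⟩
  have htd : |t| < d := (abs_le.2 ht).trans_lt hτd
  obtain ⟨h1, h2⟩ := hball (y := t) (by simpa using htd)
  refine ⟨t, h1, hinj (interior_subset hx.1) h2 ?_⟩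
  simp only [Prod.mk.injEq]
  refine ⟨?_, ?_, hte.symm⟩
  · rw [mem_S2.1 hxS, mem_S2.1 (hΦ.mem t y hy)]
  · rw [hxG, hΦ.energy t y hy]

theorem IsSphereFlow.neg_apply (hΦ : IsSphereFlow G Φ) (t : ℝ) (x : E3) : Φ (-t) (Φ t x) = x := by
  rw [← hΦ.add, neg_add_cancel, hΦ.zero]

theorem IsSphereFlow.continuous_orbit (hΦ : IsSphereFlow G Φ) (x : E3) :
    Continuous fun t => Φ t x :=
  hΦ.continuous.comp (continuous_id.prodMk continuous_const)

theorem IsSphereFlow.regular (hΦ : IsSphereFlow G Φ) {x : E3} (hx : x ∈ S2)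
    (hreg : cross x (gradient G x) ≠ 0) (t : ℝ) :
    cross (Φ t x) (gradient G (Φ t x)) ≠ 0 := by
  intro h
  have h1 := hΦ.fixed _ (hΦ.mem t x hx) h (-t)
  rw [hΦ.neg_apply] at h1
  rw [← h1] at h
  exact hreg h

/-- The orbit of a regular point is open in its level set. -/
theorem IsSphereFlow.exists_isOpen_orbit (hΦ : IsSphereFlow G Φ) (hG : ContDiff ℝ 2 G) {x : E3}
    (hx : x ∈ S2) (hreg : cross x (gradient G x) ≠ 0) :
    ∃ N, IsOpen N ∧ range (fun t => Φ t x) ⊆ N ∧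
      ∀ z ∈ N, z ∈ S2 → G z = G x → z ∈ range fun t => Φ t x := by
  choose W hWo hW hWx using fun t => hΦ.exists_box hG (hΦ.mem t x hx) (hΦ.regular hx hreg t)
    one_pos
  refine ⟨⋃ t, W t, isOpen_iUnion hWo, ?_, ?_⟩
  · rintro _ ⟨t, rfl⟩
    exact mem_iUnion.2 ⟨t, hW t⟩
  · intro z hz hzS hzG
    obtain ⟨t, ht⟩ := mem_iUnion.1 hz
    obtain ⟨s, -, rfl⟩ := hWx t z ht hzS (by rw [hzG, hΦ.energy t x hx])
    exact ⟨s + t, hΦ.add s t x⟩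

/-- An orbit which accumulates in the future at a regular point is closed. -/
theorem IsSphereFlow.exists_period_of_mapClusterPt (hΦ : IsSphereFlow G Φ) (hG : ContDiff ℝ 2 G)
    {x y : E3} (hx : x ∈ S2) (hreg : cross y (gradient G y) ≠ 0)
    (hcl : MapClusterPt y atTop fun n : ℕ => Φ n x) : ∃ T, 0 < T ∧ Φ T x = x := by
  have hy : y ∈ S2 := isCompact_S2.isClosed.mem_of_mapClusterPt hcl
    (Eventually.of_forall fun n => hΦ.mem n x hx)
  have hGy : G y = G x := by
    have : IsClosed {z | G z = G x} := isClosed_eq hG.continuous continuous_const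
    exact this.mem_of_mapClusterPt hcl (Eventually.of_forall fun n => hΦ.energy n x hx)
  obtain ⟨W, hWo, hyW, hW⟩ := hΦ.exists_box hG hy hreg (ε := 1 / 2) (by norm_num)
  have hfr := hcl.frequently (hWo.mem_nhds hyW)
  rw [frequently_atTop] at hfr
  obtain ⟨n, -, hn⟩ := hfr 0
  obtain ⟨k, hk, hk'⟩ := hfr (n + 2)
  obtain ⟨t, ht, hte⟩ := hW _ hn (hΦ.mem _ x hx) (by rw [hΦ.energy _ x hx, hGy])
  obtain ⟨s, hs, hse⟩ := hW _ hk' (hΦ.mem _ x hx) (by rw [hΦ.energy _ x hx, hGy])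
  have h1 : Φ (-t + n) x = y := by rw [hΦ.add, hte, hΦ.neg_apply]
  have h2 : Φ (-s + k) x = y := by rw [hΦ.add, hse, hΦ.neg_apply]
  refine ⟨-(-t + n) + (-s + k), ?_, ?_⟩
  · have : (n : ℝ) + 2 ≤ k := by exact_mod_cast hk
    rw [abs_lt] at ht hs
    linarith
  · rw [hΦ.add, h2, ← h1, hΦ.neg_apply]

theorem IsSphereFlow.exists_period_of_isCompact (hΦ : IsSphereFlow G Φ) (hG : ContDiff ℝ 2 G)
    {x : E3} (hx : x ∈ S2) {K : Set E3} (hK : IsCompact K) (hxK : ∀ t, 0 ≤ t → Φ t x ∈ K)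
    (hreg : ∀ y ∈ K, y ∈ S2 → G y = G x → cross y (gradient G y) ≠ 0) :
    ∃ T, 0 < T ∧ Φ T x = x := by
  have hK' : IsCompact (K ∩ (S2 ∩ {y | G y = G x})) :=
    hK.inter_right (isCompact_S2.isClosed.inter (isClosed_eq hG.continuous continuous_const))
  obtain ⟨y, hy, hcl⟩ := hK'.exists_mapClusterPt (f := atTop) (u := fun n : ℕ => Φ n x)
    (tendsto_principal.2 (Eventually.of_forall fun n : ℕ =>
      ⟨hxK n n.cast_nonneg, hΦ.mem _ x hx, hΦ.energy _ x hx⟩))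
  exact hΦ.exists_period_of_mapClusterPt hG hx (hreg y hy.1 hy.2.1 hy.2.2) hcl

/-- A non-constant continuous periodic function of a real variable has a minimal period. -/
theorem exists_minimal_period {E : Type*} [TopologicalSpace E] [T2Space E] {γ : ℝ → E}
    (hc : Continuous γ) {s t : ℝ} (hst : γ s ≠ γ t) {T : ℝ} (hT : 0 < T)
    (hper : Function.Periodic γ T) :
    ∃ T₀, 0 < T₀ ∧ Function.Periodic γ T₀ ∧ ∀ s ∈ Ioo 0 T₀, ¬ Function.Periodic γ s := by
  let S : AddSubgroup ℝ :=
    { carrier := {c | Function.Periodic γ c}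
      zero_mem' := fun x => by simp
      add_mem' := fun ha hb => ha.add_period hb
      neg_mem' := fun ha => ha.neg }
  have hS : ∀ c, c ∈ S ↔ Function.Periodic γ c := fun c => Iff.rfl
  have hcl : IsClosed (S : Set ℝ) := by
    have : (S : Set ℝ) = ⋂ x, {c | γ (x + c) = γ x} := by
      ext c; simp only [SetLike.mem_coe, hS, mem_iInter, mem_ofPred_eq]; rfl
    rw [this]
    exact isClosed_iInter fun x => isClosed_eq (by fun_prop) continuous_const
  rcases S.dense_or_cyclic with hd | ⟨a, ha⟩
  · have hu := hd.closure_eq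
    rw [hcl.closure_eq] at hu
    have : t - s ∈ S := by rw [← SetLike.mem_coe, hu]; trivial
    exact absurd (by simpa using ((hS _).1 this s).symm) hst
  · have hmem : ∀ c, c ∈ S ↔ ∃ n : ℤ, n • a = c := fun c => by
      rw [ha, AddSubgroup.mem_closure_singleton]
    have ha0 : a ≠ 0 := by
      rintro rfl
      obtain ⟨n, hn⟩ := (hmem T).1 hper
      simp at hn; exact hT.ne hn
    refine ⟨|a|, abs_pos.2 ha0, ?_, fun c hc hper => ?_⟩
    · have h1 : a ∈ S := (hmem a).2 ⟨1, one_smul _ _⟩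
      rcases abs_choice a with h | h <;> rw [h]
      · exact h1
      · exact S.neg_mem h1
    · obtain ⟨n, hn⟩ := (hmem c).1 hper
      have h1 : |(n : ℝ)| * |a| < 1 * |a| := by
        rw [← abs_mul, one_mul]
        have : (n : ℝ) * a = c := by rw [← hn]; simp
        rw [this, abs_of_pos hc.1]; exact hc.2
      have h2 : |(n : ℝ)| < 1 := lt_of_mul_lt_mul_right h1 (abs_nonneg a)
      have h3 : n = 0 := by
        have : |n| < 1 := by exact_mod_cast h2
        exact Int.abs_lt_one_iff.1 this
      rw [h3, zero_smul] at hn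
      exact hc.1.ne hn

/-! ### Closed level curves separate the plane -/

/-- An isolated compact connected piece `O` of a level set in a simply connected space is the zero
set of a continuous function `F` which near `O` is a multiple of `g - e`. The circle-valued map
which equals `(g - e) / δ` modulo `2`, cut off to `[-1, 1]`, near `O` and equals `1` elsewhere lifts
to such a function. In this way a closed curve separates the plane, without the Jordan curve
theorem. -/
theorem exists_separating_function {P : Type*} [TopologicalSpace P] [T2Space P]
    [LocallyCompactSpace P] [SimplyConnectedSpace P] [LocallyPathConnectedSpace P] {g : P → ℝ}
    (hg : Continuous g) {O N : Set P} (hOc : IsCompact O) (hO : IsConnected O) {e : ℝ}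
    (hOe : ∀ z ∈ O, g z = e) (hN : IsOpen N) (hON : O ⊆ N) (hNO : ∀ z ∈ N, g z = e → z ∈ O) :
    ∃ F : P → ℝ, Continuous F ∧ (∀ z, F z = 0 ↔ z ∈ O) ∧
      ∃ M, IsOpen M ∧ O ⊆ M ∧ ∃ δ > 0, ∀ z ∈ M, F z = (g z - e) / δ := by
  obtain ⟨C, hC, hOC, hCN⟩ := exists_compact_between hOc hN hON
  have hCcl : IsClosed C := hC.isClosed
  have hfr : IsCompact (frontier C) := hC.of_isClosed_subset isClosed_frontier hCcl.frontier_subset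
  have hfr0 : ∀ z ∈ frontier C, 0 < |g z - e| := by
    intro z hz
    rw [abs_pos, sub_ne_zero]
    intro h
    have := hOC (hNO z (hCN (hCcl.frontier_subset hz)) h)
    exact hz.2 this
  obtain ⟨δ, hδ, hfrδ⟩ : ∃ δ > 0, ∀ z ∈ frontier C, δ ≤ |g z - e| := by
    rcases (frontier C).eq_empty_or_nonempty with h | h
    · exact ⟨1, one_pos, by simp [h]⟩
    · obtain ⟨z, hz, hmin⟩ := hfr.exists_isMinOn h (f := fun z => |g z - e|) (by fun_prop)
      exact ⟨|g z - e|, hfr0 z hz, fun w hw => hmin hw⟩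
  have hcircle : ∀ x y : ℝ, (x : AddCircle (2 : ℝ)) = y ↔ ∃ n : ℤ, x - y = 2 * n := by
    intro x y
    rw [← sub_eq_zero, ← AddCircle.coe_sub, AddCircle.coe_eq_zero_iff]
    constructor
    · rintro ⟨n, hn⟩; exact ⟨n, by rw [← hn, zsmul_eq_mul, mul_comm]⟩
    · rintro ⟨n, hn⟩; exact ⟨n, by rw [hn, zsmul_eq_mul, mul_comm]⟩
  set k : P → ℝ := fun z => max (-1) (min 1 ((g z - e) / δ)) with hk
  have hk1 : ∀ z, -1 ≤ k z := fun z => le_max_left _ _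
  have hk2 : ∀ z, k z ≤ 1 := fun z => max_le (by norm_num) (min_le_left _ _)
  have hkc : Continuous k := by fun_prop
  have hkin : ∀ z, |g z - e| < δ → k z = (g z - e) / δ := by
    intro z hz
    have h1 : |(g z - e) / δ| < 1 := by rw [abs_div, abs_of_pos hδ, div_lt_one hδ]; exact hz
    rw [abs_lt] at h1
    rw [hk]; simp only
    rw [min_eq_right h1.2.le, max_eq_right h1.1.le]
  have hk0 : ∀ z, k z = 0 → g z = e := by
    intro z hz
    rcases lt_or_ge |g z - e| δ with h | h
    · rw [hkin z h, div_eq_zero_iff] at hz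
      rcases hz with hz | hz
      · linarith
      · exact absurd hz hδ.ne'
    · exfalso
      rw [hk] at hz; simp only at hz
      rcases le_abs.1 h with h | h
      · have : 1 ≤ (g z - e) / δ := by rwa [le_div_iff₀ hδ, one_mul]
        rw [min_eq_left this] at hz; norm_num at hz
      · have : (g z - e) / δ ≤ -1 := by rw [div_le_iff₀ hδ]; linarith
        rw [min_eq_right (by linarith), max_eq_left this] at hz; norm_num at hz
  classical
  set f : P → AddCircle (2 : ℝ) := fun z => if z ∈ C then ((k z : ℝ) : AddCircle (2 : ℝ))
    else ((1 : ℝ) : AddCircle (2 : ℝ)) with hf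
  have hfc : Continuous f := by
    refine Continuous.if ?_ ((AddCircle.continuous_mk' 2).comp hkc) continuous_const
    intro z hz
    change ((k z : ℝ) : AddCircle (2 : ℝ)) = ((1 : ℝ) : AddCircle (2 : ℝ))
    rw [hcircle]
    rcases le_abs.1 (hfrδ z hz) with h | h
    · have : 1 ≤ (g z - e) / δ := by rwa [le_div_iff₀ hδ, one_mul]
      exact ⟨0, by rw [hk]; simp only; rw [min_eq_left this]; norm_num⟩
    · have : (g z - e) / δ ≤ -1 := by rw [div_le_iff₀ hδ]; linarith
      exact ⟨-1, by
        rw [hk]; simp only; rw [min_eq_right (by linarith), max_eq_left this]; norm_num⟩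
  have hf0 : ∀ z, f z = ((0 : ℝ) : AddCircle (2 : ℝ)) → z ∈ O := by
    intro z hz
    rw [hf] at hz; simp only at hz
    split_ifs at hz with h
    · obtain ⟨n, hn⟩ := (hcircle _ _).1 hz
      have h1 := hk1 z
      have h2 := hk2 z
      have hn0 : n = 0 := by
        have h3 : (-1 : ℝ) < n := by linarith
        have h4 : (n : ℝ) < 1 := by linarith
        have h3' : -1 < n := by exact_mod_cast h3
        have h4' : n < 1 := by exact_mod_cast h4
        omega
      exact hNO z (hCN h) (hk0 z (by simpa [hn0] using hn))
    · obtain ⟨n, hn⟩ := (hcircle _ _).1 hz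
      have : (1 : ℤ) = 2 * n := by exact_mod_cast (by simpa using hn : (1 : ℝ) = 2 * n)
      omega
  have hO0 : ∀ z ∈ O, f z = ((0 : ℝ) : AddCircle (2 : ℝ)) := by
    intro z hz
    rw [hf]; simp only
    rw [if_pos (interior_subset (hOC hz)), hkin z (by rw [hOe z hz]; simpa using hδ), hOe z hz]
    simp
  obtain ⟨z₀, hz₀⟩ := hO.nonempty
  obtain ⟨F, ⟨hF0, hF⟩, -⟩ := (AddCircle.isCoveringMap_coe (2 : ℝ)).existsUnique_continuousMap_lifts
    ⟨f, hfc⟩ (a₀ := z₀) (e₀ := 0) (hO0 z₀ hz₀).symm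
  have hF' : ∀ z, ((F z : ℝ) : AddCircle (2 : ℝ)) = f z := fun z => congrFun hF z
  -- on `O` the lift takes even values only, hence it is constant there
  have hFO : ∀ z ∈ O, F z = 0 := by
    intro z hz
    obtain ⟨n, hn⟩ := (hcircle _ _).1 ((hF' z).trans (hO0 z hz))
    rw [sub_zero] at hn
    have hconn : (F '' O).OrdConnected :=
      (hO.isPreconnected.image F F.continuous.continuousOn).ordConnected
    have himg : ∀ n' : ℤ, Odd n' → (n' : ℝ) ∉ F '' O := by
      rintro n' hn' ⟨w, hw, hwn⟩
      obtain ⟨m, hm⟩ := (hcircle _ _).1 ((hF' w).trans (hO0 w hw))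
      rw [sub_zero, hwn] at hm
      have : n' = 2 * m := by exact_mod_cast hm
      rw [this] at hn'
      exact (Int.not_odd_iff_even.2 (even_two_mul m)) hn'
    have h0 : (0 : ℝ) ∈ F '' O := ⟨z₀, hz₀, hF0⟩
    have h1 : (2 * n : ℝ) ∈ F '' O := ⟨z, hz, hn⟩
    rcases lt_trichotomy n 0 with h | h | h
    · have h' : (n : ℝ) ≤ -1 := by exact_mod_cast (by omega : n ≤ -1)
      exact absurd (hconn.out h1 h0 ⟨by push_cast; linarith, by norm_num⟩)
        (himg (-1) (by decide))
    · rw [hn, h]; simp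
    · have h' : (1 : ℝ) ≤ n := by exact_mod_cast h
      exact absurd (hconn.out h0 h1 ⟨by norm_num, by push_cast; linarith⟩)
        (himg 1 (by decide))
  refine ⟨F, F.continuous, fun z => ⟨fun hz => hf0 z (by rw [← hF', hz]), hFO z⟩,
    interior C ∩ ((fun z => |F z|) ⁻¹' Iio 1 ∩ (fun z => |g z - e|) ⁻¹' Iio δ), ?_, ?_, δ, hδ, ?_⟩
  · exact isOpen_interior.inter ((isOpen_Iio.preimage (by fun_prop)).inter
      (isOpen_Iio.preimage (by fun_prop)))
  · intro z hz
    exact ⟨hOC hz, by simp [hFO z hz], by simpa [hOe z hz] using hδ⟩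
  · rintro z ⟨hz1, hz2, hz3⟩
    have hz2' : |F z| < 1 := hz2
    have hz3' : |g z - e| < δ := hz3
    have h1 : |(g z - e) / δ| < 1 := by rw [abs_div, abs_of_pos hδ, div_lt_one hδ]; exact hz3
    have h := hF' z
    rw [hf] at h; simp only at h
    rw [if_pos (interior_subset hz1), hkin z hz3'] at h
    obtain ⟨n, hn⟩ := (hcircle _ _).1 h
    rw [abs_lt] at h1 hz2'
    have h3 : (-1 : ℝ) < n := by linarith
    have h4 : (n : ℝ) < 1 := by linarith
    have h3' : -1 < n := by exact_mod_cast h3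
    have h4' : n < 1 := by exact_mod_cast h4
    have : n = 0 := by omega
    rw [this] at hn
    simp at hn
    linarith

/-! ### Closed level curves enclose extrema -/

theorem isLocalMin_of_neg {P : Type*} [TopologicalSpace P] {g : P → ℝ} {z : P} (h : IsLocalMax (fun z => -g z) z) :
    IsLocalMin g z :=
  h.mono fun _ hy => neg_le_neg_iff.1 hy

section Enclosure

variable {P : Type*} [NormedAddCommGroup P] [NormedSpace ℝ P] [FiniteDimensional ℝ P]

/-- A continuous function has a local maximum in the region `F > 0` of a ball, if its values
inside of the region exceed those on the boundary of the region. -/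
theorem exists_isLocalMax_of_region {g F : P → ℝ} (hg : Continuous g) (hF : Continuous F)
    {z₀ y : P} {r : ℝ} (hy : y ∈ Metric.closedBall z₀ r) (hFy : 0 < F y)
    (hzero : ∀ z, F z = 0 → g z ≤ g y) (hsph : ∀ z ∈ Metric.sphere z₀ r, 0 ≤ F z → g z < g y) :
    ∃ z ∈ Metric.ball z₀ r, 0 < F z ∧ g y ≤ g z ∧ IsLocalMax g z := by
  have : ProperSpace P := FiniteDimensional.proper ℝ P
  have hD : IsCompact (Metric.closedBall z₀ r ∩ {z | 0 ≤ F z}) :=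
    (isCompact_closedBall z₀ r).inter_right (isClosed_le continuous_const hF)
  obtain ⟨z, hz, hmax⟩ := hD.exists_isMaxOn ⟨y, hy, hFy.le⟩ hg.continuousOn
  have key : ∀ w ∈ Metric.closedBall z₀ r, 0 < F w → g w = g z → 
      ∃ z ∈ Metric.ball z₀ r, 0 < F z ∧ g y ≤ g z ∧ IsLocalMax g z := by
    intro w hw hFw hgw
    have hyw : g y ≤ g w := hgw ▸ hmax ⟨hy, hFy.le⟩
    have hwb : w ∈ Metric.ball z₀ r := by
      rw [← Metric.ball_union_sphere] at hw
      exact hw.resolve_right fun h => absurd (hsph w h hFw.le) (not_lt.2 hyw)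
    refine ⟨w, hwb, hFw, hyw, ?_⟩
    filter_upwards [Metric.isOpen_ball.mem_nhds hwb, (isOpen_lt continuous_const hF).mem_nhds hFw]
      with v hv1 hv2
    rw [hgw]
    exact hmax ⟨Metric.ball_subset_closedBall hv1, (show 0 < F v from hv2).le⟩
  rcases (show 0 ≤ F z from hz.2).eq_or_lt with h | h
  · refine key y hy hFy (le_antisymm (hmax ⟨hy, hFy.le⟩) (hzero z h.symm))
  · exact key z hz.1 h rfl

/-- A ball in the plane without local extrema contains no closed level curve. -/
theorem not_exists_closed_level_curve (hrank : 1 < Module.rank ℝ P) {g : P → ℝ} (hg : Continuous g) {z₀ : P} {r : ℝ}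
    {O N : Set P} (hOc : IsCompact O) (hO : IsConnected O) {e : ℝ}
    (hOe : ∀ z ∈ O, g z = e) (hN : IsOpen N) (hON : O ⊆ N) (hNO : ∀ z ∈ N, g z = e → z ∈ O)
    (hOr : O ⊆ Metric.ball z₀ r) (hno : ∀ z ∈ Metric.ball z₀ r, ¬ IsLocalExtr g z) : False := by
  obtain ⟨F, hF, hF0, M, hM, hOM, δ, hδ, hFM⟩ :=
    exists_separating_function hg hOc hO hOe hN hON hNO
  obtain ⟨x, hx⟩ := hO.nonempty
  have hr : 0 ≤ r := by
    have := Metric.mem_ball.1 (hOr hx); have := dist_nonneg (x := x) (y := z₀); linarith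
  have hS := isConnected_sphere hrank z₀ hr
  have hSF : ∀ z ∈ Metric.sphere z₀ r, F z ≠ 0 := by
    intro z hz h
    have := Metric.mem_ball.1 (hOr ((hF0 z).1 h))
    rw [Metric.mem_sphere.1 hz] at this
    exact lt_irrefl _ this
  -- a region adjacent to the curve which avoids the sphere contains an extremum
  have key : ∀ g' F' : P → ℝ, ∀ e' : ℝ, Continuous g' → Continuous F' →
      (∀ z, F' z = 0 ↔ z ∈ O) → (∀ z ∈ O, g' z = e') → (∀ z ∈ M, F' z = (g' z - e') / δ) →
      (∀ z ∈ Metric.sphere z₀ r, F' z < 0) → (∀ z ∈ Metric.ball z₀ r, ¬ IsLocalMax g' z) →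
      False := by
    intro g' F' e' hg' hF' h0 he hM' hneg hno'
    have hnm := hno' x (hOr hx)
    rw [IsLocalMax, IsMaxFilter, not_eventually] at hnm
    obtain ⟨y, hy1, hy2, hy3⟩ := (hnm.and_eventually
      ((hM.eventually_mem (hOM hx)).and
      (Metric.isOpen_ball.eventually_mem (hOr hx)))).exists
    rw [not_le, he x hx] at hy1
    have hFy : 0 < F' y := by rw [hM' y hy2]; exact div_pos (by linarith) hδ
    obtain ⟨z, hz, -, -, hmax⟩ := exists_isLocalMax_of_region hg' hF'
      (Metric.ball_subset_closedBall hy3) hFy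
      (fun z hz => by rw [he z ((h0 z).1 hz)]; exact hy1.le)
      (fun z hz hz' => absurd hz' (not_le.2 (hneg z hz)))
    exact hno' z hz hmax
  obtain ⟨s, hs⟩ := hS.nonempty
  rcases lt_or_gt_of_ne (hSF s hs) with h | h
  · refine key g F e hg hF hF0 hOe hFM (fun z hz => ?_) (fun z hz hm => hno z hz (Or.inr hm))
    by_contra! hcon
    obtain ⟨w, hw, hw'⟩ := hS.isPreconnected.intermediate_value hs hz hF.continuousOn
      ⟨h.le, hcon⟩
    exact hSF w hw hw'
  · refine key (fun z => -g z) (fun z => -F z) (-e) hg.neg hF.neg (fun z => by simp [hF0])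
      (fun z hz => by simp [hOe z hz]) (fun z hz => by rw [hFM z hz]; ring)
      (fun z hz => ?_) (fun z hz hm => hno z hz (Or.inl ?_))
    · by_contra! hcon
      obtain ⟨w, hw, hw'⟩ := hS.isPreconnected.intermediate_value hz hs hF.continuousOn
        ⟨by linarith, h.le⟩
      exact hSF w hw hw'
    · exact isLocalMin_of_neg hm

/-- Around a minimum `z₀` which is the only local extremum in a ball, a closed level curve is
the whole level set. -/
theorem mem_closed_level_curve (hrank : 1 < Module.rank ℝ P) {g : P → ℝ} (hg : Continuous g) {z₀ : P} {r : ℝ}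
    {O N : Set P} (hOc : IsCompact O) (hO : IsConnected O) {e : ℝ}
    (hOe : ∀ z ∈ O, g z = e) (hN : IsOpen N) (hON : O ⊆ N) (hNO : ∀ z ∈ N, g z = e → z ∈ O)
    (hOr : O ⊆ Metric.ball z₀ r) (hno : ∀ z ∈ Metric.ball z₀ r, IsLocalExtr g z → z = z₀)
    (h₀ : g z₀ < e) (hsph : ∀ z ∈ Metric.sphere z₀ r, e < g z) {z : P}
    (hz : z ∈ Metric.closedBall z₀ r) (hze : g z = e) : z ∈ O := by
  obtain ⟨F, hF, hF0, M, hM, hOM, δ, hδ, hFM⟩ :=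
    exists_separating_function hg hOc hO hOe hN hON hNO
  obtain ⟨x, hx⟩ := hO.nonempty
  have hxb := hOr hx
  have hr : 0 ≤ r := by
    have := Metric.mem_ball.1 hxb; have := dist_nonneg (x := x) (y := z₀); linarith
  have hxz : x ≠ z₀ := by rintro rfl; exact h₀.ne (hOe x hx)
  have hS := isConnected_sphere hrank z₀ hr
  have hSF : ∀ z ∈ Metric.sphere z₀ r, F z ≠ 0 := by
    intro z hz h
    exact (hsph z hz).ne' (hOe z ((hF0 z).1 h))
  have hnear' : ∃ᶠ y in 𝓝 x, y ∈ Metric.ball z₀ r ∧ F y < 0 ∧ g y < e := by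
    have hnm : ¬ IsLocalMin g x := fun h => hxz (hno x hxb (Or.inl h))
    rw [IsLocalMin, IsMinFilter, not_eventually] at hnm
    refine (hnm.and_eventually ((hM.eventually_mem (hOM hx)).and
      (Metric.isOpen_ball.eventually_mem hxb))).mono ?_
    rintro y ⟨hy1, hy2, hy3⟩
    rw [not_le, hOe x hx] at hy1
    exact ⟨hy3, by rw [hFM y hy2]; exact div_neg_of_neg_of_pos (by linarith) hδ, hy1⟩
  -- the sphere lies in the region `F > 0`
  have hpos : ∀ z ∈ Metric.sphere z₀ r, 0 < F z := by
    intro z hz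
    by_contra! hcon
    have hneg : ∀ w ∈ Metric.sphere z₀ r, F w < 0 := by
      intro w hw
      by_contra! hcon'
      obtain ⟨v, hv, hv'⟩ := hS.isPreconnected.intermediate_value hz hw hF.continuousOn
        ⟨hcon, hcon'⟩
      exact hSF v hv hv'
    have hnm : ¬ IsLocalMax g x := fun h => hxz (hno x hxb (Or.inr h))
    rw [IsLocalMax, IsMaxFilter, not_eventually] at hnm
    obtain ⟨y, hy1, hy2, hy3⟩ := (hnm.and_eventually
      ((hM.eventually_mem (hOM hx)).and
      (Metric.isOpen_ball.eventually_mem hxb))).exists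
    rw [not_le, hOe x hx] at hy1
    have hFy : 0 < F y := by rw [hFM y hy2]; exact div_pos (by linarith) hδ
    obtain ⟨w, hw, -, hyw, hmax⟩ := exists_isLocalMax_of_region hg hF
      (Metric.ball_subset_closedBall hy3) hFy
      (fun z hz => by rw [hOe z ((hF0 z).1 hz)]; exact hy1.le)
      (fun z hz hz' => absurd hz' (not_le.2 (hneg z hz)))
    have := hno w hw (Or.inr hmax)
    rw [this] at hyw
    linarith
  -- the minimum lies in the region `F < 0`
  have hF₀ : F z₀ < 0 := by
    obtain ⟨y, hy1, hy2, hy3⟩ := hnear'.exists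
    obtain ⟨w, hw, hFw, -, hmax⟩ := exists_isLocalMax_of_region hg.neg hF.neg
      (Metric.ball_subset_closedBall hy1) (by simpa using hy2)
      (fun z hz => by
        have := hOe z ((hF0 z).1 (by simpa using hz))
        simp only [Pi.neg_apply]; linarith)
      (fun z hz hz' => by
        have h1 := hpos z hz
        simp only [Pi.neg_apply] at hz'; linarith)
    have := hno w hw (Or.inl (isLocalMin_of_neg hmax))
    rw [this] at hFw
    simpa using hFw
  rw [← hF0]
  rcases lt_trichotomy (F z) 0 with h | h | h
  · exfalso
    obtain ⟨w, hw, -, hzw, hmax⟩ := exists_isLocalMax_of_region hg hF.neg hz (by simpa using h)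
      (fun v hv => by rw [hOe v ((hF0 v).1 (by simpa using hv)), hze])
      (fun v hv hv' => by
        have h1 := hpos v hv
        simp only [Pi.neg_apply] at hv'; linarith)
    rw [hno w hw (Or.inr hmax)] at hzw
    linarith
  · exact h
  · exfalso
    obtain ⟨w, hw, hFw, -, hmax⟩ := exists_isLocalMax_of_region hg.neg hF hz h
      (fun v hv => by simp only [Pi.neg_apply]; rw [hOe v ((hF0 v).1 hv), hze])
      (fun v hv _ => by
        have := hsph v hv
        simp only [Pi.neg_apply]; linarith)
    rw [hno w hw (Or.inl (isLocalMin_of_neg hmax))] at hFw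
    linarith

end Enclosure

/-! ### Local extrema on the sphere -/

/-- Stereographic coordinates around a point of the sphere. -/
theorem exists_sphere_chart {u₀ : E3} (hu₀ : u₀ ∈ S2) :
    ∃ (ψ : EuclideanSpace ℝ (Fin 2) → E3) (z₀ : EuclideanSpace ℝ (Fin 2)), ψ z₀ = u₀ ∧
      IsEmbedding ψ ∧ (∀ z, ψ z ∈ S2) ∧ (∀ z, map ψ (𝓝 z) = 𝓝[S2] (ψ z)) ∧
      ∀ U, IsOpen U → ∃ O, IsOpen O ∧ ψ '' U = S2 ∩ O := by
  have hfact : Fact (Module.finrank ℝ E3 = 2 + 1) := ⟨by simp⟩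
  let p : Metric.sphere (0 : E3) 1 := ⟨u₀, hu₀⟩
  let v : Metric.sphere (0 : E3) 1 := -p
  let c := stereographic' 2 v
  have htarget : c.target = univ := stereographic'_target v
  have hsource : c.source = {v}ᶜ := stereographic'_source v
  have hopen : IsOpenEmbedding c.symm :=
    c.symm.isOpenEmbedding htarget
  have hmem : p ∈ c.source := by
    rw [hsource, mem_compl_singleton_iff]
    exact ne_neg_of_mem_unit_sphere ℝ p
  refine ⟨fun z => (c.symm z : E3), c p, congrArg Subtype.val (c.left_inv hmem),
    IsEmbedding.subtypeVal.comp hopen.isEmbedding, fun z => (c.symm z).2, fun z => ?_,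
    fun U hU => ?_⟩
  · have : map (fun z => (c.symm z : E3)) (𝓝 z) = map Subtype.val (map c.symm (𝓝 z)) := rfl
    rw [this, hopen.map_nhds_eq, map_nhds_subtype_val]
    rfl
  · obtain ⟨O, hO, hOU⟩ := isOpen_induced_iff.1 (hopen.isOpenMap U hU)
    refine ⟨O, hO, ?_⟩
    have : (fun z => (c.symm z : E3)) '' U = Subtype.val '' (c.symm '' U) := by
      rw [image_image]
    rw [this, ← hOU, Subtype.image_preimage_coe]
    rfl

/-- The great circle through `u` with velocity `w`. -/
noncomputable def greatCircle (u w : E3) (s : ℝ) : E3 := Real.cos s • u + Real.sin s • w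

theorem greatCircle_zero (u w : E3) : greatCircle u w 0 = u := by simp [greatCircle]

theorem greatCircle_mem {u w : E3} (hu : u ∈ S2) (hw : w ∈ S2) (huw : inner ℝ u w = 0) (s : ℝ) :
    greatCircle u w s ∈ S2 := by
  rw [mem_S2] at *
  have h : inner ℝ w u = 0 := by rw [real_inner_comm, huw]
  simp only [greatCircle, inner_add_left, inner_add_right, inner_smul_left, inner_smul_right,
    hu, hw, huw, h]
  have := Real.sin_sq_add_cos_sq s
  simp
  nlinarith

theorem contDiff_greatCircle {n : WithTop ℕ∞} (u w : E3) : ContDiff ℝ n (greatCircle u w) :=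
  (Real.contDiff_cos.smul contDiff_const).add (Real.contDiff_sin.smul contDiff_const)

theorem hasDerivAt_greatCircle_zero (u w : E3) : HasDerivAt (greatCircle u w) w 0 := by
  have := ((Real.hasDerivAt_cos 0).smul_const u).add ((Real.hasDerivAt_sin 0).smul_const w)
  simp only [Real.sin_zero, Real.cos_zero, neg_zero, zero_smul, one_smul, zero_add] at this
  exact this

/-- A critical point is recognised on curves: it suffices that the derivative of `G` along every
great circle vanishes. -/
theorem isCriticalOnSphere_of_unit {G : E3 → ℝ} {u : E3}
    (h : ∀ w ∈ S2, inner ℝ u w = 0 → fderiv ℝ G u w = 0) : IsCriticalOnSphere G u := by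
  intro w hw
  rcases eq_or_ne w 0 with rfl | hw0
  · simp
  · have hn : ‖w‖ ≠ 0 := norm_ne_zero_iff.2 hw0
    have h1 := h (‖w‖⁻¹ • w) (by simp [S2, norm_smul, hn]) (by rw [inner_smul_right, hw, mul_zero])
    rw [map_smul, smul_eq_mul] at h1
    exact (mul_eq_zero.1 h1).resolve_left (inv_ne_zero hn)

theorem isCriticalOnSphere_of_isLocalExtrOn {G : E3 → ℝ} {u : E3} (hG : DifferentiableAt ℝ G u)
    (hu : u ∈ S2) (h : IsLocalExtrOn G S2 u) : IsCriticalOnSphere G u := by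
  refine isCriticalOnSphere_of_unit fun w hw huw => ?_
  have hd : HasDerivAt (fun s => G (greatCircle u w s)) (fderiv ℝ G u w) 0 := by
    have hG' := hG
    rw [← greatCircle_zero u w] at hG'
    have := hG'.hasFDerivAt.comp_hasDerivAt 0 (hasDerivAt_greatCircle_zero u w)
    rwa [greatCircle_zero] at this
  have ht : Tendsto (greatCircle u w) (𝓝 0) (𝓝[S2] u) := by
    refine tendsto_nhdsWithin_iff.2 ⟨?_, Eventually.of_forall (greatCircle_mem hu hw huw)⟩
    have := (hasDerivAt_greatCircle_zero u w).continuousAt.tendsto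
    rwa [greatCircle_zero] at this
  refine IsLocalExtr.hasDerivAt_eq_zero ?_ hd
  rcases h with h | h
  · refine Or.inl ?_
    have := ht.eventually h
    change ∀ᶠ s in 𝓝 (0 : ℝ), G (greatCircle u w 0) ≤ G (greatCircle u w s)
    rwa [greatCircle_zero]
  · refine Or.inr ?_
    have := ht.eventually h
    change ∀ᶠ s in 𝓝 (0 : ℝ), G (greatCircle u w s) ≤ G (greatCircle u w 0)
    rwa [greatCircle_zero]

theorem isLocalExtrOn_of_chart {G : E3 → ℝ} {ψ : EuclideanSpace ℝ (Fin 2) → E3}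
    {z : EuclideanSpace ℝ (Fin 2)} (hmap : map ψ (𝓝 z) = 𝓝[S2] (ψ z))
    (h : IsLocalExtr (fun z => G (ψ z)) z) : IsLocalExtrOn G S2 (ψ z) := by
  rcases h with h | h
  · refine Or.inl ?_
    rw [IsMinFilter, ← hmap]
    exact h
  · refine Or.inr ?_
    rw [IsMaxFilter, ← hmap]
    exact h

theorem one_lt_rank_plane : 1 < Module.rank ℝ (EuclideanSpace ℝ (Fin 2)) := by
  rw [← Module.finrank_eq_rank]
  simp

/-! ### Periodic orbits near isolated critical points -/

theorem IsSphereFlow.periodic (hΦ : IsSphereFlow G Φ) {x : E3} {T : ℝ} (hT : Φ T x = x) :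
    Function.Periodic (fun t => Φ t x) T := fun t => by
  simp only
  rw [hΦ.add, hT]

/-- A closed orbit inside of a chart, seen in the chart. -/
theorem IsSphereFlow.exists_preimage_orbit (hΦ : IsSphereFlow G Φ) (hG : ContDiff ℝ 2 G) {x : E3}
    (hx : x ∈ S2) (hreg : cross x (gradient G x) ≠ 0) {T : ℝ} (hT : 0 < T) (hTx : Φ T x = x)
    {ψ : EuclideanSpace ℝ (Fin 2) → E3} (hψ : IsEmbedding ψ) (hψS : ∀ z, ψ z ∈ S2)
    {U : Set (EuclideanSpace ℝ (Fin 2))} (hU : ∀ t, Φ t x ∈ ψ '' U) :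
    ∃ O N : Set (EuclideanSpace ℝ (Fin 2)), ψ '' O = range (fun t => Φ t x) ∧ IsCompact O ∧
      IsConnected O ∧ (∀ z ∈ O, G (ψ z) = G x) ∧ IsOpen N ∧ O ⊆ N ∧
      (∀ z ∈ N, G (ψ z) = G x → z ∈ O) ∧ O ⊆ U := by
  obtain ⟨N, hN, hxN, hNx⟩ := hΦ.exists_isOpen_orbit hG hx hreg
  have himg : ψ '' (ψ ⁻¹' range fun t => Φ t x) = range fun t => Φ t x := by
    rw [image_preimage_eq_iff]
    rintro _ ⟨t, rfl⟩
    exact image_subset_range _ _ (hU t)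
  refine ⟨ψ ⁻¹' range fun t => Φ t x, ψ ⁻¹' N, himg, ?_, ?_, ?_, hN.preimage hψ.continuous,
    preimage_mono hxN, fun z hz h => hNx _ hz (hψS z) h, ?_⟩
  · rw [hψ.isCompact_iff, himg]
    exact (hΦ.periodic hTx).compact_of_continuous hT.ne' (hΦ.continuous_orbit x)
  · have hc : IsConnected (range fun t => Φ t x) := isConnected_range (hΦ.continuous_orbit x)
    refine ⟨?_, ?_⟩
    · rw [← image_nonempty (f := ψ), himg]; exact hc.nonempty
    · rw [← hψ.isInducing.isPreconnected_image, himg]; exact hc.isPreconnected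
  · rintro z ⟨t, ht⟩
    rw [← ht, hΦ.energy t x hx]
  · rintro z ⟨t, ht⟩
    obtain ⟨w, hw, hwz⟩ := hU t
    have : w = z := hψ.injective (hwz.trans ht)
    exact this ▸ hw

/-- Near an isolated critical point which is not an extremum, orbits leave a fixed neighbourhood:
otherwise they would be closed and hence enclose an extremum. -/
theorem IsSphereFlow.exists_leaving (hΦ : IsSphereFlow G Φ) (hG : ContDiff ℝ 2 G) {u₀ : E3}
    (hu₀ : u₀ ∈ S2) (hiso : ∀ᶠ u in 𝓝 u₀, u ∈ S2 → cross u (gradient G u) = 0 → u = u₀)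
    (hext : ¬ IsLocalExtrOn G S2 u₀) :
    ∃ U ∈ 𝓝 u₀, ∀ V ∈ 𝓝 u₀, ∃ x ∈ V, x ∈ S2 ∧ ∃ t, 0 ≤ t ∧ Φ t x ∉ U := by
  obtain ⟨ψ, z₀, hz₀, hψ, hψS, hmap, hopen⟩ := exists_sphere_chart hu₀
  have hcrit : ∀ᶠ z in 𝓝 z₀, cross (ψ z) (gradient G (ψ z)) = 0 → z = z₀ := by
    have := hψ.continuous.continuousAt.eventually (hz₀.symm ▸ hiso :
      ∀ᶠ u in 𝓝 (ψ z₀), u ∈ S2 → cross u (gradient G u) = 0 → u = u₀)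
    filter_upwards [this] with z hz h
    exact hψ.injective ((hz (hψS z) h).trans hz₀.symm)
  obtain ⟨r, hr, hrz⟩ := Metric.nhds_basis_closedBall.eventually_iff.1 hcrit
  obtain ⟨U, hU, hUr⟩ := hopen _ (Metric.isOpen_ball (x := z₀) (ε := r))
  have hu₀U : u₀ ∈ U := by
    have : u₀ ∈ S2 ∩ U := by rw [← hUr, ← hz₀]; exact mem_image_of_mem _ (Metric.mem_ball_self hr)
    exact this.2
  refine ⟨U, hU.mem_nhds hu₀U, fun V hV => ?_⟩
  obtain ⟨x, hxV, hxU, hxS, hxG⟩ : ∃ x ∈ V, x ∈ U ∧ x ∈ S2 ∧ G x ≠ G u₀ := by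
    by_contra! hcon
    refine hext (Or.inl ?_)
    filter_upwards [self_mem_nhdsWithin, nhdsWithin_le_nhds hV,
      nhdsWithin_le_nhds (hU.mem_nhds hu₀U)] with x h1 h2 h3
    exact (hcon x h2 h3 h1).ge
  refine ⟨x, hxV, hxS, ?_⟩
  by_contra! hcon
  have hstay : ∀ t, 0 ≤ t → Φ t x ∈ ψ '' Metric.ball z₀ r := fun t ht => by
    rw [hUr]; exact ⟨hΦ.mem t x hxS, hcon t ht⟩
  have hregular : ∀ y ∈ ψ '' Metric.closedBall z₀ r, y ∈ S2 → G y = G x →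
      cross y (gradient G y) ≠ 0 := by
    rintro _ ⟨z, hz, rfl⟩ - hGy h
    rw [hrz hz h, hz₀] at hGy
    exact hxG hGy.symm
  obtain ⟨T, hT, hTx⟩ := hΦ.exists_period_of_isCompact hG hxS
    ((isCompact_closedBall z₀ r).image hψ.continuous)
    (fun t ht => image_mono Metric.ball_subset_closedBall (hstay t ht)) hregular
  have hstay' : ∀ t, Φ t x ∈ ψ '' Metric.ball z₀ r := by
    intro t
    obtain ⟨s, hs, hst⟩ := (hΦ.periodic hTx).exists_mem_Ico₀ hT t
    rw [show Φ t x = Φ s x from hst]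
    exact hstay s hs.1
  have hxreg : cross x (gradient G x) ≠ 0 := by
    have := hstay 0 le_rfl
    rw [hΦ.zero] at this
    exact hregular x (image_mono Metric.ball_subset_closedBall this) hxS rfl
  obtain ⟨O, N, -, hOc, hO, hOG, hN, hON, hNO, hOr⟩ :=
    hΦ.exists_preimage_orbit hG hxS hxreg hT hTx hψ hψS hstay'
  refine not_exists_closed_level_curve one_lt_rank_plane (hG.continuous.comp hψ.continuous) hOc hO
    hOG hN hON hNO hOr fun z hz hzext => ?_
  have h1 := isLocalExtrOn_of_chart (hmap z) hzext
  have h2 := isCriticalOnSphere_of_isLocalExtrOn (hG.differentiable two_ne_zero _) (hψS z) h1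
  have h3 := hrz (Metric.ball_subset_closedBall hz) ((isCriticalOnSphere_iff (hψS z)).1 h2)
  rw [h3, hz₀] at h1
  exact hext h1

/-- Around an isolated critical point `u₀` which is a minimum of `κ • G`, there is a compact disc
`B` on which the level sets of energy close to `G u₀` are closed orbits. -/
theorem IsSphereFlow.exists_disc (hΦ : IsSphereFlow G Φ) (hG : ContDiff ℝ 2 G) {u₀ : E3}
    (hu₀ : u₀ ∈ S2) (hiso : ∀ᶠ u in 𝓝 u₀, u ∈ S2 → cross u (gradient G u) = 0 → u = u₀)
    {κ : ℝ} (hκ : κ ≠ 0) (hext : IsLocalMinOn (fun u => κ * G u) S2 u₀) {V : Set E3}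
    (hV : V ∈ 𝓝 u₀) :
    ∃ B ⊆ V, IsCompact B ∧ B ⊆ S2 ∧ B ∈ 𝓝[S2] u₀ ∧
      (∀ u ∈ B, u ≠ u₀ → cross u (gradient G u) ≠ 0 ∧ 0 < κ * (G u - G u₀)) ∧
      ∃ η > 0, (∀ x ∈ B, 0 < κ * (G x - G u₀) → κ * (G x - G u₀) < η →
          (∃ T, 0 < T ∧ Φ T x = x) ∧ range (fun t => Φ t x) = {u | u ∈ B ∧ G u = G x}) ∧
        ∀ ρ ≤ η, ∃ O, IsOpen O ∧ {u | u ∈ B ∧ κ * (G u - G u₀) < ρ} = S2 ∩ O := by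
  obtain ⟨ψ, z₀, hz₀, hψ, hψS, hmap, hopen⟩ := exists_sphere_chart hu₀
  have hev : ∀ᶠ z in 𝓝 z₀, (cross (ψ z) (gradient G (ψ z)) = 0 → z = z₀) ∧
      κ * G u₀ ≤ κ * G (ψ z) ∧ ψ z ∈ V := by
    have h1 := hψ.continuous.continuousAt.eventually (hz₀.symm ▸ hiso :
      ∀ᶠ u in 𝓝 (ψ z₀), u ∈ S2 → cross u (gradient G u) = 0 → u = u₀)
    have h2 : ∀ᶠ z in 𝓝 z₀, κ * G u₀ ≤ κ * G (ψ z) := by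
      have : ∀ᶠ u in map ψ (𝓝 z₀), κ * G u₀ ≤ κ * G u := by rw [hmap, hz₀]; exact hext
      exact this
    have h3 : ∀ᶠ z in 𝓝 z₀, ψ z ∈ V :=
      (hψ.continuous.tendsto z₀).eventually (by rw [hz₀]; exact hV)
    filter_upwards [h1, h2, h3] with z hz hz' hz''
    exact ⟨fun h => hψ.injective ((hz (hψS z) h).trans hz₀.symm), hz', hz''⟩
  obtain ⟨R, hR, hRz⟩ := Metric.nhds_basis_ball.eventually_iff.1 hev
  set r := R / 2 with hr
  have hr0 : 0 < r := by positivity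
  have hsub : Metric.closedBall z₀ r ⊆ Metric.ball z₀ R :=
    Metric.closedBall_subset_ball (by linarith)
  set g : EuclideanSpace ℝ (Fin 2) → ℝ := fun z => κ * (G (ψ z) - G u₀) with hg
  have hGψ : Continuous fun z => G (ψ z) := hG.continuous.comp hψ.continuous
  have hgc : Continuous g := by fun_prop
  have hextr : ∀ z, IsLocalExtr g z → cross (ψ z) (gradient G (ψ z)) = 0 := by
    intro z hz
    refine (isCriticalOnSphere_iff (hψS z)).1 (isCriticalOnSphere_of_isLocalExtrOn
      (hG.differentiable two_ne_zero _) (hψS z) (isLocalExtrOn_of_chart (hmap z) ?_))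
    rcases lt_or_gt_of_ne hκ with hκ' | hκ'
    · rcases hz with hz | hz
      · exact Or.inr (hz.mono fun y hy => by simp only [hg] at hy; nlinarith)
      · exact Or.inl (hz.mono fun y hy => by simp only [hg] at hy; nlinarith)
    · rcases hz with hz | hz
      · exact Or.inl (hz.mono fun y hy => by simp only [hg] at hy; nlinarith)
      · exact Or.inr (hz.mono fun y hy => by simp only [hg] at hy; nlinarith)
  have hgpos : ∀ z ∈ Metric.closedBall z₀ r, z ≠ z₀ → 0 < g z := by
    intro z hz hne
    have hz' := hsub hz
    have h0 : 0 ≤ g z := by simp only [hg]; linarith [(hRz hz').2.1]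
    refine h0.lt_of_ne fun h => hne ((hRz hz').1 (hextr z (Or.inl ?_)))
    filter_upwards [Metric.isOpen_ball.mem_nhds hz'] with w hw
    rw [← h]
    simp only [hg]; linarith [(hRz hw).2.1]
  have hS : (Metric.sphere z₀ r).Nonempty := (isConnected_sphere one_lt_rank_plane z₀ hr0.le).nonempty
  obtain ⟨s, hs, hsmin⟩ := (isCompact_sphere z₀ r).exists_isMinOn hS hgc.continuousOn
  have hη : 0 < g s := hgpos s (Metric.sphere_subset_closedBall hs) (by
    rintro rfl; rw [Metric.mem_sphere, dist_self] at hs; exact hr0.ne hs)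
  -- below the energy of the boundary, the disc and its interior have the same points
  have hint : ∀ z ∈ Metric.closedBall z₀ r, g z < g s → z ∈ Metric.ball z₀ r := by
    intro z hz hlt
    rw [← Metric.ball_union_sphere] at hz
    exact hz.resolve_right fun h => absurd (hsmin h) (not_le.2 hlt)
  have hcomp : IsCompact (ψ '' Metric.closedBall z₀ r) :=
    (isCompact_closedBall z₀ r).image hψ.continuous
  refine ⟨ψ '' Metric.closedBall z₀ r, ?_, hcomp, ?_, ?_, ?_, g s, hη, ?_, ?_⟩
  · rintro _ ⟨z, hz, rfl⟩; exact (hRz (hsub hz)).2.2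
  · rintro _ ⟨z, -, rfl⟩; exact hψS z
  · rw [← hz₀, ← hmap]; exact image_mem_map (Metric.closedBall_mem_nhds z₀ hr0)
  · rintro _ ⟨z, hz, rfl⟩ hne
    have hne' : z ≠ z₀ := by rintro rfl; exact hne hz₀
    exact ⟨fun h => hne' ((hRz (hsub hz)).1 h), hgpos z hz hne'⟩
  · rintro _ ⟨zx, hzx, rfl⟩ hpos hlt
    set x := ψ zx with hx
    have hxS : x ∈ S2 := hψS zx
    have hval : ∀ t, κ * (G (Φ t x) - G u₀) = g zx := fun t => by rw [hΦ.energy t x hxS]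
    have hstay : ∀ t, Φ t x ∈ ψ '' Metric.ball z₀ r := by
      obtain ⟨O, hO, hOr⟩ := hopen _ (Metric.isOpen_ball (x := z₀) (ε := r))
      have hset : {t | Φ t x ∈ ψ '' Metric.ball z₀ r} = {t | Φ t x ∈ O} := by
        ext t
        simp only [mem_ofPred_eq, hOr]
        exact ⟨fun h => h.2, fun h => ⟨hΦ.mem t x hxS, h⟩⟩
      have hset' : {t | Φ t x ∈ ψ '' Metric.ball z₀ r} =
          {t | Φ t x ∈ ψ '' Metric.closedBall z₀ r} := by
        ext t
        refine ⟨fun h => image_mono Metric.ball_subset_closedBall h, ?_⟩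
        rintro ⟨z, hz, hzt⟩
        refine ⟨z, hint z hz ?_, hzt⟩
        have := hval t
        rw [← hzt] at this
        exact this.trans_lt hlt
      have hclopen : IsClopen {t | Φ t x ∈ ψ '' Metric.ball z₀ r} := by
        constructor
        · rw [hset']; exact hcomp.isClosed.preimage (hΦ.continuous_orbit x)
        · rw [hset]; exact hO.preimage (hΦ.continuous_orbit x)
      have huniv := hclopen.eq_univ ⟨0, by
        rw [mem_ofPred_eq, hΦ.zero]; exact ⟨zx, hint zx hzx hlt, rfl⟩⟩
      intro t
      have : t ∈ {t | Φ t x ∈ ψ '' Metric.ball z₀ r} := by rw [huniv]; trivial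
      exact this
    have hregular : ∀ y ∈ ψ '' Metric.closedBall z₀ r, y ∈ S2 → G y = G x →
        cross y (gradient G y) ≠ 0 := by
      rintro _ ⟨z, hz, rfl⟩ - hGy h
      rw [(hRz (hsub hz)).1 h, hz₀] at hGy
      rw [← hGy] at hpos
      simp at hpos
    obtain ⟨T, hT, hTx⟩ := hΦ.exists_period_of_isCompact hG hxS hcomp
      (fun t _ => image_mono Metric.ball_subset_closedBall (hstay t)) hregular
    refine ⟨⟨T, hT, hTx⟩, ?_⟩
    obtain ⟨O, N, hOx, hOc, hO, hOG, hN, hON, hNO, hOr⟩ := hΦ.exists_preimage_orbit hG hxS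
      (hregular x ⟨zx, hzx, rfl⟩ hxS rfl) hT hTx hψ hψS hstay
    have hiff : ∀ z, g z = g zx ↔ G (ψ z) = G x := by
      intro z
      simp only [hg]
      rw [mul_right_inj' hκ, sub_left_inj]
    apply Subset.antisymm
    · rintro _ ⟨t, rfl⟩
      exact ⟨image_mono Metric.ball_subset_closedBall (hstay t), hΦ.energy t x hxS⟩
    · rintro _ ⟨⟨z, hz, rfl⟩, hzG⟩
      rw [← hOx]
      refine mem_image_of_mem ψ (mem_closed_level_curve one_lt_rank_plane hgc (z₀ := z₀) (r := r)
        hOc hO (e := g zx) (fun z hz => (hiff z).2 (hOG z hz)) hN hON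
        (fun z hz h => hNO z hz ((hiff z).1 h)) hOr ?_ ?_ ?_ hz ((hiff z).2 hzG))
      · intro z hz hext
        exact (hRz (hsub (Metric.ball_subset_closedBall hz))).1 (hextr z hext)
      · have : g z₀ = 0 := by simp [hg, hz₀]
        rw [this]; exact hpos
      · intro z hz
        exact hlt.trans_le (hsmin hz)
  · intro ρ hρ
    obtain ⟨O, hO, hOr⟩ := hopen (Metric.ball z₀ r ∩ g ⁻¹' Iio ρ)
      (Metric.isOpen_ball.inter (isOpen_Iio.preimage hgc))
    refine ⟨O, hO, ?_⟩
    rw [← hOr]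
    ext u
    constructor
    · rintro ⟨⟨z, hz, rfl⟩, hu⟩
      exact ⟨z, ⟨hint z hz (lt_of_lt_of_le hu hρ), hu⟩, rfl⟩
    · rintro ⟨z, ⟨hz, hu⟩, rfl⟩
      exact ⟨⟨z, Metric.ball_subset_closedBall hz, rfl⟩, hu⟩

/-! ### Anti-rational equations in the complex plane -/

section Schwarz

open Polynomial ComplexConjugate

/-- If `z ↦ q(z) / l(z)` agrees with complex conjugation on an infinite set, then its degree is at
most one: composed with its conjugate it is the identity, so that it takes almost every value only
once, and it has no critical points then. -/
theorem natDegree_le_one_of_infinite {q l : ℂ[X]} (hql : IsCoprime q l)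
    (hinf : {z : ℂ | conj z * l.eval z = q.eval z}.Infinite) :
    max q.natDegree l.natDegree ≤ 1 := by
  set n := max q.natDegree l.natDegree with hn
  have hne : ∀ z, l.eval z = 0 → q.eval z ≠ 0 := by
    intro z h1 h2
    obtain ⟨a, b, hab⟩ := hql
    have := congrArg (eval z) hab
    simp [h1, h2] at this
  have hl0 : l ≠ 0 := by
    rintro rfl
    obtain ⟨z, hz⟩ := hinf.nonempty
    exact hne z (by simp) (by simpa using hz.symm)
  -- the numerator of `p (q / l)` over the denominator `l ^ n`
  let hom : ℂ[X] → ℂ[X] := fun p => ∑ i ∈ Finset.range (n + 1), C (p.coeff i) * q ^ i * l ^ (n - i)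
  have hhom : ∀ p : ℂ[X], p.natDegree ≤ n → ∀ z, l.eval z ≠ 0 →
      (hom p).eval z = (l.eval z) ^ n * p.eval (q.eval z / l.eval z) := by
    intro p hp z hz
    rw [eval_eq_sum_range' (Nat.lt_succ_of_le hp), Finset.mul_sum, eval_finsetSum]
    refine Finset.sum_congr rfl fun i hi => ?_
    have hi' : i ≤ n := Nat.lt_succ_iff.1 (Finset.mem_range.1 hi)
    obtain ⟨k, hk⟩ := Nat.exists_eq_add_of_le hi'
    simp only [eval_mul, eval_pow, eval_C]
    rw [hk, Nat.add_sub_cancel_left, pow_add, div_pow]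
    field_simp
  set qb := q.map (starRingEnd ℂ)
  set lb := l.map (starRingEnd ℂ)
  have hqb : qb.natDegree ≤ n := natDegree_map_le.trans (le_max_left _ _)
  have hlb : lb.natDegree ≤ n := natDegree_map_le.trans (le_max_right _ _)
  have hzero : X * hom lb - hom qb = 0 := by
    refine eq_zero_of_infinite_isRoot _ (hinf.mono fun z hz => ?_)
    have hz' : conj z * l.eval z = q.eval z := hz
    have hlz : l.eval z ≠ 0 := fun h => hne z h (by rw [← hz', h, mul_zero])
    have hw : q.eval z / l.eval z = conj z := by rw [← hz', mul_div_assoc, div_self hlz, mul_one]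
    have hconj : z * lb.eval (conj z) = qb.eval (conj z) := by
      rw [eval_map_apply, eval_map_apply, ← hz', map_mul, Complex.conj_conj]
    change eval z (X * hom lb - hom qb) = 0
    rw [eval_sub, eval_mul, eval_X, hhom _ hlb z hlz, hhom _ hqb z hlz, hw, ← hconj]
    ring
  have hinv : ∀ z, l.eval z ≠ 0 →
      z * lb.eval (q.eval z / l.eval z) = qb.eval (q.eval z / l.eval z) := by
    intro z hz
    have := congrArg (eval z) hzero
    rw [eval_sub, eval_mul, eval_X, hhom _ hlb z hz, hhom _ hqb z hz, eval_zero, sub_eq_zero] at this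
    have h2 : (l.eval z) ^ n ≠ 0 := pow_ne_zero _ hz
    exact mul_left_cancel₀ h2 (by rw [← this]; ring)
  by_contra! hn2
  set bad : Set ℂ := {w | lb.eval w = 0} ∪ {q.coeff n / l.coeff n}
  have hbad : bad.Finite := by
    refine Set.Finite.union ?_ (finite_singleton _)
    have hlb0 : lb ≠ 0 := (Polynomial.map_ne_zero_iff (starRingEnd ℂ).injective).2 hl0
    exact lb.finite_setOfPred_isRoot hlb0
  -- a value taken only once is a critical value
  have hgood : ∀ w ∉ bad, ∃ z, l.eval z ≠ 0 ∧ q.eval z / l.eval z = w ∧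
      (derivative q * l - q * derivative l).eval z = 0 := by
    intro w hw
    simp only [bad, mem_union, mem_singleton_iff, not_or, mem_ofPred_eq] at hw
    set r := q - C w * l with hr
    have hcoeff : r.coeff n ≠ 0 := by
      rw [hr, coeff_sub, coeff_C_mul]
      intro h
      rcases eq_or_ne (l.coeff n) 0 with h0 | h0
      · have hq0 : q.coeff n = 0 := by simpa [h0] using h
        rcases max_choice q.natDegree l.natDegree with hm | hm
        · have : q.leadingCoeff = 0 := by rw [leadingCoeff, ← hm]; exact hq0
          rw [leadingCoeff_eq_zero] at this
          rw [this] at hm hn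
          rw [hm] at hn
          simp at hn
          omega
        · have : l.leadingCoeff = 0 := by rw [leadingCoeff, ← hm]; exact h0
          exact hl0 (leadingCoeff_eq_zero.1 this)
      · exact hw.2 (by field_simp; linear_combination -h)
    have hrdeg : n ≤ r.natDegree := le_natDegree_of_ne_zero hcoeff
    have hval : ∀ z, r.eval z = 0 → l.eval z ≠ 0 ∧ q.eval z / l.eval z = w := by
      intro z hz
      rw [hr, eval_sub, eval_mul, eval_C, sub_eq_zero] at hz
      have hlz : l.eval z ≠ 0 := fun h => hne z h (by rw [hz, h, mul_zero])
      exact ⟨hlz, by rw [hz, mul_div_assoc, div_self hlz, mul_one]⟩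
    obtain ⟨z₁, hz₁⟩ := IsAlgClosed.exists_root r (fun h => by
      have := natDegree_eq_zero_iff_degree_le_zero.2 h.le; omega)
    obtain ⟨r₁, hr₁⟩ := dvd_iff_isRoot.2 hz₁
    have hr0 : r ≠ 0 := fun h => hcoeff (by rw [h, coeff_zero])
    have hr₁0 : r₁ ≠ 0 := by rintro rfl; exact hr0 (by rw [hr₁, mul_zero])
    have hdeg : r.natDegree = 1 + r₁.natDegree := by
      rw [hr₁, natDegree_mul (X_sub_C_ne_zero z₁) hr₁0, natDegree_X_sub_C]
    obtain ⟨z₂, hz₂⟩ := IsAlgClosed.exists_root r₁ (fun h => by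
      have := natDegree_eq_zero_iff_degree_le_zero.2 h.le; omega)
    obtain ⟨hl₁, hw₁⟩ := hval z₁ hz₁
    obtain ⟨hl₂, hw₂⟩ := hval z₂ (by rw [hr₁, eval_mul, hz₂.eq_zero, mul_zero])
    have h₁ := hinv z₁ hl₁
    have h₂ := hinv z₂ hl₂
    rw [hw₁] at h₁
    rw [hw₂] at h₂
    have hz12 : z₁ = z₂ := mul_right_cancel₀ hw.1 (h₁.trans h₂.symm)
    refine ⟨z₁, hl₁, hw₁, ?_⟩
    have hder : (derivative r).eval z₁ = 0 := by
      rw [hr₁, derivative_mul, derivative_X_sub_C, one_mul, eval_add, eval_mul, eval_sub, eval_X,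
        eval_C, sub_self, zero_mul, add_zero, hz12, hz₂.eq_zero]
    rw [hr, derivative_sub, derivative_C_mul, eval_sub, eval_mul, eval_C] at hder
    have hq : q.eval z₁ = w * l.eval z₁ := by rw [← hw₁]; field_simp
    rw [eval_sub, eval_mul, eval_mul, hq]
    linear_combination l.eval z₁ * hder
  have hD : derivative q * l - q * derivative l = 0 := by
    by_contra hD
    have hfin : ((fun z => q.eval z / l.eval z) ''
        {z | (derivative q * l - q * derivative l).IsRoot z} ∪ bad).Finite :=
      ((finite_setOfPred_isRoot hD).image _).union hbad
    refine (infinite_univ (α := ℂ)) (hfin.subset fun w _ => ?_)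
    by_cases hw : w ∈ bad
    · exact Or.inr hw
    · obtain ⟨z, -, hz, hz'⟩ := hgood w hw
      exact Or.inl ⟨z, hz', hz⟩
  rw [sub_eq_zero] at hD
  have h1 : q ∣ derivative q := hql.dvd_of_dvd_mul_right ⟨_, hD⟩
  have h2 : l ∣ derivative l := hql.symm.dvd_of_dvd_mul_left ⟨derivative q, by rw [← hD, mul_comm]⟩
  have h3 := derivative_eq_zero.1 (dvd_derivative_iff.1 h1)
  have h4 := derivative_eq_zero.1 (dvd_derivative_iff.1 h2)
  rw [h3, h4] at hn
  simp at hn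
  omega

theorem exists_eq_mul_isCoprime (A : ℂ[X]) {B : ℂ[X]} (hB : B ≠ 0) :
    ∃ D a b, A = D * a ∧ B = D * b ∧ IsCoprime a b := by
  have h0 : EuclideanDomain.gcd A B ≠ 0 := fun h => hB (EuclideanDomain.gcd_eq_zero_iff.1 h).2
  obtain ⟨a, ha⟩ := EuclideanDomain.gcd_dvd_left A B
  obtain ⟨b, hb⟩ := EuclideanDomain.gcd_dvd_right A B
  refine ⟨_, a, b, ha, hb, ?_⟩
  refine ⟨EuclideanDomain.gcdA A B, EuclideanDomain.gcdB A B, mul_left_cancel₀ h0 ?_⟩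
  have h := EuclideanDomain.gcd_eq_gcd_ab A B
  rw [mul_one, mul_add, ← mul_assoc, ← mul_assoc, mul_right_comm, ← ha, mul_right_comm _ _ b, ← hb]
  exact h.symm

/-- The critical points of `log (|P(z)|² / (1 + |z|²)ᵂ)` are finite in number if `P` has at least
three zeros. -/
theorem finite_setOf_derivative_eq {P : ℂ[X]} {W : ℂ} (hW : W ≠ 0) {a b c : ℂ} (hab : a ≠ b)
    (hac : a ≠ c) (hbc : b ≠ c) (ha : P.eval a = 0) (hb : P.eval b = 0) (hc : P.eval c = 0) :
    {z : ℂ | P.eval z ≠ 0 ∧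
      (derivative P).eval z * (1 + z * conj z) = W * P.eval z * conj z}.Finite := by
  by_contra hinf
  have hP : P ≠ 0 := by
    rintro rfl
    exact hinf (by simp)
  have hP' : derivative P ≠ 0 := by
    intro h
    have := derivative_eq_zero.1 h
    obtain ⟨k, hk⟩ := natDegree_eq_zero.1 this
    rw [← hk, eval_C] at ha
    rw [ha, C_0] at hk
    exact hP hk.symm
  set L := C W * P - X * derivative P with hL
  obtain ⟨D, l, q, hDl, hDq, hcop⟩ := exists_eq_mul_isCoprime L hP'
  have hWP : C W * P = D * (l + X * q) := by
    rw [mul_add, ← hDl, mul_left_comm, ← hDq, hL]; ring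
  have hdeg := natDegree_le_one_of_infinite hcop.symm (Set.Infinite.mono ?_ hinf)
  · set R := l + X * q with hR
    have hR0 : R ≠ 0 := by
      intro h
      rw [h, mul_zero, mul_eq_zero, C_eq_zero] at hWP
      exact hWP.elim hW hP
    have hRdeg : R.natDegree ≤ 2 := by
      refine (natDegree_add_le _ _).trans (max_le ?_ ?_)
      · have := le_max_right q.natDegree l.natDegree; omega
      · refine natDegree_mul_le.trans ?_
        have := le_max_left q.natDegree l.natDegree
        rw [natDegree_X]; omega
    -- the factor `D` has a zero of `P` with multiplicity one less than `P`
    have hroot : ∀ ζ, P.eval ζ = 0 → R.eval ζ = 0 := by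
      intro ζ hζ
      by_contra hne
      have hD0 : D ≠ 0 := by rintro h; exact hP' (by rw [hDq, h, zero_mul])
      have h1 : (C W * P).rootMultiplicity ζ = P.rootMultiplicity ζ := by
        rw [rootMultiplicity_mul (mul_ne_zero (C_ne_zero.2 hW) hP), rootMultiplicity_C, zero_add]
      have h2 : (D * R).rootMultiplicity ζ = D.rootMultiplicity ζ := by
        rw [rootMultiplicity_mul (mul_ne_zero hD0 hR0), rootMultiplicity_eq_zero hne, add_zero]
      have h3 : D.rootMultiplicity ζ ≤ (derivative P).rootMultiplicity ζ :=
        rootMultiplicity_le_rootMultiplicity_of_dvd hP' ⟨q, hDq⟩ ζ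
      have h4 : (derivative P).rootMultiplicity ζ = P.rootMultiplicity ζ - 1 :=
        derivative_rootMultiplicity_of_root hζ
      have h5 : 0 < P.rootMultiplicity ζ := (rootMultiplicity_pos hP).2 hζ
      rw [hWP, h2] at h1
      omega
    have hcard : ({a, b, c} : Finset ℂ).card ≤ R.natDegree := by
      refine card_le_degree_of_subset_roots ?_
      intro ζ hζ
      rw [mem_roots hR0]
      simp only [Finset.mem_val, Finset.mem_insert, Finset.mem_singleton] at hζ
      rcases hζ with rfl | rfl | rfl
      · exact hroot _ ha
      · exact hroot _ hb
      · exact hroot _ hc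
    rw [Finset.card_eq_three.2 ⟨a, b, c, hab, hac, hbc, rfl⟩] at hcard
    omega
  · rintro z ⟨hz0, hz⟩
    have hDz : D.eval z ≠ 0 := by
      intro h
      have := congrArg (eval z) hWP
      rw [eval_mul, eval_mul, eval_C, h, zero_mul] at this
      exact (mul_ne_zero hW hz0) this
    have e1 := congrArg (eval z) hDq
    have e2 := congrArg (eval z) hDl
    simp only [hL, eval_mul, eval_sub, eval_C, eval_X] at e1 e2
    refine mul_left_cancel₀ hDz ?_
    linear_combination conj z * (-e2) + e1 - hz

end Schwarz

/-! ### Stereographic coordinates and critical points of products of distances -/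

section Stereographic

open Polynomial ComplexConjugate

/-- The inverse stereographic projection from the north pole. -/
noncomputable def stereo (z : ℂ) : E3 :=
  (1 + ‖z‖ ^ 2)⁻¹ • !₂[2 * z.re, 2 * z.im, ‖z‖ ^ 2 - 1]

theorem norm_sq_complex (z : ℂ) : ‖z‖ ^ 2 = z.re ^ 2 + z.im ^ 2 := by
  rw [Complex.sq_norm, Complex.normSq_apply]; ring

theorem stereo_mem (z : ℂ) : stereo z ∈ S2 := by
  rw [mem_S2, inner_coord]
  have h : (1 : ℝ) + ‖z‖ ^ 2 ≠ 0 := by positivity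
  simp only [stereo, PiLp.smul_apply, smul_eq_mul]
  simp
  field_simp
  rw [norm_sq_complex]
  ring

theorem exists_stereo_eq {u : E3} (hu : u ∈ S2) (h2 : u 2 ≠ 1) : ∃ z, stereo z = u := by
  rw [mem_S2, inner_coord] at hu
  have h2' : 1 - u 2 ≠ 0 := fun h => h2 (by linarith)
  have hn : ‖(⟨u 0 / (1 - u 2), u 1 / (1 - u 2)⟩ : ℂ)‖ ^ 2 = (1 + u 2) / (1 - u 2) := by
    rw [norm_sq_complex]
    field_simp
    linarith
  have h3 : (1 : ℝ) + (1 + u 2) / (1 - u 2) = 2 / (1 - u 2) := by field_simp; ring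
  refine ⟨⟨u 0 / (1 - u 2), u 1 / (1 - u 2)⟩, ?_⟩
  apply E3.ext <;> simp only [stereo, hn, h3, PiLp.smul_apply, smul_eq_mul] <;> simp <;> field_simp
  ring

theorem norm_sub_sq_S2 {u p : E3} (hu : u ∈ S2) (hp : p ∈ S2) :
    ‖u - p‖ ^ 2 = 2 - 2 * inner ℝ u p := by
  rw [← real_inner_self_eq_norm_sq, inner_sub_left, inner_sub_right, inner_sub_right,
    mem_S2.1 hu, mem_S2.1 hp, real_inner_comm]
  ring

/-- In stereographic coordinates the distance to a point of the sphere is the modulus of a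
polynomial, up to the conformal factor. -/
theorem exists_polynomial_norm_sub {p : E3} (hp : p ∈ S2) :
    ∃ (P : ℂ[X]) (c : ℝ), 0 < c ∧ ∀ z, (1 + ‖z‖ ^ 2) * ‖stereo z - p‖ ^ 2 = c * ‖P.eval z‖ ^ 2 := by
  have key : ∀ z, (1 + ‖z‖ ^ 2) * ‖stereo z - p‖ ^ 2 =
      2 * ((1 - p 2) * ‖z‖ ^ 2 - 2 * (z.re * p 0 + z.im * p 1) + (1 + p 2)) := by
    intro z
    rw [norm_sub_sq_S2 (stereo_mem z) hp, inner_coord]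
    have h : (1 : ℝ) + ‖z‖ ^ 2 ≠ 0 := by positivity
    simp only [stereo, PiLp.smul_apply, smul_eq_mul]
    simp
    field_simp
    ring
  have hp' := mem_S2.1 hp
  rw [inner_coord] at hp'
  by_cases h : p 2 = 1
  · have h0 : p 0 = 0 := by rw [h] at hp'; nlinarith [sq_nonneg (p 0), sq_nonneg (p 1)]
    have h1 : p 1 = 0 := by rw [h] at hp'; nlinarith [sq_nonneg (p 0), sq_nonneg (p 1)]
    refine ⟨1, 4, by norm_num, fun z => ?_⟩
    rw [key, h, h0, h1]
    simp
    norm_num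
  · have hlt : 0 < 1 - p 2 := by
      have h1 : p 2 ≤ 1 := by nlinarith [sq_nonneg (p 0), sq_nonneg (p 1)]
      have := lt_of_le_of_ne h1 h
      linarith
    refine ⟨X - C ⟨p 0 / (1 - p 2), p 1 / (1 - p 2)⟩, 2 * (1 - p 2), by linarith, fun z => ?_⟩
    rw [key, norm_sq_complex, norm_sq_complex]
    simp
    field_simp
    linear_combination -hp'

/-- `f` is, on the sphere, a product of squared distances to points of the sphere. -/
def IsPointProduct (f : E3 → ℝ) : Prop :=
  ∃ (s : Multiset E3) (C : ℝ), 0 < C ∧ (∀ p ∈ s, p ∈ S2) ∧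
    ∀ u ∈ S2, f u = C * (s.map fun p => ‖u - p‖ ^ 2).prod

theorem IsPointProduct.const {C : ℝ} (hC : 0 < C) : IsPointProduct fun _ => C :=
  ⟨0, C, hC, by simp, by simp⟩

theorem IsPointProduct.mul {f g : E3 → ℝ} (hf : IsPointProduct f) (hg : IsPointProduct g) :
    IsPointProduct fun u => f u * g u := by
  obtain ⟨s, C, hC, hs, hf⟩ := hf
  obtain ⟨t, D, hD, ht, hg⟩ := hg
  refine ⟨s + t, C * D, mul_pos hC hD, fun p hp => ?_, fun u hu => ?_⟩
  · rcases Multiset.mem_add.1 hp with h | h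
    · exact hs p h
    · exact ht p h
  · change f u * g u = _
    rw [hf u hu, hg u hu, Multiset.map_add, Multiset.prod_add]; ring

theorem IsPointProduct.finset_prod {ι : Type*} {t : Finset ι} {f : ι → E3 → ℝ}
    (hf : ∀ i ∈ t, IsPointProduct (f i)) : IsPointProduct fun u => ∏ i ∈ t, f i u := by
  classical
  induction t using Finset.induction_on with
  | empty => simpa using IsPointProduct.const one_pos
  | insert i t hi ih =>
    simp only [Finset.prod_insert hi]
    exact (hf i (Finset.mem_insert_self i t)).mul
      (ih fun j hj => hf j (Finset.mem_insert_of_mem hj))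

theorem exists_polynomial_prod (s : Multiset E3) (hs : ∀ p ∈ s, p ∈ S2) :
    ∃ (P : ℂ[X]) (c : ℝ), 0 < c ∧ ∀ z, (1 + ‖z‖ ^ 2) ^ (Multiset.card s) *
      (s.map fun p => ‖stereo z - p‖ ^ 2).prod = c * ‖P.eval z‖ ^ 2 := by
  induction s using Multiset.induction_on with
  | empty => exact ⟨1, 1, one_pos, by simp⟩
  | cons p s ih =>
    obtain ⟨P, c, hc, hP⟩ := ih fun p' hp' => hs p' (Multiset.mem_cons_of_mem hp')
    obtain ⟨Q, d, hd, hQ⟩ := exists_polynomial_norm_sub (hs p (Multiset.mem_cons_self p s))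
    refine ⟨Q * P, d * c, mul_pos hd hc, fun z => ?_⟩
    rw [Multiset.card_cons, Multiset.map_cons, Multiset.prod_cons, eval_mul, norm_mul, mul_pow,
      pow_succ]
    linear_combination (d * ‖Q.eval z‖ ^ 2) * hP z +
      (1 + ‖z‖ ^ 2) ^ (Multiset.card s) * (s.map fun p => ‖stereo z - p‖ ^ 2).prod * hQ z

theorem differentiable_stereo : Differentiable ℝ stereo := by
  have h : ∀ z : ℂ, (1 : ℝ) + ‖z‖ ^ 2 ≠ 0 := fun z => by positivity
  have hn : Differentiable ℝ fun z : ℂ => ‖z‖ ^ 2 := differentiable_id.norm_sq ℝ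
  have hre : Differentiable ℝ fun z : ℂ => z.re := Complex.reCLM.differentiable
  have him : Differentiable ℝ fun z : ℂ => z.im := Complex.imCLM.differentiable
  refine Differentiable.smul ((hn.const_add 1).inv h) ?_
  rw [differentiable_euclidean]
  intro i
  fin_cases i
  · simpa using hre.const_mul 2
  · simpa using him.const_mul 2
  · simpa using hn.sub_const 1

/-- The equation of the critical points in stereographic coordinates. -/
theorem derivative_eq_of_isCritical {G : E3 → ℝ} (hG : Differentiable ℝ G) {P : ℂ[X]} {c : ℝ}
    (hc : 0 < c) {W : ℕ} (hGP : ∀ z, (1 + ‖z‖ ^ 2) ^ W * G (stereo z) = c * ‖P.eval z‖ ^ 2) {z : ℂ}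
    (hz : IsCriticalOnSphere G (stereo z)) (hPz : P.eval z ≠ 0) :
    (derivative P).eval z * (1 + z * conj z) = W * P.eval z * conj z := by
  have hre : ∀ v : ℂ, ((W * (‖P.eval z‖ ^ 2 : ℝ) * conj z -
      conj (P.eval z) * (derivative P).eval z * (1 + ‖z‖ ^ 2 : ℝ)) * v).re = 0 := by
    intro v
    have hline : HasDerivAt (fun s : ℝ => z + s * v) v 0 := by
      have := ((Complex.ofRealCLM.hasDerivAt (x := (0 : ℝ))).mul_const v).const_add z
      simpa using this
    have hγ : HasDerivAt (fun s : ℝ => stereo (z + s * v)) (fderiv ℝ stereo z v) 0 := by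
      have h := (differentiable_stereo (z + (0 : ℝ) * v)).hasFDerivAt.comp_hasDerivAt 0 hline
      simpa [Function.comp_def] using h
    have htan : inner ℝ (stereo z) (fderiv ℝ stereo z v) = 0 := by
      have h1 := hγ.inner ℝ hγ
      have h2 : (fun s : ℝ => inner ℝ (stereo (z + s * v)) (stereo (z + s * v))) =
          fun _ => (1 : ℝ) := funext fun s => mem_S2.1 (stereo_mem _)
      rw [h2] at h1
      have h3 := h1.unique (hasDerivAt_const (0 : ℝ) (1 : ℝ))
      simp only [Complex.ofReal_zero, zero_mul, add_zero] at h3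
      rw [real_inner_comm (stereo z) (fderiv ℝ stereo z v)] at h3
      linarith
    have hGd : HasDerivAt (fun s : ℝ => G (stereo (z + s * v))) 0 0 := by
      have h := (hG (stereo (z + (0 : ℝ) * v))).hasFDerivAt.comp_hasDerivAt 0 hγ
      simp only [Complex.ofReal_zero, zero_mul, add_zero] at h
      rwa [hz _ htan] at h
    have hl := (((hline.norm_sq).const_add 1).pow W).mul hGd
    have hPd : HasDerivAt (fun s : ℝ => P.eval (z + s * v)) ((derivative P).eval z * v) 0 := by
      have h := (P.hasDerivAt (z + (0 : ℝ) * v)).comp (0 : ℝ) hline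
      simpa [Function.comp_def] using h
    have hrr := (hPd.norm_sq).const_mul c
    have heq : (fun s : ℝ => c * ‖P.eval (z + s * v)‖ ^ 2) =
        ((fun s : ℝ => 1 + ‖z + s * v‖ ^ 2) ^ W) * fun s : ℝ => G (stereo (z + s * v)) := by
      funext s; exact (hGP _).symm
    rw [heq] at hrr
    have h := hl.unique hrr
    simp only [Complex.ofReal_zero, zero_mul, add_zero, mul_zero, Complex.inner] at h
    rw [mul_comm v, mul_comm ((derivative P).eval z * v)] at h
    have h0 := hGP z
    have hpos : (0 : ℝ) < 1 + ‖z‖ ^ 2 := by positivity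
    rcases Nat.eq_zero_or_pos W with hW | hW
    · subst hW
      simp only [Nat.cast_zero, zero_mul, zero_sub, neg_mul, Complex.neg_re] at h ⊢
      rw [mul_right_comm, Complex.re_mul_ofReal, mul_assoc]
      have h' : (conj (P.eval z) * ((derivative P).eval z * v)).re = 0 := by
        rcases mul_eq_zero.1 (h.symm.trans (by ring)) with h | h
        · exact absurd h hc.ne'
        · linarith
      rw [h']; simp
    · have hpow : (1 + ‖z‖ ^ 2) ^ W = (1 + ‖z‖ ^ 2) ^ (W - 1) * (1 + ‖z‖ ^ 2) := by
        rw [← pow_succ, Nat.sub_add_cancel hW]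
      rw [hpow] at h0
      have h1 : (W : ℝ) * (conj z * v).re * ‖P.eval z‖ ^ 2 =
          (conj (P.eval z) * ((derivative P).eval z * v)).re * (1 + ‖z‖ ^ 2) := by
        refine mul_left_cancel₀ (mul_pos hc two_pos).ne' ?_
        linear_combination (1 + ‖z‖ ^ 2) * h - 2 * (W : ℝ) * (conj z * v).re * h0
      have h2 : (W * (‖P.eval z‖ ^ 2 : ℝ) * conj z -
          conj (P.eval z) * (derivative P).eval z * (1 + ‖z‖ ^ 2 : ℝ)) * v =
          ((W * ‖P.eval z‖ ^ 2 : ℝ) : ℂ) * (conj z * v) -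
          ((1 + ‖z‖ ^ 2 : ℝ) : ℂ) * (conj (P.eval z) * ((derivative P).eval z * v)) := by
        push_cast; ring
      rw [h2, Complex.sub_re, Complex.re_ofReal_mul, Complex.re_ofReal_mul]
      linarith
  have hA : (W * (‖P.eval z‖ ^ 2 : ℝ) * conj z -
      conj (P.eval z) * (derivative P).eval z * (1 + ‖z‖ ^ 2 : ℝ)) = 0 := by
    apply Complex.ext
    · simpa using hre 1
    · have := hre Complex.I
      rw [Complex.mul_I_re, neg_eq_zero] at this
      simpa using this
  have hcz : conj (P.eval z) ≠ 0 := by simpa using hPz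
  have e1 : ((‖P.eval z‖ ^ 2 : ℝ) : ℂ) = P.eval z * conj (P.eval z) := by
    rw [Complex.mul_conj, Complex.normSq_eq_norm_sq]
  have e2 : ((1 + ‖z‖ ^ 2 : ℝ) : ℂ) = 1 + z * conj z := by
    rw [Complex.mul_conj, Complex.normSq_eq_norm_sq]; push_cast; ring
  rw [e1, e2] at hA
  refine mul_left_cancel₀ hcz ?_
  linear_combination -hA

/-- A product of squared distances to at least four points has finitely many critical points on
the sphere. -/
theorem IsPointProduct.finite_critical {G : E3 → ℝ} (hG : Differentiable ℝ G)
    (hprod : IsPointProduct G) {t : Finset E3} (ht : ∀ p ∈ t, p ∈ S2 ∧ G p = 0) (htc : 4 ≤ t.card) :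
    {u | u ∈ S2 ∧ IsCriticalOnSphere G u}.Finite := by
  classical
  obtain ⟨s, C, hC, hs, hGs⟩ := hprod
  obtain ⟨P, c, hc, hP⟩ := exists_polynomial_prod s hs
  have hGP : ∀ z, (1 + ‖z‖ ^ 2) ^ (Multiset.card s) * G (stereo z) = (C * c) * ‖P.eval z‖ ^ 2 := by
    intro z
    rw [hGs _ (stereo_mem z)]
    linear_combination C * hP z
  have hzero : ∀ u ∈ S2, G u = 0 → u ∈ s := by
    intro u hu h
    rw [hGs u hu, mul_eq_zero] at h
    have := h.resolve_left hC.ne'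
    rw [Multiset.prod_eq_zero_iff, Multiset.mem_map] at this
    obtain ⟨p, hp, hpu⟩ := this
    rw [sq_eq_zero_iff, norm_eq_zero, sub_eq_zero] at hpu
    exact hpu ▸ hp
  have hPG : ∀ z, P.eval z = 0 ↔ G (stereo z) = 0 := by
    intro z
    have h := hGP z
    have h1 : (1 + ‖z‖ ^ 2) ^ (Multiset.card s) ≠ 0 := by positivity
    constructor
    · intro h0
      rw [h0] at h
      simpa [h1] using h
    · intro h0
      rw [h0] at h
      have : C * c ≠ 0 := (mul_pos hC hc).ne'
      simpa [hC.ne', hc.ne'] using h.symm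
  -- at most one of the four points is the pole of the projection
  let pole : E3 := !₂[0, 0, 1]
  have hpole : ∀ u ∈ S2, u ≠ pole → ∃ z, stereo z = u := by
    intro u hu hne
    refine exists_stereo_eq hu fun h2 => hne ?_
    rw [mem_S2, inner_coord, h2] at hu
    apply E3.ext
    · simp only [pole]; simp; nlinarith [sq_nonneg (u 0), sq_nonneg (u 1)]
    · simp only [pole]; simp; nlinarith [sq_nonneg (u 0), sq_nonneg (u 1)]
    · simpa [pole] using h2
  have hcard : 2 < (t.erase pole).card := by
    have := Finset.pred_card_le_card_erase (s := t) (a := pole)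
    omega
  obtain ⟨a, ha, b, hb, d, hd, hab, had, hbd⟩ := Finset.two_lt_card.1 hcard
  have hz : ∀ p ∈ t.erase pole, ∃ z, stereo z = p ∧ P.eval z = 0 := by
    intro p hp
    rw [Finset.mem_erase] at hp
    obtain ⟨z, hz⟩ := hpole p (ht p hp.2).1 hp.1
    exact ⟨z, hz, by rw [hPG, hz]; exact (ht p hp.2).2⟩
  obtain ⟨za, hza, hPa⟩ := hz a ha
  obtain ⟨zb, hzb, hPb⟩ := hz b hb
  obtain ⟨zd, hzd, hPd⟩ := hz d hd
  have hW : ((Multiset.card s : ℕ) : ℂ) ≠ 0 := by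
    rw [Nat.cast_ne_zero, Ne, Multiset.card_eq_zero]
    rintro rfl
    rw [Finset.mem_erase] at ha
    exact Multiset.notMem_zero a (hzero a (ht a ha.2).1 (ht a ha.2).2)
  have hfin := finite_setOf_derivative_eq (P := P) hW (a := za) (b := zb) (c := zd)
    (by rintro rfl; exact hab (hza.symm.trans hzb)) (by rintro rfl; exact had (hza.symm.trans hzd))
    (by rintro rfl; exact hbd (hzb.symm.trans hzd)) hPa hPb hPd
  refine (((hfin.image stereo).union (s.toFinset.finite_toSet)).union
    (finite_singleton pole)).subset ?_
  rintro u ⟨hu, hcrit⟩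
  by_cases h1 : u = pole
  · exact Or.inr h1
  by_cases h2 : G u = 0
  · exact Or.inl (Or.inr (by simpa using hzero u hu h2))
  obtain ⟨z, rfl⟩ := hpole u hu h1
  have h3 : P.eval z ≠ 0 := fun h => h2 ((hPG z).1 h)
  exact Or.inl (Or.inl ⟨z, ⟨h3, derivative_eq_of_isCritical hG (mul_pos hC hc) hGP hcrit h3⟩, rfl⟩)

end Stereographic

/-! ### Rotations and their axes -/

theorem rot_mul (g h : SO3) (u : E3) : rot (g * h) u = rot g (rot h u) := by
  simp [rot, Matrix.mulVec_mulVec]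

theorem rot_one (u : E3) : rot 1 u = u := by simp [rot]

theorem rot_inv_rot (g : SO3) (u : E3) : rot g⁻¹ (rot g u) = u := by
  rw [← rot_mul, inv_mul_cancel, rot_one]

theorem rot_rot_inv (g : SO3) (u : E3) : rot g (rot g⁻¹ u) = u := by
  rw [← rot_mul, mul_inv_cancel, rot_one]

theorem rot_add (g : SO3) (u v : E3) : rot g (u + v) = rot g u + rot g v := by
  simp [rot, Matrix.mulVec_add]

theorem rot_sub (g : SO3) (u v : E3) : rot g (u - v) = rot g u - rot g v := by
  simp [rot, Matrix.mulVec_sub]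

theorem rot_smul (g : SO3) (c : ℝ) (u : E3) : rot g (c • u) = c • rot g u := by
  simp [rot, Matrix.mulVec_smul]

theorem rot_neg (g : SO3) (u : E3) : rot g (-u) = -rot g u := by
  simp [rot, Matrix.mulVec_neg]

theorem rot_injective {g h : SO3} (H : ∀ u, rot g u = rot h u) : g = h := by
  apply Subtype.ext
  apply Matrix.mulVec_injective
  funext v
  have := congrArg WithLp.ofLp (H (WithLp.toLp 2 v))
  simpa [rot] using this

theorem SO3.transpose_mul (g : SO3) :
    (g : Matrix (Fin 3) (Fin 3) ℝ).transpose * (g : Matrix (Fin 3) (Fin 3) ℝ) = 1 := by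
  have := (Matrix.mem_specialOrthogonalGroup_iff.1 g.2).1
  have := (Matrix.mem_orthogonalGroup_iff' (Fin 3) ℝ).1 this
  simpa [Matrix.star_eq_conjTranspose] using this

theorem SO3.mul_transpose (g : SO3) :
    (g : Matrix (Fin 3) (Fin 3) ℝ) * (g : Matrix (Fin 3) (Fin 3) ℝ).transpose = 1 := by
  have := (Matrix.mem_specialOrthogonalGroup_iff.1 g.2).1
  have := (Matrix.mem_orthogonalGroup_iff (Fin 3) ℝ).1 this
  simpa [Matrix.star_eq_conjTranspose] using this

theorem SO3.det_eq (g : SO3) : (g : Matrix (Fin 3) (Fin 3) ℝ).det = 1 :=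
  (Matrix.mem_specialOrthogonalGroup_iff.1 g.2).2

theorem inner_rot (g : SO3) (u v : E3) : inner ℝ (rot g u) (rot g v) = inner ℝ u v := by
  rw [EuclideanSpace.inner_eq_star_dotProduct, EuclideanSpace.inner_eq_star_dotProduct]
  simp only [rot, star_trivial]
  rw [Matrix.dotProduct_mulVec, Matrix.vecMul_mulVec, SO3.transpose_mul, Matrix.vecMul_one]

theorem norm_rot (g : SO3) (u : E3) : ‖rot g u‖ = ‖u‖ := by
  rw [norm_eq_sqrt_real_inner, inner_rot, ← norm_eq_sqrt_real_inner]

theorem rot_mem_S2 (g : SO3) {u : E3} (hu : u ∈ S2) : rot g u ∈ S2 := by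
  rw [mem_S2] at *
  rw [inner_rot, hu]

theorem contDiff_rot {n : WithTop ℕ∞} (g : SO3) : ContDiff ℝ n (rot g) := by
  let L : E3 →ₗ[ℝ] E3 := { toFun := rot g, map_add' := rot_add g, map_smul' := rot_smul g }
  exact L.toContinuousLinearMap.contDiff

theorem cross_rot (g : SO3) (u v : E3) : cross (rot g u) (rot g v) = rot g (cross u v) := by
  -- a rotation matrix is its own cofactor matrix
  have hadj : (g : Matrix (Fin 3) (Fin 3) ℝ).adjugate =
      (g : Matrix (Fin 3) (Fin 3) ℝ).transpose := by
    have h := Matrix.mul_adjugate (g : Matrix (Fin 3) (Fin 3) ℝ)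
    rw [SO3.det_eq, one_smul] at h
    have := congrArg (fun M => (g : Matrix (Fin 3) (Fin 3) ℝ).transpose * M) h
    simpa only [← mul_assoc, SO3.transpose_mul, one_mul, mul_one] using this
  rw [Matrix.adjugate_fin_three] at hadj
  have e := fun i j => congrFun (congrFun hadj i) j
  have e00 := e 0 0
  have e01 := e 0 1
  have e02 := e 0 2
  have e10 := e 1 0
  have e11 := e 1 1
  have e12 := e 1 2
  have e20 := e 2 0
  have e21 := e 2 1
  have e22 := e 2 2
  simp [Matrix.transpose_apply] at e00 e01 e02 e10 e11 e12 e20 e21 e22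
  apply E3.ext
  · simp only [rot, cross_zero, cross_one, cross_two, Matrix.mulVec, dotProduct,
      Fin.sum_univ_three]
    rw [← e00, ← e10, ← e20]; ring
  · simp only [rot, cross_zero, cross_one, cross_two, Matrix.mulVec, dotProduct,
      Fin.sum_univ_three]
    rw [← e01, ← e11, ← e21]; ring
  · simp only [rot, cross_zero, cross_one, cross_two, Matrix.mulVec, dotProduct,
      Fin.sum_univ_three]
    rw [← e02, ← e12, ← e22]; ring

theorem exists_unit_orthogonal (a : E3) : ∃ b ∈ S2, inner ℝ a b = 0 := by
  obtain ⟨b, hb0, hab⟩ : ∃ b : E3, b ≠ 0 ∧ inner ℝ a b = 0 := by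
    by_cases h : a 0 = 0 ∧ a 1 = 0
    · refine ⟨!₂[1, 0, 0], fun h0 => ?_, ?_⟩
      · have := congrArg (fun v : E3 => v 0) h0
        simp at this
      · rw [inner_coord]; simp [h.1]
    · refine ⟨!₂[-a 1, a 0, 0], fun h0 => h ⟨?_, ?_⟩, ?_⟩
      · have := congrArg (fun v : E3 => v 1) h0
        simpa using this
      · have := congrArg (fun v : E3 => v 0) h0
        simpa using this
      · rw [inner_coord]; simp; ring
  have hn : ‖b‖ ≠ 0 := norm_ne_zero_iff.2 hb0
  exact ⟨‖b‖⁻¹ • b, by simp [S2, norm_smul, hn], by rw [inner_smul_right, hab, mul_zero]⟩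

theorem orthonormal_frame {a b : E3} (ha : a ∈ S2) (hb : b ∈ S2) (hab : inner ℝ a b = 0) :
    cross a b ∈ S2 ∧ cross a (cross a b) = -b ∧
      ∀ u, u = inner ℝ u a • a + inner ℝ u b • b + inner ℝ u (cross a b) • cross a b := by
  have hd : inner ℝ (cross a b) (cross a b) = 1 := by
    have : inner ℝ (cross a b) (cross a b)
        = inner ℝ a a * inner ℝ b b - inner ℝ a b ^ 2 := by
      simp only [inner_coord, cross_zero, cross_one, cross_two]; ring
    rw [this, mem_S2.1 ha, mem_S2.1 hb, hab]; norm_num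
  have hba : inner ℝ b a = 0 := by rw [real_inner_comm, hab]
  have hda : inner ℝ (cross a b) a = 0 := by rw [real_inner_comm, inner_cross_self_left]
  have hdb : inner ℝ (cross a b) b = 0 := by rw [real_inner_comm, inner_cross_self_right]
  have hne : cross a b ≠ 0 := by
    intro h; rw [h, inner_zero_left] at hd; exact zero_ne_one hd
  refine ⟨mem_S2.2 hd, ?_, fun u => ?_⟩
  · rw [cross_cross_left, hab, mem_S2.1 ha]; simp
  · refine sub_eq_zero.1 (eq_zero_of_orthogonal (y := a) (g := b) hne ?_ ?_ ?_)
    · simp only [inner_sub_right, inner_add_right, inner_smul_right, mem_S2.1 ha, hab,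
        inner_cross_self_left, real_inner_comm a u]
      ring
    · simp only [inner_sub_right, inner_add_right, inner_smul_right, mem_S2.1 hb, hba,
        inner_cross_self_right, real_inner_comm b u]
      ring
    · simp only [inner_sub_right, inner_add_right, inner_smul_right, hd, hda, hdb,
        real_inner_comm (cross a b) u]
      ring

theorem exists_fixed_point (k : SO3) : ∃ a ∈ S2, rot k a = a := by
  set M := (k : Matrix (Fin 3) (Fin 3) ℝ) with hM
  have hdet : (M - 1).det = 0 := by
    have h1 : M - 1 = M * (1 - M.transpose) := by
      rw [mul_sub, mul_one, SO3.mul_transpose]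
    have h2 : (M - 1).det = (1 - M).det := by
      rw [h1, Matrix.det_mul, SO3.det_eq, one_mul, ← Matrix.det_transpose]
      simp
    have h3 : (1 - M).det = -(M - 1).det := by
      rw [← neg_sub, Matrix.det_neg]; simp
      ring
    linarith
  obtain ⟨v, hv0, hv⟩ := Matrix.exists_mulVec_eq_zero_iff.2 hdet
  have hn : ‖WithLp.toLp 2 v‖ ≠ 0 := by simpa using hv0
  refine ⟨‖WithLp.toLp 2 v‖⁻¹ • WithLp.toLp 2 v, by simp [S2, norm_smul, hv0], ?_⟩
  rw [rot_smul]
  congr 1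
  rw [Matrix.sub_mulVec, Matrix.one_mulVec, sub_eq_zero] at hv
  simp only [rot]
  rw [← hM, hv]

/-- A non-trivial rotation has an axis, and it moves each point by a distance proportional to the
distance to the axis. -/
theorem exists_axis {k : SO3} (hk : k ≠ 1) : ∃ a ∈ S2, rot k a = a ∧ ∃ c : ℝ, 0 < c ∧
    ∀ u, ‖u - rot k u‖ ^ 2 = c * (inner ℝ u u - inner ℝ u a ^ 2) := by
  obtain ⟨a, ha, hka⟩ := exists_fixed_point k
  obtain ⟨b, hb, hab⟩ := exists_unit_orthogonal a
  obtain ⟨hd, hdd, hframe⟩ := orthonormal_frame ha hb hab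
  set d := cross a b with hdef
  have hba : inner ℝ b a = 0 := by rw [real_inner_comm, hab]
  have had : inner ℝ a d = 0 := inner_cross_self_left a b
  have hbd : inner ℝ b d = 0 := inner_cross_self_right a b
  have hda : inner ℝ d a = 0 := by rw [real_inner_comm, had]
  have hdb : inner ℝ d b = 0 := by rw [real_inner_comm, hbd]
  have hkba : inner ℝ (rot k b) a = 0 := by
    conv_lhs => rw [← hka]
    rw [inner_rot, hba]
  set β := inner ℝ (rot k b) b
  set δ := inner ℝ (rot k b) d
  have hkb : rot k b = β • b + δ • d := by
    have := hframe (rot k b)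
    rwa [hkba, zero_smul, zero_add] at this
  have hkd : rot k d = β • d - δ • b := by
    rw [hdef, ← cross_rot, hka, hkb]
    have : cross a (β • b + δ • d) = β • cross a b + δ • cross a d := by
      apply E3.ext <;> simp [cross_zero, cross_one, cross_two] <;> ring
    rw [this, hdd, smul_neg, sub_eq_add_neg]
  have hq : ∀ u, ‖u - rot k u‖ ^ 2 = (2 * (1 - β)) * (inner ℝ u u - inner ℝ u a ^ 2) := by
    intro u
    have h1 : ‖u - rot k u‖ ^ 2 = 2 * inner ℝ u u - 2 * inner ℝ u (rot k u) := by
      rw [← real_inner_self_eq_norm_sq, inner_sub_left, inner_sub_right, inner_sub_right, inner_rot,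
        real_inner_comm u (rot k u)]
      ring
    rw [h1]
    generalize hx : inner ℝ u a = x
    have hu := hframe u
    rw [hx] at hu
    generalize inner ℝ u b = y at hu
    generalize inner ℝ u d = z at hu
    subst hu
    simp only [rot_add, rot_smul, hka, hkb, hkd, inner_add_left, inner_add_right, inner_smul_left,
      inner_smul_right, inner_sub_right, mem_S2.1 ha, mem_S2.1 hb, mem_S2.1 hd, hab, hba, had, hda,
      hbd, hdb]
    simp
    ring
  refine ⟨a, ha, hka, 2 * (1 - β), ?_, hq⟩
  have h0 := hq b
  rw [mem_S2.1 hb, hba] at h0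
  have hβ : 0 ≤ 2 * (1 - β) := by
    have : 0 ≤ ‖b - rot k b‖ ^ 2 := by positivity
    linarith
  refine hβ.lt_of_ne fun h => hk (rot_injective fun u => ?_)
  have := hq u
  rw [← h, zero_mul, sq_eq_zero_iff, norm_eq_zero, sub_eq_zero] at this
  rw [rot_one, ← this]

theorem isPointProduct_norm_sub {p : E3} (hp : p ∈ S2) : IsPointProduct fun u => ‖u - p‖ ^ 2 :=
  ⟨{p}, 1, one_pos, by simpa using hp, by simp⟩

theorem isPointProduct_norm_sub_rot {k : SO3} (hk : k ≠ 1) :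
    IsPointProduct fun u => ‖u - rot k u‖ ^ 2 := by
  obtain ⟨a, ha, -, c, hc, hac⟩ := exists_axis hk
  have ha' : -a ∈ S2 := by simpa [S2] using ha
  obtain ⟨s, C, hC, hs, hsC⟩ := (IsPointProduct.const (C := c / 4) (by positivity)).mul
    ((isPointProduct_norm_sub ha).mul (isPointProduct_norm_sub ha'))
  refine ⟨s, C, hC, hs, fun u hu => ?_⟩
  rw [← hsC u hu]
  change ‖u - rot k u‖ ^ 2 = c / 4 * (‖u - a‖ ^ 2 * ‖u - -a‖ ^ 2)
  rw [hac, norm_sub_sq_S2 hu ha, norm_sub_sq_S2 hu ha', mem_S2.1 hu, inner_neg_right]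
  ring

/-- A rotation of order two is determined by its axis. -/
theorem rot_eq_of_involution {g : SO3} (hg : g ≠ 1) (hgg : g * g = 1) :
    ∃ a ∈ S2, rot g a = a ∧ ∀ u, rot g u = (2 * inner ℝ u a) • a - u := by
  obtain ⟨a, ha, hga, c, hc, hac⟩ := exists_axis hg
  refine ⟨a, ha, hga, fun u => ?_⟩
  set w := u + rot g u with hw
  have hgw : rot g w = w := by rw [hw, rot_add, ← rot_mul, hgg, rot_one, add_comm]
  have h1 := hac w
  rw [hgw, sub_self, norm_zero] at h1
  have h2 : inner ℝ w w - inner ℝ w a ^ 2 = 0 := by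
    rcases mul_eq_zero.1 (h1.symm.trans (by norm_num)) with h | h
    · exact absurd h hc.ne'
    · exact h
  have h3 : inner ℝ w a = 2 * inner ℝ u a := by
    have : inner ℝ (rot g u) a = inner ℝ u a := by
      conv_lhs => rw [← hga]
      rw [inner_rot]
    rw [hw, inner_add_left, this]; ring
  have h4 : w - inner ℝ w a • a = 0 := by
    rw [← inner_self_eq_zero (𝕜 := ℝ)]
    simp only [inner_sub_left, inner_sub_right, inner_smul_left, inner_smul_right, mem_S2.1 ha,
      real_inner_comm w a]
    simp only [conj_trivial]
    linarith
  rw [h3, sub_eq_zero] at h4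
  rw [← h4, hw]; abel

/-- Each of the groups in question contains two different rotations of order two. -/
theorem exists_involutions {K : Subgroup SO3} (hK : IsDihedralOrPolyhedral K) :
    ∃ g ∈ K, ∃ h ∈ K, g ≠ h ∧ g ≠ 1 ∧ h ≠ 1 ∧ g * g = 1 ∧ h * h = 1 := by
  have transfer : ∀ {A : Type} [Group A] (e : K ≃* A) (x y : A), x ≠ y → x ≠ 1 → y ≠ 1 →
      x * x = 1 → y * y = 1 →
      ∃ g ∈ K, ∃ h ∈ K, g ≠ h ∧ g ≠ 1 ∧ h ≠ 1 ∧ g * g = 1 ∧ h * h = 1 := by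
    intro A _ e x y hxy hx hy hxx hyy
    refine ⟨e.symm x, (e.symm x).2, e.symm y, (e.symm y).2, ?_, ?_, ?_, ?_, ?_⟩
    · intro h; exact hxy (e.symm.injective (Subtype.ext h))
    · intro h
      have : e.symm x = 1 := Subtype.ext h
      exact hx (by simpa using this)
    · intro h
      have : e.symm y = 1 := Subtype.ext h
      exact hy (by simpa using this)
    · have : e.symm x * e.symm x = 1 := by rw [← map_mul, hxx, map_one]
      exact congrArg Subtype.val this
    · have : e.symm y * e.symm y = 1 := by rw [← map_mul, hyy, map_one]
      exact congrArg Subtype.val this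
  rcases hK with ⟨n, hn, ⟨e⟩⟩ | ⟨⟨e⟩⟩ | ⟨⟨e⟩⟩ | ⟨⟨e⟩⟩
  · refine transfer e (DihedralGroup.sr 0) (DihedralGroup.sr 1) ?_ ?_ ?_ (by simp) (by simp)
    · have : Fact (1 < n) := ⟨hn⟩
      intro h
      exact zero_ne_one (DihedralGroup.sr.inj h)
    · rw [DihedralGroup.one_def]; intro h; cases h
    · rw [DihedralGroup.one_def]; intro h; cases h
  · exact transfer e
      ⟨Equiv.swap 0 1 * Equiv.swap 2 3, by rw [Equiv.Perm.mem_alternatingGroup]; decide⟩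
      ⟨Equiv.swap 0 2 * Equiv.swap 1 3, by rw [Equiv.Perm.mem_alternatingGroup]; decide⟩
      (by decide) (by decide) (by decide) (by decide) (by decide)
  · exact transfer e (Equiv.swap 0 1) (Equiv.swap 0 2)
      (by decide) (by decide) (by decide) (by decide) (by decide)
  · exact transfer e
      ⟨Equiv.swap 0 1 * Equiv.swap 2 3, by rw [Equiv.Perm.mem_alternatingGroup]; decide⟩
      ⟨Equiv.swap 0 2 * Equiv.swap 1 3, by rw [Equiv.Perm.mem_alternatingGroup]; decide⟩
      (by decide) (by decide) (by decide) (by decide) (by decide)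

theorem exists_four_isotropyPoints {K : Subgroup SO3} (hK : IsDihedralOrPolyhedral K) :
    ∃ t : Finset E3, (∀ p ∈ t, p ∈ isotropyPoints K) ∧ 4 ≤ t.card := by
  classical
  obtain ⟨g, hg, h, hh, hgh, hg1, hh1, hgg, hhh⟩ := exists_involutions hK
  obtain ⟨a, ha, hga, hgu⟩ := rot_eq_of_involution hg1 hgg
  obtain ⟨b, hb, hhb, hhu⟩ := rot_eq_of_involution hh1 hhh
  have hab : a ≠ b := by
    rintro rfl
    exact hgh (rot_injective fun u => by rw [hgu, hhu])
  have hab' : a ≠ -b := by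
    rintro rfl
    exact hgh (rot_injective fun u => by rw [hgu, hhu]; simp)
  have hneg : ∀ p ∈ S2, p ≠ -p := by
    intro p hp h
    have h1 : inner ℝ p p = inner ℝ p (-p) := congrArg (inner ℝ p) h
    rw [inner_neg_right, mem_S2.1 hp] at h1
    norm_num at h1
  have hmem : ∀ p ∈ S2, -p ∈ S2 := fun p hp => by simpa [S2] using hp
  refine ⟨{a, -a, b, -b}, fun p hp => ?_, ?_⟩
  · simp only [Finset.mem_insert, Finset.mem_singleton] at hp
    rcases hp with rfl | rfl | rfl | rfl
    · exact ⟨ha, g, hg, hg1, hga⟩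
    · exact ⟨hmem _ ha, g, hg, hg1, by rw [rot_neg, hga]⟩
    · exact ⟨hb, h, hh, hh1, hhb⟩
    · exact ⟨hmem _ hb, h, hh, hh1, by rw [rot_neg, hhb]⟩
  · rw [Finset.card_insert_of_notMem, Finset.card_insert_of_notMem, Finset.card_insert_of_notMem,
      Finset.card_singleton]
    · simpa using hneg b hb
    · simp only [Finset.mem_insert, Finset.mem_singleton, not_or]
      exact ⟨fun h => hab' (by rw [← h, neg_neg]), fun h => hab (neg_injective h)⟩
    · simp only [Finset.mem_insert, Finset.mem_singleton, not_or]
      exact ⟨hneg a ha, hab, hab'⟩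

/-! ### The product of the mutual distances -/

section Vortex

variable {K : Subgroup SO3} {F : Set E3} {m l : ℕ} (gs : Fin m ≃ K) (fs : Fin l ≃ F)

/-- The product `∏_{i<j} |v_j - v_i|²` over the symmetric configuration of `u`. The reduced
Hamiltonian is `-½` times its logarithm. Unlike the Hamiltonian it is smooth on all of `ℝ³`. -/
noncomputable def distanceProduct (u : E3) : ℝ :=
  ∏ i : Fin (m + l), ∏ j ∈ Finset.Ioi i,
    ‖symmetricConfiguration gs fs u j - symmetricConfiguration gs fs u i‖ ^ 2

theorem symmetricConfiguration_castAdd (u : E3) (i : Fin m) :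
    symmetricConfiguration gs fs u (Fin.castAdd l i) = rot (gs i : SO3) u := by
  simp [symmetricConfiguration]

theorem symmetricConfiguration_natAdd (u : E3) (j : Fin l) :
    symmetricConfiguration gs fs u (Fin.natAdd m j) = fs j := by
  simp [symmetricConfiguration]

theorem contDiff_symmetricConfiguration {n : WithTop ℕ∞} (i : Fin (m + l)) :
    ContDiff ℝ n fun u => symmetricConfiguration gs fs u i := by
  induction i using Fin.addCases with
  | left i => simp only [symmetricConfiguration_castAdd]; exact contDiff_rot _
  | right j => simp only [symmetricConfiguration_natAdd]; exact contDiff_const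

theorem contDiff_distanceProduct {n : WithTop ℕ∞} : ContDiff ℝ n (distanceProduct gs fs) :=
  contDiff_prod fun i _ => contDiff_prod fun j _ => ContDiff.norm_sq ℝ
    ((contDiff_symmetricConfiguration gs fs j).sub (contDiff_symmetricConfiguration gs fs i))

theorem distanceProduct_nonneg (u : E3) : 0 ≤ distanceProduct gs fs u :=
  Finset.prod_nonneg fun _ _ => Finset.prod_nonneg fun _ _ => sq_nonneg _

theorem isPointProduct_factor (hF : F ⊆ S2) {i j : Fin (m + l)} (hij : i ≠ j) :
    IsPointProduct fun u =>
      ‖symmetricConfiguration gs fs u j - symmetricConfiguration gs fs u i‖ ^ 2 := by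
  have hmixed : ∀ (g : SO3) (f : F), IsPointProduct fun u => ‖rot g u - f‖ ^ 2 := by
    intro g f
    have : (fun u => ‖rot g u - f‖ ^ 2) = fun u => ‖u - rot g⁻¹ f‖ ^ 2 := by
      funext u
      rw [← norm_rot g (u - _), rot_sub, rot_rot_inv]
    rw [this]
    exact isPointProduct_norm_sub (rot_mem_S2 _ (hF f.2))
  induction i using Fin.addCases with
  | left i =>
    induction j using Fin.addCases with
    | left j =>
      simp only [symmetricConfiguration_castAdd]
      have : (fun u => ‖rot (gs j : SO3) u - rot (gs i : SO3) u‖ ^ 2) =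
          fun u => ‖u - rot ((gs j : SO3)⁻¹ * gs i) u‖ ^ 2 := by
        funext u
        rw [← norm_rot (gs j : SO3) (u - _), rot_sub, rot_mul, rot_rot_inv]
      rw [this]
      refine isPointProduct_norm_sub_rot fun h => hij ?_
      rw [inv_mul_eq_one] at h
      rw [gs.injective (Subtype.ext h)]
    | right j =>
      simp only [symmetricConfiguration_castAdd, symmetricConfiguration_natAdd,
        norm_sub_rev (fs j : E3)]
      exact hmixed _ _
  | right i =>
    induction j using Fin.addCases with
    | left j =>
      simp only [symmetricConfiguration_castAdd, symmetricConfiguration_natAdd]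
      exact hmixed _ _
    | right j =>
      simp only [symmetricConfiguration_natAdd]
      refine IsPointProduct.const ?_
      have : (fs j : E3) - fs i ≠ 0 := by
        rw [sub_ne_zero]
        intro h
        exact hij (by rw [fs.injective (Subtype.ext h)])
      positivity

theorem isPointProduct_distanceProduct (hF : F ⊆ S2) : IsPointProduct (distanceProduct gs fs) :=
  IsPointProduct.finset_prod fun _ _ => IsPointProduct.finset_prod fun _ hj =>
    isPointProduct_factor gs fs hF (Finset.mem_Ioi.1 hj).ne

theorem distanceProduct_ne_zero_iff (u : E3) : distanceProduct gs fs u ≠ 0 ↔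
    Function.Injective (symmetricConfiguration gs fs u) := by
  have : distanceProduct gs fs u ≠ 0 ↔ ∀ i j, i < j →
      symmetricConfiguration gs fs u j ≠ symmetricConfiguration gs fs u i := by
    simp [distanceProduct, Finset.prod_ne_zero_iff, sub_eq_zero]
  rw [this]
  constructor
  · intro h i j hij
    rcases lt_trichotomy i j with hlt | heq | hlt
    · exact absurd hij.symm (h i j hlt)
    · exact heq
    · exact absurd hij (h j i hlt)
  · intro h i j hij heq
    exact hij.ne (h heq).symm

theorem distanceProduct_eq_zero_iff (hF : F ⊆ isotropyPoints K) {u : E3} (hu : u ∈ S2) :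
    distanceProduct gs fs u = 0 ↔ u ∈ isotropyPoints K := by
  have hmixed : ∀ (g : K) (f : F), rot (g : SO3) u = f → u ∈ isotropyPoints K := by
    intro g f h
    obtain ⟨-, k, hk, hk1, hkf⟩ := hF f.2
    refine ⟨hu, (g : SO3)⁻¹ * k * g, K.mul_mem (K.mul_mem (K.inv_mem g.2) hk) g.2, fun h1 => ?_, ?_⟩
    · refine hk1 ?_
      have : k = g * ((g : SO3)⁻¹ * k * g) * (g : SO3)⁻¹ := by group
      rw [this, h1]; group
    · rw [rot_mul, rot_mul, h, hkf, ← h, rot_inv_rot]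
  rw [← not_iff_not, ← Ne, distanceProduct_ne_zero_iff]
  constructor
  · rintro hinj ⟨-, k, hk, hk1, hku⟩
    have h1 : symmetricConfiguration gs fs u (Fin.castAdd l (gs.symm ⟨k, hk⟩)) =
        symmetricConfiguration gs fs u (Fin.castAdd l (gs.symm 1)) := by
      rw [symmetricConfiguration_castAdd, symmetricConfiguration_castAdd]
      simp [hku, rot_one]
    have h2 := gs.symm.injective (Fin.castAdd_injective m l (hinj h1))
    exact hk1 (congrArg Subtype.val h2)
  · intro hnot i j hij
    induction i using Fin.addCases with
    | left i =>
      induction j using Fin.addCases with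
      | left j =>
        rw [symmetricConfiguration_castAdd, symmetricConfiguration_castAdd] at hij
        by_contra hne
        refine hnot ⟨hu, (gs j : SO3)⁻¹ * gs i, K.mul_mem (K.inv_mem (gs j).2) (gs i).2, ?_, ?_⟩
        · intro h
          rw [inv_mul_eq_one] at h
          exact hne (by rw [gs.injective (Subtype.ext h)])
        · rw [rot_mul, hij, rot_inv_rot]
      | right j =>
        rw [symmetricConfiguration_castAdd, symmetricConfiguration_natAdd] at hij
        exact absurd (hmixed _ _ hij) hnot
    | right i =>
      induction j using Fin.addCases with
      | left j =>
        rw [symmetricConfiguration_castAdd, symmetricConfiguration_natAdd] at hij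
        exact absurd (hmixed _ _ hij.symm) hnot
      | right j =>
        rw [symmetricConfiguration_natAdd, symmetricConfiguration_natAdd] at hij
        rw [fs.injective (Subtype.ext hij)]

theorem reducedHamiltonian_eq {u : E3} (h : distanceProduct gs fs u ≠ 0) :
    reducedHamiltonian gs fs u = -(1 / 2) * Real.log (distanceProduct gs fs u) := by
  have hne : ∀ i : Fin (m + l), ∀ j ∈ Finset.Ioi i,
      ‖symmetricConfiguration gs fs u j - symmetricConfiguration gs fs u i‖ ^ 2 ≠ 0 := by
    intro i j hj h0
    exact h (Finset.prod_eq_zero (Finset.mem_univ i) (Finset.prod_eq_zero hj h0))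
  rw [distanceProduct, Real.log_prod fun i _ => Finset.prod_ne_zero_iff.2 (hne i)]
  simp only [reducedHamiltonian, vortexHamiltonian]
  congr 1
  exact Finset.sum_congr rfl fun i _ => (Real.log_prod (hne i)).symm

end Vortex

/-! ### Logarithmic Hamiltonians -/

/-- The system `u' = X u` on `D` with energy `h` is Hamiltonian with `h = -½ log G`, where `G` is a
non-negative analytic function on `ℝ³` and `D` is the part of the sphere where `G ≠ 0`. The field
`X` is `u × ∇G(u)` divided by `k G(u)`, and this factor is constant along orbits. -/
structure IsLogHamiltonian (D : Set E3) (X : E3 → E3) (h G : E3 → ℝ) (k : ℝ) : Prop where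
  contDiff : ContDiff ℝ ω G
  nonneg : ∀ u, 0 ≤ G u
  pos : 0 < k
  mem_iff : ∀ u, u ∈ D ↔ u ∈ S2 ∧ G u ≠ 0
  energy_eq : ∀ u, G u ≠ 0 → h u = -(1 / 2) * Real.log (G u)
  field_eq : ∀ u, G u ≠ 0 → X u = (1 / (k * G u)) • cross u (gradient G u)

section

variable {D : Set E3} {X : E3 → E3} {h : E3 → ℝ} {k : ℝ}

theorem IsLogHamiltonian.contDiff_two (H : IsLogHamiltonian D X h G k) : ContDiff ℝ 2 G :=
  H.contDiff.of_le (by exact_mod_cast le_top)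

theorem IsLogHamiltonian.differentiable (H : IsLogHamiltonian D X h G k) : Differentiable ℝ G :=
  H.contDiff_two.differentiable two_ne_zero

theorem IsLogHamiltonian.continuous (H : IsLogHamiltonian D X h G k) : Continuous G :=
  H.contDiff.continuous

theorem IsLogHamiltonian.G_pos (H : IsLogHamiltonian D X h G k) {u : E3} (hu : G u ≠ 0) :
    0 < G u := (H.nonneg u).lt_of_ne hu.symm

theorem IsLogHamiltonian.G_eq_exp (H : IsLogHamiltonian D X h G k) {u : E3} (hu : G u ≠ 0) :
    G u = Real.exp (-2 * h u) := by
  rw [H.energy_eq u hu, ← Real.exp_log (H.G_pos hu)]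
  congr 1
  rw [Real.exp_log (H.G_pos hu)]
  ring

theorem IsLogHamiltonian.energy_eq_of (H : IsLogHamiltonian D X h G k) {u : E3} {e : ℝ}
    (hu : G u = Real.exp (-2 * e)) : h u = e := by
  rw [H.energy_eq u (by rw [hu]; exact (Real.exp_pos _).ne'), hu, Real.log_exp]
  ring

theorem IsLogHamiltonian.fderiv_eq (H : IsLogHamiltonian D X h G k) {u : E3} (hu : G u ≠ 0) :
    fderiv ℝ h u = (-(1 / 2) * (G u)⁻¹) • fderiv ℝ G u := by
  have hev : h =ᶠ[𝓝 u] fun u => -(1 / 2) * Real.log (G u) := by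
    filter_upwards [(isOpen_ne.preimage H.continuous).mem_nhds (show u ∈ G ⁻¹' {x | x ≠ 0} from hu)]
      with v hv
    exact H.energy_eq v hv
  rw [hev.fderiv_eq]
  have := ((H.differentiable u).hasFDerivAt.log hu).const_mul (-(1 / 2))
  rw [this.fderiv, smul_smul]

theorem IsLogHamiltonian.isCritical_iff (H : IsLogHamiltonian D X h G k) {u : E3} (hu : u ∈ D) :
    IsCriticalOnSphere h u ↔ cross u (gradient G u) = 0 := by
  obtain ⟨hS, hG⟩ := (H.mem_iff u).1 hu
  rw [← isCriticalOnSphere_iff hS]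
  have hc : -(1 / 2) * (G u)⁻¹ ≠ 0 := mul_ne_zero (by norm_num) (inv_ne_zero hG)
  unfold IsCriticalOnSphere
  simp [H.fderiv_eq hG, hG]

theorem IsLogHamiltonian.isEquilibrium_iff (H : IsLogHamiltonian D X h G k) {u : E3} (hu : u ∈ D) :
    IsEquilibrium D X u ↔ IsCriticalOnSphere h u := by
  obtain ⟨hS, hG⟩ := (H.mem_iff u).1 hu
  have hc : 1 / (k * G u) ≠ 0 := one_div_ne_zero (mul_ne_zero H.pos.ne' hG)
  rw [H.isCritical_iff hu, IsEquilibrium, H.field_eq u hG, smul_eq_zero_iff_right hc]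
  exact and_iff_right hu

theorem IsLogHamiltonian.cross_eq_zero (H : IsLogHamiltonian D X h G k) {u : E3} (hu : G u = 0) :
    cross u (gradient G u) = 0 := by
  have hmin : IsLocalMin G u := Eventually.of_forall fun v => by rw [hu]; exact H.nonneg v
  have : gradient G u = 0 := by
    rw [gradient, hmin.fderiv_eq_zero, map_zero]
  rw [this]
  apply E3.ext <;> simp [cross_zero, cross_one, cross_two]

theorem IsLogHamiltonian.nhdsWithin_eq (H : IsLogHamiltonian D X h G k) {u : E3} (hu : u ∈ D) :
    𝓝[D] u = 𝓝[S2] u := by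
  have hD : D = S2 ∩ G ⁻¹' {x | x ≠ 0} := by
    ext v; rw [H.mem_iff]; rfl
  rw [hD]
  exact nhdsWithin_inter_of_mem' (mem_nhdsWithin_of_mem_nhds
    ((isOpen_ne.preimage H.continuous).mem_nhds ((H.mem_iff u).1 hu).2))

theorem IsLogHamiltonian.le_iff (H : IsLogHamiltonian D X h G k) {u v : E3} (hu : u ∈ D)
    (hv : v ∈ D) : h u ≤ h v ↔ G v ≤ G u := by
  rw [H.G_eq_exp ((H.mem_iff u).1 hu).2, H.G_eq_exp ((H.mem_iff v).1 hv).2, Real.exp_le_exp]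
  constructor <;> intro <;> linarith

theorem IsLogHamiltonian.isLocalMinOn_iff (H : IsLogHamiltonian D X h G k) {u : E3} (hu : u ∈ D) :
    IsLocalMinOn h D u ↔ IsLocalMaxOn G S2 u := by
  unfold IsLocalMinOn IsLocalMaxOn IsMinFilter IsMaxFilter
  rw [← H.nhdsWithin_eq hu]
  exact eventually_congr (eventually_mem_nhdsWithin.mono fun v hv => H.le_iff hu hv)

theorem IsLogHamiltonian.isLocalMaxOn_iff (H : IsLogHamiltonian D X h G k) {u : E3} (hu : u ∈ D) :
    IsLocalMaxOn h D u ↔ IsLocalMinOn G S2 u := by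
  unfold IsLocalMinOn IsLocalMaxOn IsMinFilter IsMaxFilter
  rw [← H.nhdsWithin_eq hu]
  exact eventually_congr (eventually_mem_nhdsWithin.mono fun v hv => H.le_iff hv hu)

/-! ### Solutions -/

/-- The orbits of the flow of `G`, run with the right constant speed, are solutions. -/
theorem IsLogHamiltonian.isSolutionOn (H : IsLogHamiltonian D X h G k) (hΦ : IsSphereFlow G Φ)
    {x : E3} (hx : x ∈ D) {g : ℝ} (hg : G x = g) :
    IsSolutionOn D X (fun t => Φ (t / (k * g)) x) univ := by
  obtain ⟨hS, hG⟩ := (H.mem_iff x).1 hx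
  intro t _
  have hGt : G (Φ (t / (k * g)) x) = G x := hΦ.energy _ x hS
  refine ⟨(H.mem_iff _).2 ⟨hΦ.mem _ x hS, by rw [hGt]; exact hG⟩, ?_⟩
  rw [H.field_eq _ (by rw [hGt]; exact hG), hGt, hg, hasDerivWithinAt_univ]
  have h1 : HasDerivAt (fun t : ℝ => t / (k * g)) (1 / (k * g)) t :=
    (hasDerivAt_id t).div_const _
  exact (hΦ.hasDerivAt x hS (t / (k * g))).scomp t h1

theorem IsSphereFlow.exists_ne (hΦ : IsSphereFlow G Φ) {x : E3} (hx : x ∈ S2)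
    (hreg : cross x (gradient G x) ≠ 0) : ∃ t, Φ t x ≠ Φ 0 x := by
  by_contra! hcon
  have h1 := hΦ.hasDerivAt x hx 0
  have h2 : (fun s => Φ s x) = fun _ => Φ 0 x := funext hcon
  rw [h2] at h1
  have h3 := h1.unique (hasDerivAt_const 0 (Φ 0 x))
  rw [hΦ.zero] at h3
  exact hreg h3

theorem IsLogHamiltonian.isPeriodicSolution (H : IsLogHamiltonian D X h G k)
    (hΦ : IsSphereFlow G Φ) {x : E3} (hx : x ∈ D) (hreg : cross x (gradient G x) ≠ 0) {g : ℝ}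
    (hg : G x = g) {T : ℝ} (hT : 0 < T) (hTx : Φ T x = x) :
    ∃ T₀, IsPeriodicSolution D X (fun t => Φ (t / (k * g)) x) T₀ := by
  obtain ⟨hS, hG⟩ := (H.mem_iff x).1 hx
  have hkg : 0 < k * g := mul_pos H.pos (hg ▸ H.G_pos hG)
  obtain ⟨t, ht⟩ := hΦ.exists_ne hS hreg
  obtain ⟨T₀, h1, h2, h3⟩ := exists_minimal_period (γ := fun t => Φ (t / (k * g)) x)
    ((hΦ.continuous_orbit x).comp (continuous_id.div_const _)) (s := k * g * t) (t := 0)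
    (by simpa [mul_div_cancel_left₀ t hkg.ne'] using ht) (mul_pos hkg hT) (fun s => by
      simp only [add_div, mul_div_cancel_left₀ T hkg.ne']
      exact hΦ.periodic hTx _)
  exact ⟨T₀, H.isSolutionOn hΦ hx hg, h1, h2, h3⟩

theorem range_reparam {E : Type*} (γ : ℝ → E) {c : ℝ} (hc : c ≠ 0) :
    range (fun t => γ (t / c)) = range γ := by
  apply Subset.antisymm
  · rintro _ ⟨t, rfl⟩; exact ⟨t / c, rfl⟩
  · rintro _ ⟨t, rfl⟩; exact ⟨c * t, by simp only [mul_div_cancel_left₀ t hc]⟩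

/-- The components of regular level sets are periodic orbits: orbits are open and closed there. -/
theorem IsLogHamiltonian.isPeriodicOrbit_component (H : IsLogHamiltonian D X h G k)
    (hΦ : IsSphereFlow G Φ) {c : ℝ} (hc : ∀ u ∈ levelSet D h c, ¬ IsCriticalOnSphere h u) {u : E3}
    (hu : u ∈ levelSet D h c) :
    IsPeriodicOrbit D X (connectedComponentIn (levelSet D h c) u) := by
  have hlevel : ∀ v, v ∈ levelSet D h c ↔ v ∈ S2 ∧ G v = Real.exp (-2 * c) := by
    intro v
    constructor
    · rintro ⟨hv, hvc⟩
      obtain ⟨hS, hG⟩ := (H.mem_iff v).1 hv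
      exact ⟨hS, by rw [H.G_eq_exp hG, hvc]⟩
    · rintro ⟨hS, hG⟩
      exact ⟨(H.mem_iff v).2 ⟨hS, by rw [hG]; exact (Real.exp_pos _).ne'⟩, H.energy_eq_of hG⟩
  have hreg : ∀ v, v ∈ levelSet D h c → cross v (gradient G v) ≠ 0 := fun v hv h0 =>
    hc v hv ((H.isCritical_iff hv.1).2 h0)
  obtain ⟨huS, huG⟩ := (hlevel u).1 hu
  obtain ⟨T, hT, hTu⟩ := hΦ.exists_period_of_isCompact H.contDiff_two huS isCompact_S2
    (fun t _ => hΦ.mem t u huS) fun y _ hy hGy => hreg y ((hlevel y).2 ⟨hy, hGy.trans huG⟩)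
  obtain ⟨T₀, hT₀⟩ := H.isPeriodicSolution hΦ hu.1 (hreg u hu) rfl hT hTu
  refine ⟨_, T₀, hT₀, ?_⟩
  rw [range_reparam (fun t => Φ t u) (mul_pos H.pos (H.G_pos ((H.mem_iff u).1 hu.1).2)).ne']
  have hu0 : u ∈ range fun t => Φ t u := ⟨0, hΦ.zero u⟩
  have hsub : (range fun t => Φ t u) ⊆ levelSet D h c := by
    rintro _ ⟨t, rfl⟩
    exact (hlevel _).2 ⟨hΦ.mem t u huS, by rw [hΦ.energy t u huS, huG]⟩
  apply Subset.antisymm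
  · obtain ⟨N, hN, huN, hNu⟩ := hΦ.exists_isOpen_orbit H.contDiff_two huS (hreg u hu)
    have hcl : IsClosed (range fun t => Φ t u) :=
      ((hΦ.periodic hTu).compact_of_continuous hT.ne' (hΦ.continuous_orbit u)).isClosed
    have hC : ∀ v ∈ connectedComponentIn (levelSet D h c) u, v ∈ N → v ∈ range fun t => Φ t u := by
      intro v hv hvN
      obtain ⟨hS, hG⟩ := (hlevel v).1 (connectedComponentIn_subset _ _ hv)
      exact hNu v hvN hS (hG.trans huG.symm)
    have hcov : connectedComponentIn (levelSet D h c) u ⊆ N ∪ (range fun t => Φ t u)ᶜ := by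
      intro v _
      by_cases hv : v ∈ range fun t => Φ t u
      · exact Or.inl (huN hv)
      · exact Or.inr hv
    have hdisj : connectedComponentIn (levelSet D h c) u ∩ (N ∩ (range fun t => Φ t u)ᶜ) = ∅ := by
      rw [eq_empty_iff_forall_notMem]
      exact fun v hv => hv.2.2 (hC v hv.1 hv.2.1)
    rcases isPreconnected_iff_subset_of_disjoint.1
        (isPreconnected_connectedComponentIn (x := u) (F := levelSet D h c))
        N (range fun t => Φ t u)ᶜ hN hcl.isOpen_compl hcov hdisj with h1 | h1
    · exact fun v hv => hC v hv (h1 hv)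
    · exact absurd hu0 (h1 (mem_connectedComponentIn hu))
  · exact (isPreconnected_range (hΦ.continuous_orbit u)).subset_connectedComponentIn hu0 hsub

/-! ### Stability -/

/-- The energy is constant along solutions. -/
theorem IsLogHamiltonian.energy_const (H : IsLogHamiltonian D X h G k) {b : ℝ} {γ : ℝ → E3}
    (hγ : IsSolutionOn D X γ (Ico 0 b)) {t : ℝ} (ht : t ∈ Ico 0 b) : G (γ t) = G (γ 0) := by
  rcases ht.1.eq_or_lt with h0 | h0
  · rw [← h0]
  have hsub : Icc 0 t ⊆ Ico 0 b := fun s hs => ⟨hs.1, hs.2.trans_lt ht.2⟩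
  have hd : ∀ s ∈ Icc 0 t, HasDerivWithinAt (fun s => G (γ s)) 0 (Icc 0 t) s := by
    intro s hs
    obtain ⟨hD, hder⟩ := hγ s (hsub hs)
    have h1 := (H.differentiable (γ s)).hasFDerivAt.comp_hasDerivWithinAt s (hder.mono hsub)
    rwa [← inner_gradient, H.field_eq _ ((H.mem_iff _).1 hD).2, inner_smul_right,
      inner_cross_self_right, mul_zero] at h1
  exact constant_of_derivWithin_zero (fun s hs => (hd s hs).differentiableWithinAt)
    (fun s hs => (hd s (Ico_subset_Icc_self hs)).derivWithin
      (uniqueDiffOn_Icc h0 s (Ico_subset_Icc_self hs))) t ⟨ht.1, le_rfl⟩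

theorem IsLogHamiltonian.isLyapunovStable (H : IsLogHamiltonian D X h G k)
    (hΦ : IsSphereFlow G Φ) {u₀ : E3} (hu₀ : u₀ ∈ S2)
    (hiso : ∀ᶠ u in 𝓝 u₀, u ∈ S2 → cross u (gradient G u) = 0 → u = u₀)
    {κ : ℝ} (hκ : κ ≠ 0) (hext : IsLocalMinOn (fun u => κ * G u) S2 u₀) :
    IsLyapunovStable D X u₀ := by
  intro U hU
  obtain ⟨B, hBU, hB, hBS, hBn, -, η, hη, -, hopen⟩ :=
    hΦ.exists_disc H.contDiff_two hu₀ hiso hκ hext hU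
  obtain ⟨O, hO, hBO⟩ := hopen η le_rfl
  have hmemO : ∀ u, u ∈ S2 → (u ∈ O ↔ u ∈ B ∧ κ * (G u - G u₀) < η) := by
    intro u hu
    have : u ∈ {u | u ∈ B ∧ κ * (G u - G u₀) < η} ↔ u ∈ S2 ∩ O := by rw [hBO]
    exact ⟨fun h => this.2 ⟨hu, h⟩, fun h => (this.1 h).2⟩
  have hu₀O : u₀ ∈ O := (hmemO u₀ hu₀).2 ⟨mem_of_mem_nhdsWithin hu₀ hBn, by simpa using hη⟩
  refine ⟨O, hO.mem_nhds hu₀O, fun b hb γ hγ hγ0 t ht => hBU ?_⟩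
  have hS : ∀ s ∈ Icc 0 t, γ s ∈ S2 := fun s hs =>
    ((H.mem_iff _).1 (hγ s ⟨hs.1, hs.2.trans_lt ht.2⟩).1).1
  have h00 : (0 : ℝ) ∈ Icc 0 t := ⟨le_rfl, ht.1⟩
  have hlt : κ * (G (γ 0) - G u₀) < η := ((hmemO _ (hS 0 h00)).1 hγ0).2
  have hiff : ∀ s ∈ Icc 0 t, (γ s ∈ O ↔ γ s ∈ B) := by
    intro s hs
    rw [hmemO _ (hS s hs), H.energy_const hγ ⟨hs.1, hs.2.trans_lt ht.2⟩]
    exact and_iff_left hlt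
  have hpre : IsPreconnected (γ '' Icc 0 t) := isPreconnected_Icc.image _ fun s hs =>
    (hγ s ⟨hs.1, hs.2.trans_lt ht.2⟩).2.continuousWithinAt.mono
      fun r hr => ⟨hr.1, hr.2.trans_lt ht.2⟩
  have hcov : γ '' Icc 0 t ⊆ O ∪ Bᶜ := by
    rintro _ ⟨s, hs, rfl⟩
    by_cases hsB : γ s ∈ B
    · exact Or.inl ((hiff s hs).2 hsB)
    · exact Or.inr hsB
  have hdisj : γ '' Icc 0 t ∩ (O ∩ Bᶜ) = ∅ := by
    rw [eq_empty_iff_forall_notMem]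
    rintro _ ⟨⟨s, hs, rfl⟩, h2, h3⟩
    exact h3 ((hiff s hs).1 h2)
  rcases isPreconnected_iff_subset_of_disjoint.1 hpre O Bᶜ hO hB.isClosed.isOpen_compl hcov hdisj
    with h1 | h1
  · exact (hiff t ⟨ht.1, le_rfl⟩).1 (h1 (mem_image_of_mem _ ⟨ht.1, le_rfl⟩))
  · exact absurd ((hiff 0 h00).1 hγ0) (h1 (mem_image_of_mem _ h00))

theorem IsLogHamiltonian.not_isLyapunovStable (H : IsLogHamiltonian D X h G k)
    (hΦ : IsSphereFlow G Φ) {u₀ : E3} (hu₀ : u₀ ∈ D)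
    (hiso : ∀ᶠ u in 𝓝 u₀, u ∈ S2 → cross u (gradient G u) = 0 → u = u₀)
    (hext : ¬ IsLocalExtrOn h D u₀) : ¬ IsLyapunovStable D X u₀ := by
  intro hst
  obtain ⟨hS₀, hG₀⟩ := (H.mem_iff u₀).1 hu₀
  have hext' : ¬ IsLocalExtrOn G S2 u₀ := by
    rintro (h1 | h1)
    · exact hext (Or.inr ((H.isLocalMaxOn_iff hu₀).2 h1))
    · exact hext (Or.inl ((H.isLocalMinOn_iff hu₀).2 h1))
  obtain ⟨U, hU, hleave⟩ := hΦ.exists_leaving H.contDiff_two hS₀ hiso hext'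
  obtain ⟨V, hV, hVU⟩ := hst U hU
  obtain ⟨x, ⟨hxV, hxG⟩, hxS, t, ht, htU⟩ := hleave (V ∩ G ⁻¹' {y | y ≠ 0})
    (inter_mem hV ((isOpen_ne.preimage H.continuous).mem_nhds hG₀))
  have hkg : 0 < k * G x := mul_pos H.pos (H.G_pos hxG)
  have hsol := H.isSolutionOn hΦ ((H.mem_iff x).2 ⟨hxS, hxG⟩) rfl
  refine htU ?_
  have := hVU (k * G x * t + 1) (by positivity) (fun t => Φ (t / (k * G x)) x)
    (fun s _ => ⟨(hsol s trivial).1, (hsol s trivial).2.mono (subset_univ _)⟩)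
    (by simpa [hΦ.zero] using hxV) (k * G x * t) ⟨by positivity, by linarith⟩
  simpa only [mul_div_cancel_left₀ t hkg.ne'] using this

end

/-! ### One-parameter families of periodic orbits -/

/-- An analytic function of one variable that lies above its value at `0` on the right of `0` is
strictly increasing there, because the zeros of its derivative do not accumulate. -/
theorem exists_strictMonoOn_of_contDiff_omega {q : ℝ → ℝ} (hq : ContDiff ℝ ω q)
    (hpos : ∀ᶠ s in 𝓝[>] 0, q 0 < q s) : ∃ δ > 0, StrictMonoOn q (Icc 0 δ) := by
  have hdq : Differentiable ℝ q := hq.differentiable (by simp)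
  have hd : AnalyticAt ℝ (deriv q) 0 := (hq.contDiffAt.analyticAt).deriv
  have hne : ∀ᶠ s in 𝓝[>] 0, deriv q s ≠ 0 := by
    rcases hd.eventually_eq_zero_or_eventually_ne_zero with h0 | h0
    · obtain ⟨ε, hε, hball⟩ := mem_nhdsGT_iff_exists_Ioo_subset.1
        ((h0.filter_mono nhdsWithin_le_nhds).and hpos)
      have hε' : (0 : ℝ) < ε := hε
      obtain ⟨c, hc, hcs⟩ := exists_deriv_eq_slope q (half_pos hε') hdq.continuous.continuousOn
        hdq.differentiableOn
      have h1 := (hball ⟨hc.1, by linarith [hc.2]⟩).1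
      have h2 := (hball (show ε / 2 ∈ Ioo 0 ε from ⟨by linarith, by linarith⟩)).2
      rw [h1, eq_div_iff (by linarith)] at hcs
      linarith
    · exact h0.filter_mono (nhdsWithin_mono _ fun s (hs : 0 < s) => hs.ne')
  obtain ⟨ε, hε, hball⟩ := mem_nhdsGT_iff_exists_Ioo_subset.1 (hne.and hpos)
  have hε' : (0 : ℝ) < ε := hε
  refine ⟨ε / 2, half_pos hε', ?_⟩
  refine ContinuousOn.strictMonoOn_of_injOn_Icc (half_pos hε').le
    (hball (show ε / 2 ∈ Ioo 0 ε from ⟨by linarith, by linarith⟩)).2.le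
    hdq.continuous.continuousOn ?_
  have key : ∀ s t, 0 ≤ s → s < t → t ≤ ε / 2 → q s ≠ q t := by
    intro s t hs hst ht heq
    obtain ⟨c, hc, hc0⟩ := exists_deriv_eq_zero hst hdq.continuous.continuousOn heq
    exact (hball ⟨by linarith [hc.1], by linarith [hc.2]⟩).1 hc0
  intro s hs t ht heq
  rcases lt_trichotomy s t with h | h | h
  · exact absurd heq (key s t hs.1 h ht.2)
  · exact h
  · exact absurd heq.symm (key t s ht.1 h hs.2)

/-- The inverse of a strictly increasing continuous function on an interval is continuous. -/
theorem exists_inverse_of_strictMonoOn {q : ℝ → ℝ} {δ : ℝ} (hδ : 0 < δ)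
    (hc : ContinuousOn q (Icc 0 δ)) (hm : StrictMonoOn q (Icc 0 δ)) :
    ∃ σ : ℝ → ℝ, (∀ ρ ∈ Ioo (q 0) (q δ), σ ρ ∈ Ioo 0 δ ∧ q (σ ρ) = ρ) ∧
      ContinuousOn σ (Ioo (q 0) (q δ)) := by
  have h1 : ∀ ρ, ∃ s, ρ ∈ Ioo (q 0) (q δ) → s ∈ Ioo 0 δ ∧ q s = ρ := by
    intro ρ
    by_cases hρ : ρ ∈ Ioo (q 0) (q δ)
    · obtain ⟨s, hs, hqs⟩ := intermediate_value_Ioo hδ.le hc hρ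
      exact ⟨s, fun _ => ⟨hs, hqs⟩⟩
    · exact ⟨0, fun h => absurd h hρ⟩
  choose σ hσ using h1
  refine ⟨σ, hσ, fun ρ hρ => ContinuousAt.continuousWithinAt ?_⟩
  refine continuousAt_of_monotoneOn_of_image_mem_nhds (s := Ioo (q 0) (q δ)) ?_
    (isOpen_Ioo.mem_nhds hρ) ?_
  · intro a ha b hb hab
    rw [← hm.le_iff_le (Ioo_subset_Icc_self (hσ a ha).1) (Ioo_subset_Icc_self (hσ b hb).1),
      (hσ a ha).2, (hσ b hb).2]
    exact hab
  · refine mem_of_superset (isOpen_Ioo.mem_nhds (hσ ρ hρ).1) fun s hs => ?_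
    have hqs : q s ∈ Ioo (q 0) (q δ) :=
      ⟨hm ⟨le_rfl, hδ.le⟩ (Ioo_subset_Icc_self hs) hs.1,
        hm (Ioo_subset_Icc_self hs) ⟨hδ.le, le_rfl⟩ hs.2⟩
    exact ⟨q s, hqs, hm.injOn (Ioo_subset_Icc_self (hσ _ hqs).1) (Ioo_subset_Icc_self hs)
      (hσ _ hqs).2⟩

/-- Around an isolated critical point which is a minimum of `κ • G`, the closed level curves cross
every short great circle arc from `u₀` exactly once. Started on the arc at the point of value
`ρ = κ (exp(-2e) - G u₀)`, they form a family of periodic orbits parametrised by the energy `e`. -/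
theorem IsLogHamiltonian.exists_family {D : Set E3} {X : E3 → E3} {h G : E3 → ℝ} {k : ℝ}
    {Φ : ℝ → E3 → E3} (H : IsLogHamiltonian D X h G k) (hΦ : IsSphereFlow G Φ) {u₀ w : E3}
    (hu₀ : u₀ ∈ S2) (hw : w ∈ S2) (huw : inner ℝ u₀ w = 0)
    (hiso : ∀ᶠ u in 𝓝 u₀, u ∈ S2 → cross u (gradient G u) = 0 → u = u₀)
    {κ : ℝ} (hκ : κ ≠ 0) (hext : IsLocalMinOn (fun u => κ * G u) S2 u₀) :
    ∃ δ ∈ Ioc (0 : ℝ) 1, StrictMonoOn (fun s => κ * (G (greatCircle u₀ w s) - G u₀)) (Icc 0 δ) ∧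
    ∃ η > 0, ∃ σ : ℝ → ℝ,
    (∀ ρ ∈ Ioo 0 η, σ ρ ∈ Ioo 0 δ ∧ κ * (G (greatCircle u₀ w (σ ρ)) - G u₀) = ρ) ∧
    ∀ (I : Set ℝ) (J : ℝ → Set ℝ) (l : Filter ℝ) (ρ : ℝ → ℝ),
      (∀ e, ρ e = κ * (Real.exp (-2 * e) - G u₀)) → (∀ e ∈ I, ρ e ∈ Ioo 0 η) →
      (∀ e ∈ I, ∀ e', e' ∈ J e ↔ 0 < ρ e' ∧ ρ e' < ρ e) → (∀ᶠ e in l, e ∈ I) →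
      Tendsto ρ l (𝓝 0) → ∃ T, IsPeriodicFamilyAround D X h u₀ I J l
        (fun e t => Φ (t / (k * Real.exp (-2 * e))) (greatCircle u₀ w (σ (ρ e)))) T := by
  obtain ⟨B, -, hB, hBS, hBn, hreg, η₀, hη₀, horb, hopen⟩ :=
    hΦ.exists_disc H.contDiff_two hu₀ hiso hκ hext univ_mem
  have hu₀B : u₀ ∈ B := mem_of_mem_nhdsWithin hu₀ hBn
  have hgc : ContDiff ℝ ω (greatCircle u₀ w) := contDiff_greatCircle u₀ w
  set q : ℝ → ℝ := fun s => κ * (G (greatCircle u₀ w s) - G u₀) with hq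
  have hqω : ContDiff ℝ ω q := contDiff_const.mul ((H.contDiff.comp hgc).sub contDiff_const)
  have hq0 : q 0 = 0 := by simp [hq, greatCircle_zero]
  have hgB : ∀ᶠ s in 𝓝 (0 : ℝ), greatCircle u₀ w s ∈ B := by
    have h1 : Tendsto (greatCircle u₀ w) (𝓝 0) (𝓝[S2] u₀) := by
      refine tendsto_nhdsWithin_iff.2 ⟨?_, Eventually.of_forall fun s =>
        greatCircle_mem hu₀ hw huw s⟩
      have := hgc.continuous.tendsto 0
      rwa [greatCircle_zero] at this
    exact h1 hBn
  have hinner : ∀ s, inner ℝ (greatCircle u₀ w s) w = Real.sin s := by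
    intro s
    rw [greatCircle, inner_add_left, real_inner_smul_left, real_inner_smul_left, huw, mem_S2.1 hw,
      mul_zero, zero_add, mul_one]
  have hpos : ∀ᶠ s in 𝓝[>] 0, q 0 < q s := by
    have h1 : ∀ᶠ s in 𝓝[>] (0 : ℝ), s < Real.pi :=
      nhdsWithin_le_nhds (Iio_mem_nhds Real.pi_pos)
    filter_upwards [nhdsWithin_le_nhds hgB, h1, self_mem_nhdsWithin] with s hs hs1 hs0
    rw [hq0]
    refine (hreg _ hs fun h0 => ?_).2
    have h2 := hinner s
    rw [h0, huw] at h2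
    exact (Real.sin_pos_of_pos_of_lt_pi hs0 hs1).ne h2
  obtain ⟨δ₁, hδ₁, hmono₁⟩ := exists_strictMonoOn_of_contDiff_omega hqω hpos
  obtain ⟨δ₂, hδ₂, hball⟩ := Metric.eventually_nhds_iff.1 hgB
  set δ := min (min δ₁ (δ₂ / 2)) 1 with hδdef
  have hδ : 0 < δ := lt_min (lt_min hδ₁ (half_pos hδ₂)) one_pos
  have hmono : StrictMonoOn q (Icc 0 δ) := hmono₁.mono
    (Icc_subset_Icc_right ((min_le_left _ _).trans (min_le_left _ _)))
  have hδB : ∀ s ∈ Ioo 0 δ, greatCircle u₀ w s ∈ B := by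
    intro s hs
    refine hball ?_
    have : δ ≤ δ₂ / 2 := (min_le_left _ _).trans (min_le_right _ _)
    rw [Real.dist_eq, sub_zero, abs_of_pos hs.1]
    linarith [hs.2]
  obtain ⟨σ, hσ, hσc⟩ := exists_inverse_of_strictMonoOn hδ hqω.continuous.continuousOn hmono
  have hqδ : 0 < q δ := hq0 ▸ hmono ⟨le_rfl, hδ.le⟩ ⟨hδ.le, le_rfl⟩ hδ
  set η := min η₀ (q δ) with hηdef
  have hsub : Ioo 0 η ⊆ Ioo (q 0) (q δ) := by
    rw [hq0]; exact Ioo_subset_Ioo_right (min_le_right _ _)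
  refine ⟨δ, ⟨hδ, min_le_right _ _⟩, hmono, η, lt_min hη₀ hqδ, σ, fun ρ hρ => hσ ρ (hsub hρ), ?_⟩
  intro I J l ρ hρdef hρI hJ hl hlim
  set x : ℝ → E3 := fun e => greatCircle u₀ w (σ (ρ e)) with hx
  have hxS : ∀ e, x e ∈ S2 := fun e => greatCircle_mem hu₀ hw huw _
  have hxB : ∀ e, ρ e ∈ Ioo 0 η → x e ∈ B := fun e he => hδB _ (hσ _ (hsub he)).1
  have hxρ : ∀ e, ρ e ∈ Ioo 0 η → κ * (G (x e) - G u₀) = ρ e := fun e he => (hσ _ (hsub he)).2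
  have hxG : ∀ e, ρ e ∈ Ioo 0 η → G (x e) = Real.exp (-2 * e) := by
    intro e he
    have h1 := hxρ e he
    rw [hρdef] at h1
    linarith [mul_left_cancel₀ hκ h1]
  have hxD : ∀ e, ρ e ∈ Ioo 0 η → x e ∈ D := fun e he =>
    (H.mem_iff _).2 ⟨hxS e, by rw [hxG e he]; exact (Real.exp_pos _).ne'⟩
  have hxη : ∀ e, ρ e ∈ Ioo 0 η → 0 < κ * (G (x e) - G u₀) ∧ κ * (G (x e) - G u₀) < η₀ := by
    intro e he
    rw [hxρ e he]
    exact ⟨he.1, he.2.trans_le (min_le_left _ _)⟩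
  have hrange : ∀ e, ρ e ∈ Ioo 0 η →
      range (fun t => Φ (t / (k * Real.exp (-2 * e))) (x e)) =
        {u | u ∈ B ∧ κ * (G u - G u₀) = ρ e} := by
    intro e he
    rw [range_reparam (fun t => Φ t (x e)) (mul_pos H.pos (Real.exp_pos _)).ne',
      (horb (x e) (hxB e he) (hxη e he).1 (hxη e he).2).2]
    ext u
    simp only [mem_ofPred_eq, hxG e he, hρdef]
    refine and_congr_right fun _ => ⟨fun hu => by rw [hu], fun hu => ?_⟩
    linarith [mul_left_cancel₀ hκ hu]
  have hfill : ∀ e ∈ I, filledBy (fun e t => Φ (t / (k * Real.exp (-2 * e))) (x e)) u₀ (J e) =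
      {u | u ∈ B ∧ κ * (G u - G u₀) < ρ e} := by
    intro e he
    ext u
    simp only [filledBy, mem_insert_iff, mem_iUnion, exists_prop, mem_ofPred_eq]
    constructor
    · rintro (rfl | ⟨e', he', hu⟩)
      · exact ⟨hu₀B, by simpa using (hρI e he).1⟩
      · obtain ⟨h1, h2⟩ := (hJ e he e').1 he'
        rw [hrange e' ⟨h1, h2.trans (hρI e he).2⟩] at hu
        exact ⟨hu.1, hu.2.trans_lt h2⟩
    · rintro ⟨huB, hu⟩
      refine or_iff_not_imp_left.2 fun hne => ⟨h u, ?_⟩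
      obtain ⟨hc, hpos⟩ := hreg u huB hne
      have hGu : G u ≠ 0 := fun h0 => hc (H.cross_eq_zero h0)
      have hρu : ρ (h u) = κ * (G u - G u₀) := by rw [hρdef, ← H.G_eq_exp hGu]
      have h1 : 0 < ρ (h u) ∧ ρ (h u) < ρ e := by rw [hρu]; exact ⟨hpos, hu⟩
      refine ⟨(hJ e he _).2 h1, ?_⟩
      rw [hrange _ ⟨h1.1, h1.2.trans (hρI e he).2⟩]
      exact ⟨huB, hρu.symm⟩
  have hper : ∀ e, ∃ T, e ∈ I →
      IsPeriodicSolution D X (fun t => Φ (t / (k * Real.exp (-2 * e))) (x e)) T := by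
    intro e
    by_cases he : e ∈ I
    · have he' := hρI e he
      obtain ⟨T, hT, hTx⟩ := (horb (x e) (hxB e he') (hxη e he').1 (hxη e he').2).1
      have hne : x e ≠ u₀ := by
        intro h0
        have := (hxη e he').1
        rw [h0, sub_self, mul_zero] at this
        exact this.false
      obtain ⟨T₀, hT₀⟩ := H.isPeriodicSolution hΦ (hxD e he') (hreg _ (hxB e he') hne).1
        (hxG e he') hT hTx
      exact ⟨T₀, fun _ => hT₀⟩
    · exact ⟨0, fun h => absurd h he⟩
  choose T hT using hper
  have hcont : Continuous fun u => κ * (G u - G u₀) :=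
    continuous_const.mul (H.continuous.sub continuous_const)
  refine ⟨T, ?_, hT, ?_, ?_, ?_, ?_⟩
  · have hρc : Continuous ρ := by
      rw [show ρ = fun e => κ * (Real.exp (-2 * e) - G u₀) from funext hρdef]
      fun_prop
    have hxc : ContinuousOn x I := hgc.continuous.comp_continuousOn
      ((hσc.mono hsub).comp hρc.continuousOn hρI)
    refine hΦ.continuous.comp_continuousOn (ContinuousOn.prodMk ?_ ?_)
    · refine Continuous.continuousOn (Continuous.div continuous_snd (by fun_prop) fun p => ?_)
      exact (mul_pos H.pos (Real.exp_pos _)).ne'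
    · exact hxc.comp continuousOn_fst fun p hp => hp.1
  · intro e he t
    refine H.energy_eq_of ?_
    rw [hΦ.energy _ _ (hxS e), hxG e (hρI e he)]
  · intro e he
    obtain ⟨O, hO, h1⟩ := hopen (ρ e) ((hρI e he).2.le.trans (min_le_left _ _))
    exact ⟨O, hO, (hfill e he).trans h1⟩
  · intro e he
    rw [hfill e he, hrange e (hρI e he)]
    have hρ0 := hρI e he
    apply Subset.antisymm
    · rintro u ⟨hu1, hu2⟩
      have hcl : IsClosed {u | u ∈ B ∧ κ * (G u - G u₀) ≤ ρ e} :=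
        hB.isClosed.inter (isClosed_le hcont continuous_const)
      have h1 := closure_minimal (fun v (hv : v ∈ {u | u ∈ B ∧ κ * (G u - G u₀) < ρ e}) =>
        (⟨hv.1, hv.2.le⟩ : v ∈ {u | u ∈ B ∧ κ * (G u - G u₀) ≤ ρ e})) hcl hu1
      exact ⟨h1.1, le_antisymm h1.2 (not_lt.1 fun h2 => hu2 ⟨h1.1, h2⟩)⟩
    · rintro u ⟨huB, hu⟩
      refine ⟨?_, fun h1 => h1.2.ne hu⟩
      by_contra hcl
      have hne : u ≠ u₀ := by
        rintro rfl
        rw [sub_self, mul_zero] at hu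
        exact hρ0.1.ne hu
      refine (hreg u huB hne).1 ((isCriticalOnSphere_iff (hBS huB)).1 ?_)
      -- a point outside the closure is a local minimum of `κ • G`, hence critical
      obtain ⟨O, hO, h1⟩ := hopen η₀ le_rfl
      have huO : u ∈ O := by
        have : u ∈ {u | u ∈ B ∧ κ * (G u - G u₀) < η₀} :=
          ⟨huB, hu.trans_lt (hρ0.2.trans_le (min_le_left _ _))⟩
        rw [h1] at this
        exact this.2
      have hmin : IsLocalMinOn (fun v => κ * G v) S2 u := by
        have h2 : ∀ᶠ v in 𝓝[S2] u, v ∈ O ∧ v ∈ (closure {u | u ∈ B ∧ κ * (G u - G u₀) < ρ e})ᶜ :=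
          nhdsWithin_le_nhds
            (inter_mem (hO.mem_nhds huO) (isClosed_closure.isOpen_compl.mem_nhds hcl))
        filter_upwards [h2, self_mem_nhdsWithin] with v hv hvS
        have hvB : v ∈ {u | u ∈ B ∧ κ * (G u - G u₀) < η₀} := by rw [h1]; exact ⟨hvS, hv.1⟩
        have h3 : ρ e ≤ κ * (G v - G u₀) := not_lt.1 fun h4 =>
          hv.2 (subset_closure ⟨hvB.1, h4⟩)
        linarith
      have hcrit := isCriticalOnSphere_of_isLocalExtrOn
        ((H.differentiable u).const_mul κ) (hBS huB) (Or.inl hmin)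
      intro v hv
      have h2 := hcrit v hv
      rw [((H.differentiable u).hasFDerivAt.const_mul κ).fderiv] at h2
      exact (mul_eq_zero.1 h2).resolve_left hκ
  · intro U hU
    have hK : IsCompact (B \ interior U) := hB.diff isOpen_interior
    have hev : ∃ ρ₁ > 0, ∀ u ∈ B \ interior U, ρ₁ ≤ κ * (G u - G u₀) := by
      rcases (B \ interior U).eq_empty_or_nonempty with h0 | h0
      · exact ⟨1, one_pos, fun u hu => by rw [h0] at hu; exact hu.elim⟩
      · obtain ⟨v, hv, hvmin⟩ := hK.exists_isMinOn h0 hcont.continuousOn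
        refine ⟨_, (hreg v hv.1 ?_).2, fun u hu => hvmin hu⟩
        rintro rfl
        exact hv.2 (mem_interior_iff_mem_nhds.2 hU)
    obtain ⟨ρ₁, hρ₁, hle⟩ := hev
    filter_upwards [hl, hlim (Iio_mem_nhds hρ₁)] with e he hlt
    have hlt' : ρ e < ρ₁ := hlt
    rw [hrange e (hρI e he)]
    rintro u ⟨huB, hu⟩
    by_contra huU
    have := hle u ⟨huB, fun h1 => huU (interior_subset h1)⟩
    linarith

/-! ### Short periods near collisions -/

theorem inner_cross_cross (a b c d : E3) : inner ℝ (cross a b) (cross c d) =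
    inner ℝ a c * inner ℝ b d - inner ℝ a d * inner ℝ b c := by
  simp only [inner_coord, cross_zero, cross_one, cross_two]
  ring

theorem cross_cross_self (u v : E3) :
    cross v (cross u v) = (inner ℝ v v) • u - (inner ℝ u v) • v := by
  apply E3.ext <;>
    simp [inner_coord, cross_zero, cross_one, cross_two, -inner_self_eq_norm_sq_to_K] <;> ring

/-- A curve in `ℂ ∖ {0}` that turns around `0` with angular velocity at least `ν` returns to the ray
of its starting point within the time `2π / ν`. -/
theorem exists_return_to_ray {z z' : ℝ → ℂ} (hz : ∀ t, HasDerivAt z (z' t) t)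
    (hz'c : Continuous z') (hz0 : ∀ t, z t ≠ 0) {ν : ℝ} (hν : 0 < ν)
    (hturn : ∀ t, ν * Complex.normSq (z t) ≤ (starRingEnd ℂ (z t) * z' t).im) :
    ∃ t ∈ Ioc 0 (2 * Real.pi / ν), ∃ c : ℝ, 0 < c ∧ z t = c * z 0 := by
  have hzc : Continuous z := continuous_iff_continuousAt.2 fun t => (hz t).continuousAt
  have hfc : Continuous fun t => z' t / z t := hz'c.div hzc hz0
  set L : ℝ → ℂ := fun t => ∫ s in (0 : ℝ)..t, z' s / z s with hL
  have hLd : ∀ t, HasDerivAt L (z' t / z t) t := fun t => hfc.integral_hasStrictDerivAt 0 t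
    |>.hasDerivAt
  have hL0 : L 0 = 0 := intervalIntegral.integral_same
  have hzL : ∀ t, z t = Complex.exp (L t) * z 0 := by
    have h1 : ∀ t, HasDerivAt (fun t => Complex.exp (-L t) * z t) 0 t := by
      intro t
      have h2 := ((hLd t).neg.cexp).mul (hz t)
      refine h2.congr_deriv ?_
      have h3 : z' t / z t * z t = z' t := div_mul_cancel₀ _ (hz0 t)
      linear_combination -Complex.exp ((-L) t) * h3
    intro t
    have h3 := is_const_of_deriv_eq_zero (fun t => (h1 t).differentiableAt)
      (fun t => (h1 t).deriv) t 0
    simp only [hL0, neg_zero, Complex.exp_zero, one_mul] at h3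
    rw [← h3, ← mul_assoc, ← Complex.exp_add, add_neg_cancel, Complex.exp_zero, one_mul]
  have himd : ∀ t, HasDerivAt (fun t => (L t).im) (z' t / z t).im t := fun t =>
    Complex.imCLM.hasFDerivAt.comp_hasDerivAt t (hLd t)
  have him : ∀ t, ν ≤ (z' t / z t).im := by
    intro t
    have hn : 0 < Complex.normSq (z t) := Complex.normSq_pos.2 (hz0 t)
    have h1 : (z' t / z t).im = (starRingEnd ℂ (z t) * z' t).im / Complex.normSq (z t) := by
      rw [Complex.div_im, Complex.mul_im, Complex.conj_re, Complex.conj_im]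
      ring
    rw [h1, le_div_iff₀ hn]
    exact hturn t
  have himc : Continuous fun t => (L t).im :=
    continuous_iff_continuousAt.2 fun t => (himd t).continuousAt
  have hpos : 0 < 2 * Real.pi / ν := div_pos Real.two_pi_pos hν
  have hend : 2 * Real.pi ≤ (L (2 * Real.pi / ν)).im := by
    obtain ⟨c, -, hc⟩ := exists_hasDerivAt_eq_slope (fun t => (L t).im) (fun t => (z' t / z t).im)
      hpos himc.continuousOn fun t _ => himd t
    rw [hL0, Complex.zero_im, sub_zero, sub_zero] at hc
    have h1 := him c
    rw [hc, le_div_iff₀ hpos, mul_div_cancel₀ _ hν.ne'] at h1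
    exact h1
  obtain ⟨t, ht, htL⟩ := intermediate_value_Icc hpos.le himc.continuousOn
    (show 2 * Real.pi ∈ Icc (L 0).im (L (2 * Real.pi / ν)).im from
      ⟨by rw [hL0]; exact Real.two_pi_pos.le, hend⟩)
  refine ⟨t, ⟨ht.1.lt_of_ne ?_, ht.2⟩, Real.exp (L t).re, Real.exp_pos _, ?_⟩
  · rintro rfl
    simp only [hL0, Complex.zero_im] at htL
    exact Real.two_pi_pos.ne htL
  · rw [hzL t]
    have h1 : L t = ((L t).re : ℂ) + 2 * Real.pi * Complex.I := by
      apply Complex.ext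
      · simp
      · have htL' : (L t).im = 2 * Real.pi := htL
        simp [htL']
    conv_lhs => rw [h1]
    rw [Complex.exp_add, Complex.exp_two_pi_mul_I, mul_one, Complex.ofReal_exp]

/-- Let the function `G ≥ 0` vanish at `p` and decrease in the direction of `p` at a rate comparable
to `G`. Then orbits close to `p` turn around `p` with a large angular velocity, and so they return
to their starting point on an arc `greatCircle p w`, along which `G` is strictly monotone, after a
short time. -/
theorem IsSphereFlow.exists_short_return {G : E3 → ℝ} {Φ : ℝ → E3 → E3} (hΦ : IsSphereFlow G Φ)
    (hG : ContDiff ℝ 2 G) {p w : E3} (hp : p ∈ S2) (hw : w ∈ S2) (hpw : inner ℝ p w = 0)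
    (hGp : G p = 0)
    (hrad : ∀ᶠ u in 𝓝 p, u ∈ S2 → fderiv ℝ G u (p - (inner ℝ p u) • u) ≤ -(1 / 2) * G u)
    {δ : ℝ} (hδ : δ ∈ Ioc (0 : ℝ) 1)
    (hinj : InjOn (fun s => G (greatCircle p w s)) (Icc 0 δ)) :
    ∃ r₀ > 0, ∀ r ∈ Ioc 0 r₀, ∀ s ∈ Ioo 0 δ, 0 < G (greatCircle p w s) →
      (∀ t, ‖Φ t (greatCircle p w s) - p‖ ≤ r) →
      ∃ t > 0, t ≤ 4 * Real.pi * r ^ 2 / G (greatCircle p w s) ∧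
        Φ t (greatCircle p w s) = greatCircle p w s := by
  have hδπ : δ < Real.pi / 2 := hδ.2.trans_lt (by linarith [Real.pi_gt_three])
  have hsinδ : 0 < Real.sin δ := Real.sin_pos_of_pos_of_lt_pi hδ.1 (by linarith [Real.pi_pos])
  obtain ⟨ε, hε, hball⟩ := Metric.eventually_nhds_iff.1 hrad
  refine ⟨min (min (ε / 2) (Real.sin δ / 2)) 1, by positivity, ?_⟩
  intro r hr s hs hGx hclose
  have hrε : r < ε := by
    have := hr.2.trans ((min_le_left _ _).trans (min_le_left _ _)); linarith
  have hrδ : r < Real.sin δ := by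
    have := hr.2.trans ((min_le_left _ _).trans (min_le_right _ _)); linarith
  have hr1 : r ≤ 1 := hr.2.trans (min_le_right _ _)
  have hr0 : 0 < r := hr.1
  obtain ⟨hw'S, hw'c, hframe⟩ := orthonormal_frame hp hw hpw
  set w' := cross p w with hw'
  set x := greatCircle p w s with hx
  have hxS : x ∈ S2 := greatCircle_mem hp hw hpw s
  have hpp := mem_S2.1 hp
  have hww := mem_S2.1 hw
  have hpw' : inner ℝ p w' = 0 := inner_cross_self_left p w
  have hww' : inner ℝ w w' = 0 := inner_cross_self_right p w
  have hxw : inner ℝ x w = Real.sin s := by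
    rw [hx, greatCircle, inner_add_left, real_inner_smul_left, real_inner_smul_left, hpw, hww,
      mul_zero, zero_add, mul_one]
  have hxw' : inner ℝ x w' = 0 := by
    rw [hx, greatCircle, inner_add_left, real_inner_smul_left, real_inner_smul_left, hpw', hww',
      mul_zero, mul_zero, add_zero]
  set γ : ℝ → E3 := fun t => Φ t x with hγ
  set γ' : ℝ → E3 := fun t => cross (γ t) (gradient G (γ t)) with hγ'
  have hγS : ∀ t, γ t ∈ S2 := fun t => hΦ.mem t x hxS
  have hγG : ∀ t, G (γ t) = G x := fun t => hΦ.energy t x hxS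
  have hγd : ∀ t, HasDerivAt γ (γ' t) t := fun t => hΦ.hasDerivAt x hxS t
  have hγc : Continuous γ := hΦ.continuous_orbit x
  have hgrad : ContDiff ℝ 1 (gradient G) :=
    (LinearIsometryEquiv.contDiff (InnerProductSpace.toDual ℝ E3).symm).comp
      (hG.fderiv_right (m := 1) (by norm_num))
  have hγ'c : Continuous γ' := (contDiff_cross contDiff_id hgrad).continuous.comp hγc
  have hpyth : ∀ t, inner ℝ (γ t) p ^ 2 + inner ℝ (γ t) w ^ 2 + inner ℝ (γ t) w' ^ 2 = 1 := by
    intro t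
    have h1 := mem_S2.1 (hγS t)
    conv_lhs at h1 => rw [hframe (γ t)]
    have hwp : inner ℝ w p = 0 := by rw [real_inner_comm, hpw]
    have hw'p : inner ℝ w' p = 0 := by rw [real_inner_comm, hpw']
    have hw'w : inner ℝ w' w = 0 := by rw [real_inner_comm, hww']
    simp only [inner_add_left, inner_add_right, real_inner_smul_left, real_inner_smul_right, hpp,
      hww, mem_S2.1 hw'S, hpw, hpw', hww', hwp, hw'p, hw'w] at h1
    linarith
  have hdist : ∀ t, ‖γ t - p‖ ^ 2 = 2 - 2 * inner ℝ (γ t) p := by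
    intro t
    rw [norm_sub_sq_real, ← real_inner_self_eq_norm_sq, ← real_inner_self_eq_norm_sq, hpp,
      mem_S2.1 (hγS t)]
    ring
  have hdist_le : ∀ t, 2 - 2 * inner ℝ (γ t) p ≤ r ^ 2 := by
    intro t
    rw [← hdist]
    exact pow_le_pow_left₀ (norm_nonneg _) (hclose t) 2
  have hcos : ∀ t, 0 < inner ℝ (γ t) p := by
    intro t
    have h1 := hdist_le t
    have h2 : r ^ 2 ≤ 1 := pow_le_one₀ hr0.le hr1
    linarith
  have hcos1 : ∀ t, inner ℝ (γ t) p ≤ 1 := by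
    intro t
    have h1 := hdist t
    have h2 := sq_nonneg ‖γ t - p‖
    linarith
  -- the projection to the plane orthogonal to `p`, in complex notation
  set z : ℝ → ℂ := fun t => (inner ℝ (γ t) w : ℝ) + (inner ℝ (γ t) w' : ℝ) * Complex.I with hz
  set z' : ℝ → ℂ := fun t => (inner ℝ (γ' t) w : ℝ) + (inner ℝ (γ' t) w' : ℝ) * Complex.I with hz'
  have hzre : ∀ t, (z t).re = inner ℝ (γ t) w := fun t => by simp [hz]
  have hzim : ∀ t, (z t).im = inner ℝ (γ t) w' := fun t => by simp [hz]
  have hz're : ∀ t, (z' t).re = inner ℝ (γ' t) w := fun t => by simp [hz']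
  have hz'im : ∀ t, (z' t).im = inner ℝ (γ' t) w' := fun t => by simp [hz']
  have hnorm : ∀ t, Complex.normSq (z t) = 1 - inner ℝ (γ t) p ^ 2 := by
    intro t
    rw [Complex.normSq_apply, hzre, hzim]
    linarith [hpyth t]
  have hnorm_le : ∀ t, Complex.normSq (z t) ≤ r ^ 2 := by
    intro t
    rw [hnorm]
    nlinarith [hdist_le t, hcos t, hcos1 t]
  have hzd : ∀ t, HasDerivAt z (z' t) t := by
    intro t
    have h1 : ∀ v : E3, HasDerivAt (fun t => ((inner ℝ (γ t) v : ℝ) : ℂ))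
        ((inner ℝ (γ' t) v : ℝ) : ℂ) t := fun v => by
      have := (hγd t).inner ℝ (hasDerivAt_const t v)
      rw [inner_zero_right, zero_add] at this
      exact this.ofReal_comp
    exact (h1 w).add ((h1 w').mul_const _)
  have hz'c : Continuous z' := by
    refine Continuous.add ?_ (Continuous.mul ?_ continuous_const) <;>
      exact Complex.continuous_ofReal.comp (hγ'c.inner continuous_const)
  have hz0 : ∀ t, z t ≠ 0 := by
    intro t h0
    have h1 := hnorm t
    rw [h0, map_zero] at h1
    have h2 : inner ℝ (γ t) p = 1 := by nlinarith [hcos t]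
    have h3 := hdist t
    rw [h2, mul_one, sub_self, sq_eq_zero_iff, norm_eq_zero, sub_eq_zero] at h3
    have h4 := hγG t
    rw [h3, hGp] at h4
    exact hGx.ne h4
  have hturn : ∀ t, G x / (2 * r ^ 2) * Complex.normSq (z t) ≤
      (starRingEnd ℂ (z t) * z' t).im := by
    intro t
    have h1 := hball (show dist (γ t) p < ε by
      rw [dist_eq_norm]; exact (hclose t).trans_lt hrε) (hγS t)
    rw [hγG t] at h1
    have h2 : (starRingEnd ℂ (z t) * z' t).im =
        -fderiv ℝ G (γ t) (p - inner ℝ p (γ t) • γ t) := by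
      have hp' : cross w w' = p := by
        rw [hw', cross_cross_self, hww, hpw, one_smul, zero_smul, sub_zero]
      have h3 : (starRingEnd ℂ (z t) * z' t).im =
          inner ℝ (cross (γ t) (γ' t)) (cross w w') := by
        rw [inner_cross_cross, Complex.mul_im, Complex.conj_re, Complex.conj_im, hzre, hzim, hz're,
          hz'im]
        ring
      rw [h3, hp', hγ', cross_cross_left, mem_S2.1 (hγS t), one_smul, ← inner_gradient,
        inner_sub_left, inner_sub_right, real_inner_smul_left, real_inner_smul_right,
        real_inner_comm (γ t) p, real_inner_comm (γ t) (gradient G (γ t))]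
      ring
    rw [h2]
    have h3 : G x / (2 * r ^ 2) * Complex.normSq (z t) ≤ G x / (2 * r ^ 2) * r ^ 2 :=
      mul_le_mul_of_nonneg_left (hnorm_le t) (by positivity)
    have h4 : G x / (2 * r ^ 2) * r ^ 2 = 1 / 2 * G x := by field_simp
    linarith
  obtain ⟨t, ht, c, hc, htc⟩ := exists_return_to_ray hzd hz'c hz0
    (show 0 < G x / (2 * r ^ 2) by positivity) hturn
  refine ⟨t, ht.1, ht.2.trans (le_of_eq ?_), ?_⟩
  · field_simp
    ring
  have hγ0 : γ 0 = x := hΦ.zero x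
  have hre : inner ℝ (γ t) w = c * Real.sin s := by
    have := congrArg Complex.re htc
    rwa [Complex.re_ofReal_mul, hzre, hzre, hγ0, hxw] at this
  have him : inner ℝ (γ t) w' = 0 := by
    have := congrArg Complex.im htc
    rwa [Complex.im_ofReal_mul, hzim, hzim, hγ0, hxw', mul_zero] at this
  have hsins : 0 < Real.sin s := Real.sin_pos_of_pos_of_lt_pi hs.1 (by linarith [hs.2, Real.pi_pos])
  have hwpos : 0 < inner ℝ (γ t) w := by rw [hre]; positivity
  have hwlt : inner ℝ (γ t) w < Real.sin δ := by
    refine lt_of_le_of_lt (abs_le_of_sq_le_sq' ?_ hr0.le).2 hrδ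
    have h1 := hnorm_le t
    have h2 := hpyth t
    rw [hnorm] at h1
    rw [him] at h2
    linarith
  have hs1 : Real.arcsin (inner ℝ (γ t) w) ∈ Icc 0 δ := by
    refine ⟨Real.arcsin_nonneg.2 hwpos.le, ?_⟩
    rw [← Real.arcsin_sin (x := δ) (by linarith [hδ.1, Real.pi_pos]) hδπ.le]
    exact Real.monotone_arcsin hwlt.le
  have hgc : γ t = greatCircle p w (Real.arcsin (inner ℝ (γ t) w)) := by
    have h1 := hpyth t
    rw [him] at h1
    have h2 : Real.cos (Real.arcsin (inner ℝ (γ t) w)) = inner ℝ (γ t) p := by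
      rw [Real.cos_arcsin, Real.sqrt_eq_iff_mul_self_eq_of_pos (hcos t)]
      linarith
    rw [greatCircle, h2, Real.sin_arcsin (by linarith) (hwlt.le.trans (Real.sin_le_one _))]
    conv_lhs => rw [hframe (γ t)]
    rw [him, zero_smul, add_zero]
  have heq : Real.arcsin (inner ℝ (γ t) w) = s := by
    refine hinj hs1 (Ioo_subset_Icc_self hs) ?_
    change G _ = G _
    rw [← hgc]
    exact hγG t
  change γ t = x
  rw [hgc, heq]

/-! ### Radial derivative of the product of distances at a collision -/

/-- On the sphere near `p`, the derivative of `f ≥ 0` at `u` in the direction `p - ⟪p, u⟫ u`, which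
is tangent to the sphere and points to `p`, is at most `α f(u)`. -/
structure RadialBound (p : E3) (α : ℝ) (f : E3 → ℝ) : Prop where
  nonneg : ∀ u, 0 ≤ f u
  differentiable : Differentiable ℝ f
  bound : ∀ᶠ u in 𝓝 p, u ∈ S2 → fderiv ℝ f u (p - (inner ℝ p u) • u) ≤ α * f u

theorem RadialBound.mono {p : E3} {α β : ℝ} {f : E3 → ℝ} (hf : RadialBound p α f) (h : α ≤ β) :
    RadialBound p β f :=
  ⟨hf.nonneg, hf.differentiable, hf.bound.mono fun u hu huS =>
    (hu huS).trans (mul_le_mul_of_nonneg_right h (hf.nonneg u))⟩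

theorem RadialBound.mul {p : E3} {α β : ℝ} {f g : E3 → ℝ} (hf : RadialBound p α f)
    (hg : RadialBound p β g) : RadialBound p (α + β) (fun u => f u * g u) := by
  refine ⟨fun u => mul_nonneg (hf.nonneg u) (hg.nonneg u), hf.differentiable.mul hg.differentiable,
    ?_⟩
  filter_upwards [hf.bound, hg.bound] with u h1 h2 huS
  rw [fderiv_fun_mul (hf.differentiable u) (hg.differentiable u)]
  simp only [_root_.add_apply, _root_.smul_apply, smul_eq_mul]
  have h3 := mul_le_mul_of_nonneg_left (h1 huS) (hg.nonneg u)
  have h4 := mul_le_mul_of_nonneg_left (h2 huS) (hf.nonneg u)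
  linarith

theorem RadialBound.finset_prod {ι : Type*} {p : E3} {α : ℝ} {f : ι → E3 → ℝ} (s : Finset ι)
    (h : ∀ i ∈ s, RadialBound p α (f i)) : RadialBound p (s.card * α) (fun u => ∏ i ∈ s, f i u) := by
  classical
  induction s using Finset.induction_on with
  | empty =>
    simp only [Finset.prod_empty, Finset.card_empty, Nat.cast_zero, zero_mul]
    exact ⟨fun _ => zero_le_one, differentiable_const _, Eventually.of_forall fun u _ => by simp⟩
  | insert a s ha ih =>
    have h1 := (h a (Finset.mem_insert_self a s)).mul
      (ih fun i hi => h i (Finset.mem_insert_of_mem hi))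
    simp only [Finset.prod_insert ha, Finset.card_insert_of_notMem ha]
    refine h1.mono (le_of_eq ?_)
    push_cast
    ring

theorem radialBound_of_ne_zero {p : E3} {f : E3 → ℝ} (hp : p ∈ S2) (hf : ContDiff ℝ 1 f)
    (h0 : ∀ u, 0 ≤ f u) (hfp : f p ≠ 0) {ε : ℝ} (hε : 0 < ε) : RadialBound p ε f := by
  refine ⟨h0, hf.differentiable one_ne_zero, ?_⟩
  have hc : Continuous fun u => ε * f u - fderiv ℝ f u (p - (inner ℝ p u) • u) :=
    (continuous_const.mul hf.continuous).sub
      ((hf.continuous_fderiv one_ne_zero).clm_apply (by fun_prop))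
  have hpos : 0 < ε * f p - fderiv ℝ f p (p - (inner ℝ p p) • p) := by
    rw [mem_S2.1 hp, one_smul, sub_self, map_zero, sub_zero]
    exact mul_pos hε ((h0 p).lt_of_ne hfp.symm)
  filter_upwards [hc.continuousAt.eventually (lt_mem_nhds hpos)] with u hu _
  linarith

/-- A squared distance of two points of the configuration that collide at `p`. Either both points
are rotated copies of `u`, and `b = 0`, or one of them is fixed, and `A` is an isometry, or both are
fixed, and `A = 0`. -/
theorem radialBound_of_eq_zero {p : E3} (hp : p ∈ S2) (A : E3 →L[ℝ] E3) (b : E3)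
    (hA : b = 0 ∨ (∀ u v, inner ℝ (A u) (A v) = inner ℝ u v) ∨ A = 0) (hpb : A p = b) :
    RadialBound p (-1) (fun u => ‖A u - b‖ ^ 2) := by
  have hd : ∀ u, HasFDerivAt (fun u => ‖A u - b‖ ^ 2) (2 • (innerSL ℝ (A u - b)).comp A) u :=
    fun u => (A.hasFDerivAt.sub_const b).norm_sq
  have hev : ∀ᶠ u in 𝓝 p, 1 / 2 ≤ inner ℝ p u := by
    have hc : Continuous fun u : E3 => inner ℝ p u := by fun_prop
    have h1 : 1 / 2 < inner ℝ p p := by rw [mem_S2.1 hp]; norm_num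
    exact (hc.continuousAt.eventually (lt_mem_nhds h1)).mono fun u hu => le_of_lt hu
  refine ⟨fun u => sq_nonneg _, fun u => (hd u).differentiableAt, ?_⟩
  filter_upwards [hev] with u hu huS
  set c : ℝ := inner ℝ p u with hc
  have hval : fderiv ℝ (fun u => ‖A u - b‖ ^ 2) u (p - c • u) =
      2 * inner ℝ (A u - b) (A (p - c • u)) := by
    rw [(hd u).fderiv]
    simp [inner_sub_left]
  rw [hval]
  rcases hA with rfl | hA | rfl
  · rw [map_sub, map_smul, hpb, zero_sub, sub_zero, inner_neg_right, real_inner_smul_right,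
      real_inner_self_eq_norm_sq]
    nlinarith [sq_nonneg ‖A u‖]
  · have huu := mem_S2.1 huS
    have hpp := mem_S2.1 hp
    have hup : inner ℝ u p = c := real_inner_comm p u
    rw [← hpb, ← map_sub, hA, ← real_inner_self_eq_norm_sq, hA]
    simp only [inner_sub_left, inner_sub_right, real_inner_smul_right, huu, hpp, hup, ← hc]
    have hc1 : c ≤ 1 := by
      have h1 := real_inner_self_nonneg (x := u - p) (F := E3)
      simp only [inner_sub_left, inner_sub_right, huu, hpp, hup, ← hc] at h1
      linarith
    nlinarith
  · simp at hpb
    simp [← hpb]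

theorem exists_rot_eq_clm (g : SO3) : ∃ A : E3 →L[ℝ] E3, ∀ u, A u = rot g u :=
  ⟨LinearMap.toContinuousLinearMap
    { toFun := rot g, map_add' := rot_add g, map_smul' := rot_smul g }, fun _ => rfl⟩

section

variable {K : Subgroup SO3} {F : Set E3} {m l : ℕ} (gs : Fin m ≃ K) (fs : Fin l ≃ F)

theorem radialBound_factor {p : E3} (hp : p ∈ S2) {i j : Fin (m + l)}
    (h : symmetricConfiguration gs fs p j = symmetricConfiguration gs fs p i) :
    RadialBound p (-1) fun u =>
      ‖symmetricConfiguration gs fs u j - symmetricConfiguration gs fs u i‖ ^ 2 := by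
  have key : ∀ (A : E3 →L[ℝ] E3) (b : E3),
      (b = 0 ∨ (∀ u v, inner ℝ (A u) (A v) = inner ℝ u v) ∨ A = 0) →
      (∀ u, symmetricConfiguration gs fs u j - symmetricConfiguration gs fs u i = A u - b) →
      RadialBound p (-1) fun u =>
        ‖symmetricConfiguration gs fs u j - symmetricConfiguration gs fs u i‖ ^ 2 := by
    intro A b hA hAb
    have hpb : A p = b := by
      rw [← sub_eq_zero, ← hAb, h, sub_self]
    simp only [hAb]
    exact radialBound_of_eq_zero hp A b hA hpb
  clear h
  induction i using Fin.addCases with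
  | left i =>
    obtain ⟨A, hA⟩ := exists_rot_eq_clm (gs i : SO3)
    induction j using Fin.addCases with
    | left j =>
      obtain ⟨A', hA'⟩ := exists_rot_eq_clm (gs j : SO3)
      refine key (A' - A) 0 (Or.inl rfl) fun u => ?_
      rw [symmetricConfiguration_castAdd, symmetricConfiguration_castAdd, sub_zero,
        _root_.sub_apply, hA, hA']
    | right j =>
      refine key (-A) (-(fs j : E3)) (Or.inr (Or.inl fun u v => ?_)) fun u => ?_
      · rw [_root_.neg_apply, _root_.neg_apply, inner_neg_neg, hA, hA,
          inner_rot]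
      · rw [symmetricConfiguration_castAdd, symmetricConfiguration_natAdd,
          _root_.neg_apply, hA]
        abel
  | right i =>
    induction j using Fin.addCases with
    | left j =>
      obtain ⟨A, hA⟩ := exists_rot_eq_clm (gs j : SO3)
      refine key A (fs i) (Or.inr (Or.inl fun u v => ?_)) fun u => ?_
      · rw [hA, hA, inner_rot]
      · rw [symmetricConfiguration_castAdd, symmetricConfiguration_natAdd, hA]
    | right j =>
      refine key 0 (fs i - fs j) (Or.inr (Or.inr rfl)) fun u => ?_
      rw [symmetricConfiguration_natAdd, symmetricConfiguration_natAdd,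
        _root_.zero_apply]
      abel

/-- Every factor that vanishes at the collision `p` contributes a rate of at most `-1`, and the
contribution of the other factors is arbitrarily small. -/
theorem radialBound_distanceProduct {p : E3} (hp : p ∈ S2) (h0 : distanceProduct gs fs p = 0) :
    RadialBound p (-(1 / 2)) (distanceProduct gs fs) := by
  classical
  set f : (Σ _ : Fin (m + l), Fin (m + l)) → E3 → ℝ := fun x u =>
    ‖symmetricConfiguration gs fs u x.2 - symmetricConfiguration gs fs u x.1‖ ^ 2 with hf
  set s : Finset (Σ _ : Fin (m + l), Fin (m + l)) :=
    Finset.univ.sigma fun i => Finset.Ioi i with hs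
  have hprod : distanceProduct gs fs = fun u => ∏ x ∈ s, f x u := by
    funext u
    rw [distanceProduct, Finset.prod_sigma']
  rw [hprod] at h0 ⊢
  obtain ⟨a, ha, hfa⟩ := Finset.prod_eq_zero_iff.1 h0
  have hzero : ∀ x, f x p = 0 → RadialBound p (-1) (f x) := fun x hx =>
    radialBound_factor gs fs hp (sub_eq_zero.1 (norm_eq_zero.1 (pow_eq_zero_iff two_ne_zero |>.1 hx)))
  have hε : (0 : ℝ) < 1 / (2 * ((s.erase a).card + 1)) := by positivity
  have hrest := RadialBound.finset_prod (s.erase a) (f := f)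
    (α := 1 / (2 * ((s.erase a).card + 1))) (p := p) fun x _ => by
      by_cases hx : f x p = 0
      · exact (hzero x hx).mono (by linarith)
      · exact radialBound_of_ne_zero hp (ContDiff.norm_sq ℝ
          ((contDiff_symmetricConfiguration gs fs _).sub (contDiff_symmetricConfiguration gs fs _)))
          (fun u => sq_nonneg _) hx hε
  have h1 := (hzero a hfa).mul hrest
  have h2 : (fun u => f a u * ∏ x ∈ s.erase a, f x u) = fun u => ∏ x ∈ s, f x u :=
    funext fun u => Finset.mul_prod_erase s (fun x => f x u) ha
  rw [h2] at h1
  refine h1.mono ?_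
  have h3 : ((s.erase a).card : ℝ) * (1 / (2 * ((s.erase a).card + 1))) ≤ 1 / 2 := by
    rw [mul_one_div, div_le_iff₀ (by positivity)]
    linarith
  linarith

/-! ### The reduced system -/

theorem isLogHamiltonian_reducedHamiltonian (hF : F ⊆ isotropyPoints K) :
    IsLogHamiltonian (phaseSpace K) (reducedField gs fs) (reducedHamiltonian gs fs)
      (distanceProduct gs fs) (2 * m) := by
  have hm : 0 < m := (gs.symm 1).pos
  have hm' : (0 : ℝ) < m := Nat.cast_pos.2 hm
  have hG : ContDiff ℝ ω (distanceProduct gs fs) := contDiff_distanceProduct gs fs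
  refine ⟨hG, distanceProduct_nonneg gs fs, by positivity, ?_,
    fun u hu => reducedHamiltonian_eq gs fs hu, ?_⟩
  · intro u
    exact and_congr_right fun hu => (distanceProduct_eq_zero_iff gs fs hF hu).not.symm
  · intro u hu
    have hev : reducedHamiltonian gs fs =ᶠ[𝓝 u]
        fun u => -(1 / 2) * Real.log (distanceProduct gs fs u) := by
      filter_upwards [(isOpen_ne.preimage hG.continuous).mem_nhds
        (show u ∈ distanceProduct gs fs ⁻¹' {x | x ≠ 0} from hu)] with v hv
      exact reducedHamiltonian_eq gs fs hv
    have hd := ((hG.differentiable (by simp) u).hasFDerivAt.log hu).const_mul (-(1 / 2))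
    have hgrad : gradient (reducedHamiltonian gs fs) u =
        (-(1 / 2) * (distanceProduct gs fs u)⁻¹) • gradient (distanceProduct gs fs) u := by
      rw [gradient, gradient, hev.fderiv_eq, hd.fderiv, smul_smul, map_smul]
    rw [reducedField, hamiltonianField, hgrad, cross_smul_right, smul_smul]
    congr 1
    field_simp

theorem eventually_cross_ne_zero (hK : IsDihedralOrPolyhedral K) (hF : F ⊆ isotropyPoints K)
    (u₀ : E3) : ∀ᶠ u in 𝓝 u₀, u ∈ S2 →
      cross u (gradient (distanceProduct gs fs) u) = 0 → u = u₀ := by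
  have hG : ContDiff ℝ ω (distanceProduct gs fs) := contDiff_distanceProduct gs fs
  obtain ⟨t, ht, htc⟩ := exists_four_isotropyPoints hK
  have hfin := (isPointProduct_distanceProduct gs fs fun x hx => (hF hx).1).finite_critical
    (hG.differentiable (by simp))
    (fun p hp => ⟨(ht p hp).1, (distanceProduct_eq_zero_iff gs fs hF (ht p hp).1).2 (ht p hp)⟩) htc
  have hcl := (hfin.subset (sdiff_subset (t := {u₀}))).isClosed
  filter_upwards [hcl.isOpen_compl.mem_nhds fun h => h.2 rfl] with u hu huS h0
  by_contra hne
  exact hu ⟨⟨huS, (isCriticalOnSphere_iff huS).2 h0⟩, hne⟩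

end

/-! ### Families around extrema and collision points -/

section

variable {D : Set E3} {X : E3 → E3} {h : E3 → ℝ} {k : ℝ}

theorem IsLogHamiltonian.exists_family_of_isLocalMinOn (H : IsLogHamiltonian D X h G k)
    (hΦ : IsSphereFlow G Φ) {u₀ : E3} (hu₀ : u₀ ∈ D)
    (hiso : ∀ᶠ u in 𝓝 u₀, u ∈ S2 → cross u (gradient G u) = 0 → u = u₀)
    (hmin : IsLocalMinOn (fun u => -1 * G u) S2 u₀) :
    ∃ ε > 0, ∃ (γ : ℝ → ℝ → E3) (T : ℝ → ℝ), IsPeriodicFamilyAround D X h u₀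
      (Ioo (h u₀) (h u₀ + ε)) (fun e => Ioo (h u₀) e) (𝓝[>] (h u₀)) γ T := by
  obtain ⟨hS, hG₀⟩ := (H.mem_iff u₀).1 hu₀
  obtain ⟨w, hw, huw⟩ := exists_unit_orthogonal u₀
  obtain ⟨δ, -, -, η, hη, σ, -, hfam⟩ :=
    H.exists_family hΦ hS hw huw hiso (by norm_num : (-1 : ℝ) ≠ 0) hmin
  set ρ : ℝ → ℝ := fun e => -1 * (Real.exp (-2 * e) - G u₀) with hρ
  have hρ' : ∀ e, ρ e = Real.exp (-2 * h u₀) - Real.exp (-2 * e) := fun e => by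
    rw [hρ, H.G_eq_exp hG₀]; ring
  have hρm : ∀ a b, ρ a < ρ b ↔ a < b := by
    intro a b
    rw [hρ', hρ', sub_lt_sub_iff_left, Real.exp_lt_exp]
    constructor <;> intro <;> linarith
  have hρ0 : ρ (h u₀) = 0 := by rw [hρ', sub_self]
  have hρc : Continuous ρ := by fun_prop
  have hev : ∀ᶠ e in 𝓝 (h u₀), ρ e < η := hρc.continuousAt.eventually (gt_mem_nhds (hρ0 ▸ hη))
  obtain ⟨ε, hε, hball⟩ := Metric.eventually_nhds_iff.1 hev
  refine ⟨ε, hε, _, hfam _ _ _ ρ (fun _ => rfl) ?_ ?_ (Ioo_mem_nhdsGT (by linarith)) ?_⟩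
  · intro e he
    refine ⟨by rw [← hρ0, hρm]; exact he.1, hball ?_⟩
    rw [Real.dist_eq, abs_of_pos (by linarith [he.1])]
    linarith [he.2]
  · intro e _ e'
    rw [hρm, ← hρ0, hρm]
    rfl
  · exact (hρ0 ▸ hρc.tendsto (h u₀)).mono_left nhdsWithin_le_nhds

theorem IsLogHamiltonian.exists_family_of_isLocalMaxOn (H : IsLogHamiltonian D X h G k)
    (hΦ : IsSphereFlow G Φ) {u₀ : E3} (hu₀ : u₀ ∈ D)
    (hiso : ∀ᶠ u in 𝓝 u₀, u ∈ S2 → cross u (gradient G u) = 0 → u = u₀)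
    (hmax : IsLocalMinOn (fun u => 1 * G u) S2 u₀) :
    ∃ ε > 0, ∃ (γ : ℝ → ℝ → E3) (T : ℝ → ℝ), IsPeriodicFamilyAround D X h u₀
      (Ioo (h u₀ - ε) (h u₀)) (fun e => Ioo e (h u₀)) (𝓝[<] (h u₀)) γ T := by
  obtain ⟨hS, hG₀⟩ := (H.mem_iff u₀).1 hu₀
  obtain ⟨w, hw, huw⟩ := exists_unit_orthogonal u₀
  obtain ⟨δ, -, -, η, hη, σ, -, hfam⟩ := H.exists_family hΦ hS hw huw hiso one_ne_zero hmax
  set ρ : ℝ → ℝ := fun e => 1 * (Real.exp (-2 * e) - G u₀) with hρ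
  have hρ' : ∀ e, ρ e = Real.exp (-2 * e) - Real.exp (-2 * h u₀) := fun e => by
    rw [hρ, H.G_eq_exp hG₀]; ring
  have hρm : ∀ a b, ρ a < ρ b ↔ b < a := by
    intro a b
    rw [hρ', hρ', sub_lt_sub_iff_right, Real.exp_lt_exp]
    constructor <;> intro <;> linarith
  have hρ0 : ρ (h u₀) = 0 := by rw [hρ', sub_self]
  have hρc : Continuous ρ := by fun_prop
  have hev : ∀ᶠ e in 𝓝 (h u₀), ρ e < η := hρc.continuousAt.eventually (gt_mem_nhds (hρ0 ▸ hη))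
  obtain ⟨ε, hε, hball⟩ := Metric.eventually_nhds_iff.1 hev
  refine ⟨ε, hε, _, hfam _ _ _ ρ (fun _ => rfl) ?_ ?_ (Ioo_mem_nhdsLT (by linarith)) ?_⟩
  · intro e he
    refine ⟨by rw [← hρ0, hρm]; exact he.2, hball ?_⟩
    rw [Real.dist_eq, abs_of_neg (by linarith [he.2])]
    linarith [he.1]
  · intro e _ e'
    rw [hρm, ← hρ0, hρm, and_comm]
    rfl
  · exact (hρ0 ▸ hρc.tendsto (h u₀)).mono_left nhdsWithin_le_nhds

theorem IsLogHamiltonian.tendsto_atTop (H : IsLogHamiltonian D X h G k) {p : E3} (hp : G p = 0) :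
    Tendsto h (𝓝[D] p) atTop := by
  have h1 : Tendsto G (𝓝[D] p) (𝓝[≠] 0) := by
    refine tendsto_nhdsWithin_iff.2 ⟨?_, ?_⟩
    · have := H.continuous.tendsto p
      rw [hp] at this
      exact this.mono_left nhdsWithin_le_nhds
    · exact eventually_mem_nhdsWithin.mono fun u hu => ((H.mem_iff u).1 hu).2
  have h2 := (Real.tendsto_log_nhdsNE_zero.comp h1).const_mul_atBot_of_neg
    (show (-(1 / 2) : ℝ) < 0 by norm_num)
  refine h2.congr' (eventually_mem_nhdsWithin.mono fun u hu => ?_)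
  exact (H.energy_eq u ((H.mem_iff u).1 hu).2).symm

/-- Around a zero of `G` the angular velocity of the orbits tends to infinity. -/
theorem IsLogHamiltonian.exists_family_of_zero (H : IsLogHamiltonian D X h G k)
    (hΦ : IsSphereFlow G Φ) {p : E3} (hS : p ∈ S2) (hp : G p = 0)
    (hiso : ∀ᶠ u in 𝓝 p, u ∈ S2 → cross u (gradient G u) = 0 → u = p)
    (hrad : RadialBound p (-(1 / 2)) G) :
    ∃ (E : ℝ) (γ : ℝ → ℝ → E3) (T : ℝ → ℝ), IsPeriodicFamilyAround D X h p
      (Ioi E) (fun e => Ioi e) atTop γ T ∧ Tendsto T atTop (𝓝 0) := by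
  obtain ⟨w, hw, hpw⟩ := exists_unit_orthogonal p
  have hmin : IsLocalMinOn (fun u => 1 * G u) S2 p := Eventually.of_forall fun u => by
    simpa [hp] using H.nonneg u
  obtain ⟨δ, hδ, hmono, η, hη, σ, hσ, hfam⟩ := H.exists_family hΦ hS hw hpw hiso one_ne_zero hmin
  have hinj : InjOn (fun s => G (greatCircle p w s)) (Icc 0 δ) := by
    intro s hs t ht hst
    refine hmono.injOn hs ht ?_
    simp only [show G (greatCircle p w s) = G (greatCircle p w t) from hst]
  obtain ⟨r₀, hr₀, hshort⟩ := hΦ.exists_short_return H.contDiff_two hS hw hpw hp hrad.bound hδ hinj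
  set ρ : ℝ → ℝ := fun e => Real.exp (-2 * e) with hρ
  have hρ1 : ∀ e, ρ e = 1 * (Real.exp (-2 * e) - G p) := fun e => by rw [hp, sub_zero, one_mul]
  have hρ0 : Tendsto ρ atTop (𝓝 0) := Real.tendsto_exp_atBot.comp
    (tendsto_id.const_mul_atTop_of_neg (by norm_num : (-2 : ℝ) < 0))
  obtain ⟨E, hE⟩ := eventually_atTop.1 (hρ0.eventually (gt_mem_nhds hη))
  have hI : ∀ e ∈ Ioi E, ρ e ∈ Ioo 0 η := fun e he => ⟨Real.exp_pos _, hE e (le_of_lt he)⟩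
  have hl : ∀ᶠ e in atTop, e ∈ Ioi E := eventually_gt_atTop E
  obtain ⟨T, hT⟩ := hfam (Ioi E) (fun e => Ioi e) atTop ρ hρ1 hI (fun e _ e' => by
    rw [and_iff_right (Real.exp_pos _), Real.exp_lt_exp, mem_Ioi]
    constructor <;> intro <;> linarith) hl hρ0
  refine ⟨E, _, T, hT, ?_⟩
  refine Metric.tendsto_nhds.2 fun ε hε => ?_
  -- small enough that the period bound `4 π k r²` is below `ε`
  obtain ⟨r, hr, hrε⟩ : ∃ r ∈ Ioc 0 r₀, 4 * Real.pi * k * r ^ 2 < ε := by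
    have hc : Continuous fun r : ℝ => 4 * Real.pi * k * r ^ 2 := by fun_prop
    have h1 : ∀ᶠ r in 𝓝[>] (0 : ℝ), 4 * Real.pi * k * r ^ 2 < ε :=
      nhdsWithin_le_nhds (hc.continuousAt.eventually (gt_mem_nhds (by simpa using hε)))
    obtain ⟨r, h2, h3⟩ := (h1.and (Ioc_mem_nhdsGT hr₀)).exists
    exact ⟨r, h3, h2⟩
  filter_upwards [hl, hT.approach _ (Metric.ball_mem_nhds p hr.1)] with e he hball
  obtain ⟨-, hTpos, -, hTmin⟩ := hT.periodic e he
  have hkg : 0 < k * Real.exp (-2 * e) := mul_pos H.pos (Real.exp_pos _)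
  obtain ⟨hσI, hσρ⟩ := hσ (ρ e) (hI e he)
  rw [hp, sub_zero, one_mul] at hσρ
  rw [range_reparam (fun t => Φ t (greatCircle p w (σ (ρ e)))) hkg.ne'] at hball
  obtain ⟨t, ht, htr, htx⟩ := hshort r hr (σ (ρ e)) hσI (by rw [hσρ]; exact Real.exp_pos _) fun t => by
    rw [← dist_eq_norm]
    exact le_of_lt (hball ⟨t, rfl⟩)
  have hle : T e ≤ k * Real.exp (-2 * e) * t := by
    by_contra! hlt
    refine hTmin _ ⟨mul_pos hkg ht, hlt⟩ fun s => ?_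
    simp only [add_div, mul_div_cancel_left₀ t hkg.ne']
    exact hΦ.periodic htx _
  rw [Real.dist_eq, sub_zero, abs_of_pos hTpos]
  refine (hle.trans ?_).trans_lt hrε
  rw [hσρ, le_div_iff₀ (Real.exp_pos _)] at htr
  calc k * Real.exp (-2 * e) * t = k * (t * Real.exp (-2 * e)) := by ring
    _ ≤ k * (4 * Real.pi * r ^ 2) := mul_le_mul_of_nonneg_left htr H.pos.le
    _ = 4 * Real.pi * k * r ^ 2 := by ring

end

end SphereVortex

theorem proposition3p8
    (K : Subgroup SO3) (hK : IsDihedralOrPolyhedral K)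
    (F : Set E3) (hF : F ⊆ isotropyPoints K)
    (hinv : ∀ g ∈ K, ∀ f ∈ F, rot g f ∈ F)
    (m l : ℕ) (gs : Fin m ≃ K) (fs : Fin l ≃ F) :
    -- (i) non-collision equilibria, local extrema, saddle points
    ((∀ u ∈ phaseSpace K, IsEquilibrium (phaseSpace K) (reducedField gs fs) u ↔
        IsCriticalOnSphere (reducedHamiltonian gs fs) u) ∧
      (∀ u₀ ∈ phaseSpace K, IsLocalMinOn (reducedHamiltonian gs fs) (phaseSpace K) u₀ →
        IsEquilibrium (phaseSpace K) (reducedField gs fs) u₀ ∧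
        IsLyapunovStable (phaseSpace K) (reducedField gs fs) u₀ ∧
        ∃ ε > 0, ∃ (γ : ℝ → ℝ → E3) (T : ℝ → ℝ),
          IsPeriodicFamilyAround (phaseSpace K) (reducedField gs fs) (reducedHamiltonian gs fs) u₀
            (Ioo (reducedHamiltonian gs fs u₀) (reducedHamiltonian gs fs u₀ + ε))
            (fun e => Ioo (reducedHamiltonian gs fs u₀) e) (𝓝[>] (reducedHamiltonian gs fs u₀)) γ T) ∧
      (∀ u₀ ∈ phaseSpace K, IsLocalMaxOn (reducedHamiltonian gs fs) (phaseSpace K) u₀ →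
        IsEquilibrium (phaseSpace K) (reducedField gs fs) u₀ ∧
        IsLyapunovStable (phaseSpace K) (reducedField gs fs) u₀ ∧
        ∃ ε > 0, ∃ (γ : ℝ → ℝ → E3) (T : ℝ → ℝ),
          IsPeriodicFamilyAround (phaseSpace K) (reducedField gs fs) (reducedHamiltonian gs fs) u₀
            (Ioo (reducedHamiltonian gs fs u₀ - ε) (reducedHamiltonian gs fs u₀))
            (fun e => Ioo e (reducedHamiltonian gs fs u₀)) (𝓝[<] (reducedHamiltonian gs fs u₀)) γ T) ∧
      (∀ u₀ ∈ phaseSpace K, IsCriticalOnSphere (reducedHamiltonian gs fs) u₀ →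
        ¬ IsLocalExtrOn (reducedHamiltonian gs fs) (phaseSpace K) u₀ →
        IsEquilibrium (phaseSpace K) (reducedField gs fs) u₀ ∧
        ¬ IsLyapunovStable (phaseSpace K) (reducedField gs fs) u₀)) ∧
    -- (ii) regular level sets
    (∀ c : ℝ, (∀ u ∈ levelSet (phaseSpace K) (reducedHamiltonian gs fs) c,
        ¬ IsCriticalOnSphere (reducedHamiltonian gs fs) u) →
      ∀ u ∈ levelSet (phaseSpace K) (reducedHamiltonian gs fs) c,
        IsPeriodicOrbit (phaseSpace K) (reducedField gs fs)
          (connectedComponentIn (levelSet (phaseSpace K) (reducedHamiltonian gs fs) c) u)) ∧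
    -- (iii) collision equilibria
    (∀ u₀ ∈ isotropyPoints K,
      Tendsto (reducedHamiltonian gs fs) (𝓝[phaseSpace K] u₀) atTop ∧
      ∃ (E : ℝ) (γ : ℝ → ℝ → E3) (T : ℝ → ℝ),
        IsPeriodicFamilyAround (phaseSpace K) (reducedField gs fs) (reducedHamiltonian gs fs) u₀
          (Ioi E) (fun e => Ioi e) atTop γ T ∧
        Tendsto T atTop (𝓝 0)) := by
  have H := isLogHamiltonian_reducedHamiltonian gs fs hF
  have hiso := eventually_cross_ne_zero gs fs hK hF
  obtain ⟨Φ, hΦ⟩ := exists_isSphereFlow H.contDiff_two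
  have hmin : ∀ u₀ ∈ phaseSpace K,
      IsLocalMinOn (reducedHamiltonian gs fs) (phaseSpace K) u₀ →
      IsLocalMinOn (fun u => -1 * distanceProduct gs fs u) S2 u₀ := fun u₀ hu₀ hext => by
    simpa using ((H.isLocalMinOn_iff hu₀).1 hext).neg
  have hmax : ∀ u₀ ∈ phaseSpace K,
      IsLocalMaxOn (reducedHamiltonian gs fs) (phaseSpace K) u₀ →
      IsLocalMinOn (fun u => 1 * distanceProduct gs fs u) S2 u₀ := fun u₀ hu₀ hext => by
    simpa using (H.isLocalMaxOn_iff hu₀).1 hext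
  have hcrit : ∀ u₀ ∈ phaseSpace K,
      IsLocalExtrOn (distanceProduct gs fs) S2 u₀ →
      IsEquilibrium (phaseSpace K) (reducedField gs fs) u₀ := fun u₀ hu₀ hext =>
    (H.isEquilibrium_iff hu₀).2 ((H.isCritical_iff hu₀).2 ((isCriticalOnSphere_iff hu₀.1).1
      (isCriticalOnSphere_of_isLocalExtrOn (H.differentiable u₀) hu₀.1 hext)))
  refine ⟨⟨fun u hu => H.isEquilibrium_iff hu, fun u₀ hu₀ hext => ⟨?_, ?_, ?_⟩,
    fun u₀ hu₀ hext => ⟨?_, ?_, ?_⟩, fun u₀ hu₀ hc hext => ⟨?_, ?_⟩⟩, fun c hc u hu =>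
    H.isPeriodicOrbit_component hΦ hc hu, fun u₀ hu₀ => ⟨?_, ?_⟩⟩
  · exact hcrit u₀ hu₀ (Or.inr ((H.isLocalMinOn_iff hu₀).1 hext))
  · exact H.isLyapunovStable hΦ hu₀.1 (hiso u₀) (by norm_num) (hmin u₀ hu₀ hext)
  · exact H.exists_family_of_isLocalMinOn hΦ hu₀ (hiso u₀) (hmin u₀ hu₀ hext)
  · exact hcrit u₀ hu₀ (Or.inl ((H.isLocalMaxOn_iff hu₀).1 hext))
  · exact H.isLyapunovStable hΦ hu₀.1 (hiso u₀) one_ne_zero (hmax u₀ hu₀ hext)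
  · exact H.exists_family_of_isLocalMaxOn hΦ hu₀ (hiso u₀) (hmax u₀ hu₀ hext)
  · exact (H.isEquilibrium_iff hu₀).2 hc
  · exact H.not_isLyapunovStable hΦ hu₀ (hiso u₀) hext
  · exact H.tendsto_atTop ((distanceProduct_eq_zero_iff gs fs hF hu₀.1).2 hu₀)
  · have h0 := (distanceProduct_eq_zero_iff gs fs hF hu₀.1).2 hu₀
    exact H.exists_family_of_zero hΦ hu₀.1 h0 (hiso u₀) (radialBound_distanceProduct gs fs hu₀.1 h0)
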